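/- **Proposition (norm compatibility).** Let $p$ be an odd prime. For $n\ge 0$ let $k_n=\mathbb Q(\mu_{p^{n+1}})$, $G_n=\mathrm{Gal}(k_n/\mathbb Q)$, let $\sigma_{-1}\in G_n$ be the automorphism acting on $\mu_{p^{n+1}}$ by $\zeta\mapsto\zeta^{-1}$, and let $I_n$ be the group of fractional ideals of $k_n$ prime to $p$. Let $\Omega$ be the compositum of all the fields $\mathbb Q(\zeta_m)$ with $m$ prime to $p$; the group $G_n$ acts on $\Omega(\zeta_{p^{n+1}})^\times$ through the restriction isomorphism $\mathrm{Gal}(\Omega(\zeta_{p^{n+1}})/\Omega)\simeq G_n$. For every prime number $l$ fix a primitive $l$-th root of unity $\zeta_l$ (the same at all levels $n$). For a prime ideal $\mathfrak l\nmid p$ of $k_n$, above the prime number $l$ and with residue field $\mathbb F_q$, let $\chi_{\mathfrak l}:\mathbb F_q^\times\to\mu_{p^{n+1}}$ be the character with $\chi_{\mathfrak l}(x)\equiv x^{-(q-1)/p^{n+1}}\pmod{\mathfrak l}$, and let $$\tau_n(\mathfrak l)=-\sum_{a\in\mathbb F_q^\times}\chi_{\mathfrak l}(a)\,\zeta_l^{\mathrm{Tr}_{\mathbb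 F_q/\mathbb F_l}(a)} .$$ Extend $\tau_n$ multiplicatively to a homomorphism $\tau_n:I_n\to\Omega(\zeta_{p^{n+1}})^\times$. The Jacobi module is $$\mathcal J_n=\mathbb Z[G_n]\,\tau_n\cap \mathrm{Hom}_{\mathbb Z[G_n]}(I_n,k_n^\times),$$ and its minus part is $\mathcal J_n^-=\{f\in\mathcal J_n : \sigma_{-1}f=f^{-1}\}$. For $n\ge1$ let $N_{n,n-1}$ denote both the norm $k_n^\times\to k_{n-1}^\times\subset k_n^\times$ and the norm of ideals $I_n\to I_{n-1}$. Then, for every $n\ge 1$, $$N_{n,n-1}\circ\mathcal J_n^-\equiv\mathcal J_{n-1}^-\circ N_{n,n-1}\pmod{\mathrm{Hom}_{\mathbb Z[G_n]}(I_n,\mu_{2p^{n+1}})},$$ that is, in the group of homomorphisms $I_n\to k_n^\times$ one has the equality of subgroups $$\{N_{n,n-1}\circ f: f\in\mathcal J_n^-\}\cdot\mathrm{Hom}_{\mathbb Z[G_n]}(I_n,\mu_{2p^{n+1}})=\{g\circ N_{n,n-1}: g\in\mathcal J_{n-1}^-\}\cdot\mathrm{Hom}_{\mathbb Z[G_n]}(I_n,\mu_{2p^{n+1}}).$$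 -/

import Mathlib

open NumberField IsDedekindDomain
open scoped nonZeroDivisors

noncomputable section

namespace JacobiNorm

/-- The group of (nonzero) fractional ideals of a number field. -/
abbrev FracIdeals (K : Type*) [Field K] [NumberField K] : Type _ :=
  (FractionalIdeal (𝓞 K)⁰ K)ˣ

/-- A prime ideal, as an element of the group of fractional ideals. -/
def primeUnit {K : Type*} [Field K] [NumberField K] (v : HeightOneSpectrum (𝓞 K)) :
    FracIdeals K :=
  Units.mk0 (v.asIdeal : FractionalIdeal (𝓞 K)⁰ K)
    (FractionalIdeal.coeIdeal_ne_zero.mpr v.ne_bot)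

theorem hasFiniteMulSupport_count {K : Type*} [Field K] [NumberField K] {A : Type*} [CommGroup A]
    (φ : HeightOneSpectrum (𝓞 K) → A) (a : FracIdeals K) :
    (Function.mulSupport
      fun v ↦ φ v ^ FractionalIdeal.count K v (a : FractionalIdeal (𝓞 K)⁰ K)).Finite := by
  have h := FractionalIdeal.finite_factors (K := K) (a : FractionalIdeal (𝓞 K)⁰ K)
  rw [Filter.eventually_cofinite] at h
  refine h.subset fun v hv h0 ↦ hv ?_
  simp only [h0, zpow_zero]

/-- The multiplicative extension to all fractional ideals of a function on the primes:
`∏ v ^ (m v)` is sent to `∏ (φ v) ^ (m v)`. -/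
def primeExt {K : Type*} [Field K] [NumberField K] {A : Type*} [CommGroup A]
    (φ : HeightOneSpectrum (𝓞 K) → A) : FracIdeals K →* A where
  toFun a := ∏ᶠ v, φ v ^ FractionalIdeal.count K v (a : FractionalIdeal (𝓞 K)⁰ K)
  map_one' := by
    simp only [Units.val_one, FractionalIdeal.count_one, zpow_zero, finprod_one]
  map_mul' a b := by
    rw [← finprod_mul_distrib (hasFiniteMulSupport_count φ a) (hasFiniteMulSupport_count φ b)]
    refine finprod_congr fun v ↦ ?_
    rw [Units.val_mul, FractionalIdeal.count_mul K v a.ne_zero b.ne_zero, zpow_add]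

theorem primeExt_primeUnit {K : Type*} [Field K] [NumberField K] {A : Type*} [CommGroup A]
    (φ : HeightOneSpectrum (𝓞 K) → A) (v : HeightOneSpectrum (𝓞 K)) :
    primeExt φ (primeUnit v) = φ v := by
  change ∏ᶠ w, φ w ^ FractionalIdeal.count K w (v.asIdeal : FractionalIdeal (𝓞 K)⁰ K) = φ v
  rw [finprod_eq_single _ v]
  · rw [FractionalIdeal.count_self, zpow_one]
  · intro w hw
    rw [FractionalIdeal.count_maximal_coprime K w hw.symm, zpow_zero]

theorem eq_finprod_primeUnit {K : Type*} [Field K] [NumberField K] (a : FracIdeals K) :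
    a = ∏ᶠ v, primeUnit v ^ FractionalIdeal.count K v (a : FractionalIdeal (𝓞 K)⁰ K) := by
  apply Units.ext
  conv_lhs => rw [← FractionalIdeal.finprod_heightOneSpectrum_factorization' K a.ne_zero]
  have := MonoidHom.map_finprod (Units.coeHom (FractionalIdeal (𝓞 K)⁰ K))
    (hasFiniteMulSupport_count primeUnit a)
  rw [Units.coeHom_apply] at this
  rw [this]
  refine finprod_congr fun v ↦ ?_
  rw [Units.coeHom_apply, Units.val_zpow_eq_zpow_val]
  rfl

/-- The group of fractional ideals of `K` prime to `p`: no prime above `p` occurs in the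
factorization. -/
def primeToP (p : ℕ) (K : Type*) [Field K] [NumberField K] : Subgroup (FracIdeals K) where
  carrier := {a | ∀ v : HeightOneSpectrum (𝓞 K), (p : 𝓞 K) ∈ v.asIdeal →
    FractionalIdeal.count K v (a : FractionalIdeal (𝓞 K)⁰ K) = 0}
  mul_mem' {a b} ha hb v hv := by
    rw [Units.val_mul, FractionalIdeal.count_mul K v a.ne_zero b.ne_zero, ha v hv, hb v hv,
      add_zero]
  one_mem' v _ := by rw [Units.val_one, FractionalIdeal.count_one]
  inv_mem' {a} ha v hv := by
    rw [Units.val_inv_eq_inv_val, FractionalIdeal.count_inv, ha v hv, neg_zero]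

theorem map_mem_primeToP {p : ℕ} {K L : Type*} [Field K] [NumberField K] [Field L] [NumberField L]
    (g : FracIdeals K →* FracIdeals L)
    (hg : ∀ v : HeightOneSpectrum (𝓞 K), (p : 𝓞 K) ∉ v.asIdeal → g (primeUnit v) ∈ primeToP p L)
    {a : FracIdeals K} (ha : a ∈ primeToP p K) : g a ∈ primeToP p L := by
  rw [eq_finprod_primeUnit a, MonoidHom.map_finprod g (hasFiniteMulSupport_count primeUnit a)]
  refine finprod_induction (· ∈ primeToP p L) (one_mem _) (fun _ _ ↦ mul_mem) fun v ↦ ?_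
  by_cases hv : (p : 𝓞 K) ∈ v.asIdeal
  · rw [ha v hv, zpow_zero, map_one]
    exact one_mem _
  · rw [map_zpow]
    exact zpow_mem (hg v hv) _

/-- The action of a field automorphism on fractional ideals, `a ↦ σ(a)`. -/
def idealMap {K : Type*} [Field K] [NumberField K] (σ : K ≃+* K) : FracIdeals K →* FracIdeals K :=
  Units.map (FractionalIdeal.ringEquivOfRingEquiv K K
    (RingOfIntegers.mapRingEquiv σ)).toRingHom.toMonoidHom

theorem mem_idealMap {K : Type*} [Field K] [NumberField K] (σ : K ≃+* K) (a : FracIdeals K)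
    (x : K) : x ∈ (idealMap σ a : FractionalIdeal (𝓞 K)⁰ K) ↔
      ∃ y ∈ (a : FractionalIdeal (𝓞 K)⁰ K), σ y = x := by
  have key : ∀ y : K, (IsFractionRing.ringEquivOfRingEquiv (RingOfIntegers.mapRingEquiv σ) :
      K ≃+* K) y = σ y := by
    intro y
    have hring : (IsFractionRing.ringEquivOfRingEquiv (RingOfIntegers.mapRingEquiv σ) :
        K ≃+* K).toRingHom = σ.toRingHom := by
      apply IsLocalization.ringHom_ext (𝓞 K)⁰
      ext z
      simp [RingOfIntegers.mapRingEquiv_apply]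
    exact congrArg (fun f : K →+* K ↦ f y) hring
  constructor
  · rintro ⟨y, hy, rfl⟩
    exact ⟨y, hy, (key y).symm⟩
  · rintro ⟨y, hy, rfl⟩
    exact ⟨y, hy, key y⟩

theorem count_coe_eq_zero {K : Type*} [Field K] [NumberField K] {J : Ideal (𝓞 K)}
    (w : HeightOneSpectrum (𝓞 K)) (h : ¬ J ≤ w.asIdeal) :
    FractionalIdeal.count K w (J : FractionalIdeal (𝓞 K)⁰ K) = 0 := by
  classical
  have hJ : J ≠ 0 := by
    rintro rfl
    exact h bot_le
  rw [FractionalIdeal.count_coe K w hJ]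
  by_contra h0
  exact h (Ideal.dvd_iff_le.mp ((Associates.count_ne_zero_iff_dvd hJ w.irreducible).mp
    (by exact_mod_cast h0)))

theorem idealMap_mem_primeToP {p : ℕ} {K : Type*} [Field K] [NumberField K] (σ : K ≃+* K)
    {a : FracIdeals K} (ha : a ∈ primeToP p K) : idealMap σ a ∈ primeToP p K := by
  refine map_mem_primeToP _ (fun v hv w hw ↦ ?_) ha
  have h1 : (idealMap σ (primeUnit v) : FractionalIdeal (𝓞 K)⁰ K) =
      (v.asIdeal.map (RingOfIntegers.mapRingEquiv σ) : Ideal (𝓞 K)) := by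
    ext x
    rw [mem_idealMap, FractionalIdeal.mem_coeIdeal]
    constructor
    · rintro ⟨y, hy, rfl⟩
      obtain ⟨z, hz, rfl⟩ := (FractionalIdeal.mem_coeIdeal _).mp hy
      exact ⟨RingOfIntegers.mapRingEquiv σ z, Ideal.mem_map_of_mem _ hz, rfl⟩
    · rintro ⟨z, hz, rfl⟩
      obtain ⟨y, hy, rfl⟩ := (Ideal.mem_map_of_equiv _ z).mp hz
      exact ⟨y, (FractionalIdeal.mem_coeIdeal _).mpr ⟨y, hy, rfl⟩, rfl⟩
  rw [h1]
  refine count_coe_eq_zero w fun hle ↦ hv ?_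
  rw [Ideal.map_le_iff_le_comap] at hle
  have hcomap : (w.asIdeal.comap (RingOfIntegers.mapRingEquiv σ)) ≠ ⊤ :=
    Ideal.comap_ne_top _ w.isPrime.ne_top
  rw [v.isMaximal.eq_of_le hcomap hle, Ideal.mem_comap, map_natCast]
  exact hw

/-- The norm of fractional ideals in an extension `L / K` of number fields: the multiplicative
extension of the relative norm of prime ideals. -/
def idealNorm (K L : Type*) [Field K] [NumberField K] [Field L] [NumberField L] [Algebra K L] :
    FracIdeals L →* FracIdeals K :=
  primeExt fun w ↦ Units.mk0 (Ideal.relNorm (𝓞 K) w.asIdeal : FractionalIdeal (𝓞 K)⁰ K)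
    (FractionalIdeal.coeIdeal_ne_zero.mpr (mt Ideal.relNorm_eq_bot_iff.mp w.ne_bot))

theorem idealNorm_mem_primeToP {p : ℕ} {K L : Type*} [Field K] [NumberField K] [Field L]
    [NumberField L] [Algebra K L] {a : FracIdeals L} (ha : a ∈ primeToP p L) :
    idealNorm K L a ∈ primeToP p K := by
  refine map_mem_primeToP _ (fun w hw v hv ↦ ?_) ha
  rw [idealNorm, primeExt_primeUnit, Units.val_mk0]
  have hP : w.asIdeal.LiesOver (w.asIdeal.under (𝓞 K)) := ⟨rfl⟩
  obtain ⟨s, hs⟩ := Ideal.exists_relNorm_eq_pow_of_isPrime w.asIdeal (w.asIdeal.under (𝓞 K))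
  rw [hs]
  refine count_coe_eq_zero v fun hle ↦ hw ?_
  have hle' : w.asIdeal.under (𝓞 K) ≤ v.asIdeal := Ideal.IsPrime.le_of_pow_le hle
  have hmax : (w.asIdeal.under (𝓞 K)).IsMaximal := inferInstance
  have hp : (p : 𝓞 K) ∈ w.asIdeal.under (𝓞 K) := by
    rw [hmax.eq_of_le v.isPrime.ne_top hle']
    exact hv
  simpa [Ideal.mem_comap] using hp

/-- The `p ^ (n + 1)`-th cyclotomic field `k_n`, inside `ℂ`. -/
def cycField (p n : ℕ) : IntermediateField ℚ ℂ :=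
  IntermediateField.adjoin ℚ {z : ℂ | z ^ p ^ (n + 1) = 1}

/-- `Ω`, the compositum of all the cyclotomic fields `ℚ(ζ_m)` with `m` prime to `p`. -/
def omegaField (p : ℕ) : IntermediateField ℚ ℂ :=
  IntermediateField.adjoin ℚ {z : ℂ | ∃ m : ℕ, m ≠ 0 ∧ m.Coprime p ∧ z ^ m = 1}

/-- The field `Ω(ζ_{p ^ (n + 1)})`. -/
def omegaCycField (p n : ℕ) : IntermediateField (omegaField p) ℂ :=
  IntermediateField.adjoin (omegaField p) {z : ℂ | z ^ p ^ (n + 1) = 1}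

theorem exists_primitiveRoot (m : ℕ) (hm : m ≠ 0) : ∃ r : ℂ, IsPrimitiveRoot r m :=
  ⟨_, Complex.isPrimitiveRoot_exp m hm⟩

theorem isCyclotomicExtension_adjoin (F : Type*) [Field F] [Algebra F ℂ] (m : ℕ) (hm : m ≠ 0) :
    IsCyclotomicExtension {m} F (IntermediateField.adjoin F {z : ℂ | z ^ m = 1}) := by
  have h := IntermediateField.isCyclotomicExtension_adjoin_of_exists_isPrimitiveRoot {m} F ℂ
    fun m _ hm ↦ exists_primitiveRoot m hm
  have hs : {b : ℂ | ∃ n ∈ ({m} : Set ℕ), n ≠ 0 ∧ b ^ n = 1} = {z : ℂ | z ^ m = 1} := by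
    ext z
    simp [hm]
  rwa [hs] at h

instance instCyc (p n : ℕ) [hp : Fact p.Prime] :
    IsCyclotomicExtension {p ^ (n + 1)} ℚ (cycField p n) :=
  isCyclotomicExtension_adjoin ℚ _ (pow_ne_zero _ hp.out.ne_zero)

instance instOmegaCyc (p n : ℕ) [hp : Fact p.Prime] :
    IsCyclotomicExtension {p ^ (n + 1)} (omegaField p) (omegaCycField p n) :=
  isCyclotomicExtension_adjoin (omegaField p) _ (pow_ne_zero _ hp.out.ne_zero)

theorem cyc_le_succ (p n : ℕ) : cycField p n ≤ cycField p (n + 1) := by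
  refine IntermediateField.adjoin.mono _ _ _ fun z hz ↦ ?_
  have hz' : z ^ p ^ (n + 1) = 1 := hz
  change z ^ p ^ (n + 1 + 1) = 1
  rw [pow_succ p (n + 1), pow_mul, hz', one_pow]

theorem cyc_le_OmegaCyc (p n : ℕ) :
    cycField p n ≤ (omegaCycField p n).restrictScalars ℚ :=
  IntermediateField.adjoin_le_iff.mpr fun _ hz ↦
    IntermediateField.subset_adjoin (omegaField p) _ hz

theorem exists_coprime_of_mem_Omega {p : ℕ} {x : ℂ} (hx : x ∈ omegaField p) :
    ∃ m : ℕ, m ≠ 0 ∧ m.Coprime p ∧ x ∈ IntermediateField.adjoin ℚ {z : ℂ | z ^ m = 1} := by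
  obtain ⟨T, hT, hxT⟩ := IntermediateField.exists_finset_of_mem_adjoin hx
  have hT' : ∀ z : T, ∃ m : ℕ, m ≠ 0 ∧ m.Coprime p ∧ (z : ℂ) ^ m = 1 := fun z ↦ hT z.2
  choose m hm0 hmp hm using hT'
  refine ⟨∏ z, m z, Finset.prod_ne_zero_iff.mpr fun z _ ↦ hm0 z,
    Nat.Coprime.prod_left fun z _ ↦ hmp z, ?_⟩
  refine IntermediateField.adjoin.mono _ _ _ (fun z hz ↦ ?_) hxT
  obtain ⟨c, hc⟩ := Finset.dvd_prod_of_mem m (Finset.mem_univ (⟨z, hz⟩ : T))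
  change z ^ _ = 1
  rw [hc, pow_mul, hm ⟨z, hz⟩, one_pow]

theorem cyc_inf_Omega (p n : ℕ) [hp : Fact p.Prime] : cycField p n ⊓ omegaField p = ⊥ := by
  refine eq_bot_iff.mpr fun x hx ↦ ?_
  obtain ⟨m, hm0, hmp, hxm⟩ := exists_coprime_of_mem_Omega hx.2
  let F : IntermediateField ℚ ℂ := IntermediateField.adjoin ℚ {z : ℂ | z ^ m = 1}
  have : NeZero m := ⟨hm0⟩
  have : NeZero (p ^ (n + 1)) := ⟨pow_ne_zero _ hp.out.ne_zero⟩
  have hF : IsCyclotomicExtension {m} ℚ F := isCyclotomicExtension_adjoin ℚ m hm0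
  have : NumberField F := IsCyclotomicExtension.numberField {m} ℚ F
  have : NumberField (cycField p n) :=
    IsCyclotomicExtension.numberField {p ^ (n + 1)} ℚ (cycField p n)
  have hcop : Nat.Coprime (NumberField.discr (cycField p n)).natAbs (NumberField.discr F).natAbs := by
    rw [IsCyclotomicExtension.Rat.natAbs_discr (p ^ (n + 1)) (cycField p n),
      IsCyclotomicExtension.Rat.natAbs_discr m F]
    refine Nat.Coprime.coprime_div_left ?_ (Nat.prod_primeFactors_pow_totient_ediv_dvd (NeZero.pos _))
    refine Nat.Coprime.coprime_div_right ?_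
      (Nat.prod_primeFactors_pow_totient_ediv_dvd (NeZero.pos _))
    exact Nat.Coprime.pow_left _ (Nat.Coprime.pow_right _ (Nat.Coprime.pow_left _ hmp.symm))
  let D : IntermediateField ℚ ℂ := cycField p n ⊓ F
  have hfin : FiniteDimensional ℚ D :=
    FiniteDimensional.of_injective
      (IntermediateField.inclusion (inf_le_left : D ≤ cycField p n)).toLinearMap
      (IntermediateField.inclusion (inf_le_left : D ≤ cycField p n)).injective
  have : NumberField D := ⟨⟩
  have h1 : NumberField.discr D ∣ NumberField.discr (cycField p n) := by
    let _ : Algebra D (cycField p n) :=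
      (IntermediateField.inclusion (inf_le_left : D ≤ cycField p n)).toRingHom.toAlgebra
    exact NumberField.discr_dvd_discr _ _
  have h2 : NumberField.discr D ∣ NumberField.discr F := by
    let _ : Algebra D F :=
      (IntermediateField.inclusion (inf_le_right : D ≤ F)).toRingHom.toAlgebra
    exact NumberField.discr_dvd_discr _ _
  have hunit : IsUnit (NumberField.discr D) :=
    (Int.isCoprime_iff_nat_coprime.mpr hcop).isUnit_of_dvd' h1 h2
  have hD : D = ⊥ := by
    by_contra hne
    have h3 : 1 < Module.finrank ℚ D := by
      refine Nat.one_lt_iff_ne_zero_and_ne_one.mpr ⟨Module.finrank_pos.ne', ?_⟩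
      rwa [ne_eq, IntermediateField.finrank_eq_one_iff]
    have h4 := NumberField.abs_discr_gt_two h3
    rw [Int.isUnit_iff_abs_eq.mp hunit] at h4
    omega
  exact hD ▸ ⟨hx.1, hxm⟩

/-- The field `k_n` as a type. -/
def Cyc (p n : ℕ) : Type := cycField p n

/-- The field `Ω` as a type. -/
def Omega (p : ℕ) : Type := omegaField p

/-- The field `Ω(ζ_{p ^ (n + 1)})` as a type. -/
def OmegaCyc (p n : ℕ) : Type := omegaCycField p n

instance instFieldCyc (p n : ℕ) : Field (Cyc p n) := inferInstanceAs (Field (cycField p n))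

instance instCharZeroCyc (p n : ℕ) : CharZero (Cyc p n) :=
  inferInstanceAs (CharZero (cycField p n))

instance instFieldOmega (p : ℕ) : Field (Omega p) := inferInstanceAs (Field (omegaField p))

instance instCharZeroOmega (p : ℕ) : CharZero (Omega p) :=
  inferInstanceAs (CharZero (omegaField p))

instance instFieldOmegaCyc (p n : ℕ) : Field (OmegaCyc p n) :=
  inferInstanceAs (Field (omegaCycField p n))

instance instAlgebraOmegaCyc (p n : ℕ) : Algebra (Omega p) (OmegaCyc p n) :=
  inferInstanceAs (Algebra (omegaField p) (omegaCycField p n))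

instance instCharZeroOmegaCyc (p n : ℕ) : CharZero (OmegaCyc p n) :=
  charZero_of_injective_algebraMap (algebraMap (Omega p) (OmegaCyc p n)).injective

/-- The embedding in `C` of an intermediate field of `C / F`. -/
def subVal {F C : Type*} [Field F] [Field C] [Algebra F C] (K : IntermediateField F C) : K →+* C :=
  K.toSubfield.subtype

theorem subVal_mem {F C : Type*} [Field F] [Field C] [Algebra F C] (K : IntermediateField F C)
    (x : K) : subVal K x ∈ K :=
  x.2

theorem subVal_algebraMap {F C : Type*} [Field F] [Field C] [Algebra F C]
    (O : IntermediateField F C) (M : IntermediateField O C) (x : O) :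
    subVal M (algebraMap O M x) = subVal O x :=
  rfl

/-- The embedding of `k_n` in `ℂ`. -/
def cycVal (p n : ℕ) : Cyc p n →+* ℂ := subVal (cycField p n)

/-- The embedding of `Ω` in `ℂ`. -/
def omegaVal (p : ℕ) : Omega p →+* ℂ := subVal (omegaField p)

/-- The embedding of `Ω(ζ_{p ^ (n + 1)})` in `ℂ`. -/
def omegaCycVal (p n : ℕ) : OmegaCyc p n →+* ℂ := subVal (omegaCycField p n)

theorem omegaCycVal_algebraMap (p n : ℕ) (x : Omega p) :
    omegaCycVal p n (algebraMap (Omega p) (OmegaCyc p n) x) = omegaVal p x :=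
  subVal_algebraMap (omegaField p) (omegaCycField p n) x

instance instCyc' (p n : ℕ) [Fact p.Prime] : IsCyclotomicExtension {p ^ (n + 1)} ℚ (Cyc p n) := by
  have h := instCyc p n
  have e : cycField p n ≃ₐ[ℚ] Cyc p n :=
    AlgEquiv.ofRingEquiv (f := (RingEquiv.refl (cycField p n) : cycField p n ≃+* Cyc p n))
      fun q ↦ by
        rw [eq_ratCast, eq_ratCast]
        exact map_ratCast (RingEquiv.refl (cycField p n) : cycField p n ≃+* Cyc p n) q
  exact IsCyclotomicExtension.equiv {p ^ (n + 1)} ℚ (cycField p n) e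

instance instNumberField (p n : ℕ) [Fact p.Prime] : NumberField (Cyc p n) :=
  IsCyclotomicExtension.numberField {p ^ (n + 1)} ℚ (Cyc p n)

instance instIsGalois (p n : ℕ) [Fact p.Prime] : IsGalois ℚ (Cyc p n) :=
  IsCyclotomicExtension.isGalois {p ^ (n + 1)} ℚ (Cyc p n)

instance instOmegaCyc' (p n : ℕ) [Fact p.Prime] :
    IsCyclotomicExtension {p ^ (n + 1)} (Omega p) (OmegaCyc p n) :=
  instOmegaCyc p n

instance instIsGaloisOmega (p n : ℕ) [Fact p.Prime] : IsGalois (Omega p) (OmegaCyc p n) :=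
  IsCyclotomicExtension.isGalois {p ^ (n + 1)} (Omega p) (OmegaCyc p n)

instance instFiniteOmega (p n : ℕ) [Fact p.Prime] :
    FiniteDimensional (Omega p) (OmegaCyc p n) :=
  IsCyclotomicExtension.finiteDimensional {p ^ (n + 1)} (Omega p) (OmegaCyc p n)

/-- Inclusion of subfields, for intermediate fields over possibly different bases. -/
def inclOver {F F' C : Type*} [Field F] [Field F'] [Field C] [Algebra F C] [Algebra F' C]
    (K : IntermediateField F C) (M : IntermediateField F' C) (h : ∀ x ∈ K, x ∈ M) : K →+* M where
  toFun x := ⟨x, h x x.2⟩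
  map_one' := rfl
  map_mul' _ _ := rfl
  map_zero' := rfl
  map_add' _ _ := rfl

theorem subVal_inclOver {F F' C : Type*} [Field F] [Field F'] [Field C] [Algebra F C]
    [Algebra F' C] (K : IntermediateField F C) (M : IntermediateField F' C)
    (h : ∀ x ∈ K, x ∈ M) (x : K) : subVal M (inclOver K M h x) = subVal K x :=
  rfl

/-- The inclusion of `k_n` in `k_{n + 1}`. -/
def cycIncl (p n : ℕ) : Cyc p n →+* Cyc p (n + 1) :=
  inclOver (cycField p n) (cycField p (n + 1)) (cyc_le_succ p n)

/-- The inclusion of `k_n` in `Ω(ζ_{p ^ (n + 1)})`. -/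
def omegaCycIncl (p n : ℕ) : Cyc p n →+* OmegaCyc p n :=
  inclOver (cycField p n) (omegaCycField p n) (cyc_le_OmegaCyc p n)

theorem cycVal_cycIncl (p n : ℕ) (x : Cyc p n) :
    cycVal p (n + 1) (cycIncl p n x) = cycVal p n x :=
  subVal_inclOver (cycField p n) (cycField p (n + 1)) (cyc_le_succ p n) x

theorem omegaCycVal_omegaCycIncl (p n : ℕ) (x : Cyc p n) :
    omegaCycVal p n (omegaCycIncl p n x) = cycVal p n x :=
  subVal_inclOver (cycField p n) (omegaCycField p n) (cyc_le_OmegaCyc p n) x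

/-- `k_{n + 1}` as an extension of `k_n`. -/
instance instAlgebraSucc (p n : ℕ) : Algebra (Cyc p n) (Cyc p (n + 1)) :=
  (cycIncl p n).toAlgebra

/-- `Ω(ζ_{p ^ (n + 1)})` as an extension of `k_n`. -/
instance instAlgebraCycOmegaCyc (p n : ℕ) : Algebra (Cyc p n) (OmegaCyc p n) :=
  (omegaCycIncl p n).toAlgebra

theorem omegaCycVal_algebraMap' (p n : ℕ) (x : Cyc p n) :
    omegaCycVal p n (algebraMap (Cyc p n) (OmegaCyc p n) x) = cycVal p n x := by
  rw [show algebraMap (Cyc p n) (OmegaCyc p n) = omegaCycIncl p n from rfl,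
    omegaCycVal_omegaCycIncl]

/-- Restriction `Gal(Ω(ζ_{p ^ (n + 1)}) / Ω) → Gal(k_n / ℚ)`. -/
def galRestrict (p n : ℕ) [Fact p.Prime] :
    Gal(OmegaCyc p n/Omega p) →* Gal(Cyc p n/ℚ) :=
  IntermediateField.restrictRestrictAlgEquivMapHom ℚ (Cyc p n) (Omega p) (OmegaCyc p n)

theorem galRestrict_apply (p n : ℕ) [Fact p.Prime] (φ : Gal(OmegaCyc p n/Omega p))
    (x : Cyc p n) :
    algebraMap (Cyc p n) (OmegaCyc p n) (galRestrict p n φ x) =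
      φ (algebraMap (Cyc p n) (OmegaCyc p n) x) :=
  AlgEquiv.restrictNormal_commutes _ _ x

theorem eq_self_of_adjoin {O C : Type*} [Field O] [Field C] [Algebra O C] {S : Set C}
    (φ : IntermediateField.adjoin O S →ₐ[O] IntermediateField.adjoin O S)
    (h : ∀ (z : C) (hz : z ∈ S), φ ⟨z, IntermediateField.subset_adjoin O S hz⟩ =
      ⟨z, IntermediateField.subset_adjoin O S hz⟩) (x : IntermediateField.adjoin O S) :
    φ x = x :=
  congrArg (fun f : IntermediateField.adjoin O S →ₐ[O] IntermediateField.adjoin O S ↦ f x)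
    (IntermediateField.adjoin_algHom_ext O (φ₂ := AlgHom.id O _) fun z hz ↦ h z hz)

theorem galRestrict_bijective (p n : ℕ) [Fact p.Prime] :
    Function.Bijective (galRestrict p n) := by
  constructor
  · refine (injective_iff_map_eq_one _).mpr fun φ hφ ↦ ?_
    have h0 : ∀ (z : ℂ) (hz : z ^ p ^ (n + 1) = 1),
        φ ⟨z, IntermediateField.subset_adjoin _ _ hz⟩ =
          ⟨z, IntermediateField.subset_adjoin _ _ hz⟩ := by
      intro z hz
      have hz' : z ∈ cycField p n := IntermediateField.subset_adjoin _ _ hz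
      have h1 := galRestrict_apply p n φ ⟨z, hz'⟩
      rw [hφ] at h1
      exact h1.symm
    exact AlgEquiv.ext fun x ↦ eq_self_of_adjoin (O := omegaField p) (C := ℂ)
      (S := {z : ℂ | z ^ p ^ (n + 1) = 1}) φ.toAlgHom h0 x
  · suffices h : IntermediateField.fixedField (galRestrict p n).range = ⊥ from
      MonoidHom.range_eq_top.mp <|
        IntermediateField.fixingSubgroup_fixedField (galRestrict p n).range ▸
          h ▸ IntermediateField.fixingSubgroup_bot
    refine eq_bot_iff.mpr fun x hx ↦ ?_
    have h1 : algebraMap (Cyc p n) (OmegaCyc p n) x ∈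
        (⊥ : IntermediateField (Omega p) (OmegaCyc p n)) := by
      refine (IsGalois.mem_bot_iff_fixed _).mpr fun φ ↦ ?_
      rw [← galRestrict_apply]
      rw [IntermediateField.mem_fixedField_iff] at hx
      rw [hx (galRestrict p n φ) ⟨φ, rfl⟩]
    obtain ⟨y, hy⟩ := IntermediateField.mem_bot.mp h1
    have h2 : omegaVal p y = cycVal p n x := by
      rw [← omegaCycVal_algebraMap p n, hy, omegaCycVal_algebraMap']
    have h3 : cycVal p n x ∈ cycField p n ⊓ omegaField p := by
      refine ⟨subVal_mem (cycField p n) x, ?_⟩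
      rw [← h2]
      exact subVal_mem (omegaField p) y
    rw [cyc_inf_Omega p n] at h3
    obtain ⟨q, hq⟩ := IntermediateField.mem_bot.mp h3
    refine IntermediateField.mem_bot.mpr ⟨q, (cycVal p n).injective ?_⟩
    rw [← hq, eq_ratCast, eq_ratCast, map_ratCast]

/-- The identification `Gal(k_n / ℚ) ≃ Gal(Ω(ζ_{p ^ (n + 1)}) / Ω)`, inverse to restriction. -/
def galLift (p n : ℕ) [Fact p.Prime] :
    Gal(Cyc p n/ℚ) ≃* Gal(OmegaCyc p n/Omega p) :=
  (MulEquiv.ofBijective (galRestrict p n) (galRestrict_bijective p n)).symm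

section Gauss

theorem card_quotient_coprime {K : Type*} [Field K] [NumberField K] {p : ℕ} (hp : p.Prime)
    (v : HeightOneSpectrum (𝓞 K)) (hv : (p : 𝓞 K) ∉ v.asIdeal) (m : ℕ) :
    (Ideal.absNorm v.asIdeal).Coprime (p ^ m) := by
  refine Nat.Coprime.pow_right _ (Nat.Coprime.symm ((Nat.Prime.coprime_iff_not_dvd hp).mpr ?_))
  intro h
  have hmax := v.isMaximal
  let _ : Field (𝓞 K ⧸ v.asIdeal) := Ideal.Quotient.field v.asIdeal
  have : Finite (𝓞 K ⧸ v.asIdeal) := Ring.HasFiniteQuotients.finiteQuotient v.ne_bot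
  let _ : Fintype (𝓞 K ⧸ v.asIdeal) := Fintype.ofFinite _
  have hr := ringChar.charP (𝓞 K ⧸ v.asIdeal)
  obtain ⟨k, hk, hcard⟩ := FiniteField.card (𝓞 K ⧸ v.asIdeal) (ringChar (𝓞 K ⧸ v.asIdeal))
  rw [Ideal.absNorm_apply, Submodule.cardQuot_apply, Nat.card_eq_fintype_card, hcard] at h
  have h2 := (Nat.prime_dvd_prime_iff_eq hp hk).mp (hp.dvd_of_dvd_pow h)
  apply hv
  rw [← Ideal.Quotient.eq_zero_iff_mem, map_natCast, h2]
  exact CharP.cast_eq_zero _ _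

theorem existsUnique_rootsOfUnity {K : Type*} [Field K] [NumberField K] (N : ℕ) [NeZero N]
    [IsCyclotomicExtension {N} ℚ K] (v : HeightOneSpectrum (𝓞 K))
    (hv : (Ideal.absNorm v.asIdeal).Coprime N) (y : (𝓞 K ⧸ v.asIdeal)ˣ) (hy : y ^ N = 1) :
    ∃! u : rootsOfUnity N (𝓞 K), Ideal.rootsOfUnityMapQuot v.asIdeal N u = y := by
  have hne : Ideal.absNorm v.asIdeal ≠ 1 := mt Ideal.absNorm_eq_one_iff.mp v.isPrime.ne_top
  have hinj := Ideal.rootsOfUnityMapQuot_injective N hne hv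
  refine existsUnique_of_exists_of_unique ?_ fun a b ha hb ↦ hinj (ha.trans hb.symm)
  have hζ := (IsCyclotomicExtension.zeta_spec N ℚ K).toInteger_isPrimitiveRoot
  have hζ' := hζ.idealQuotient_mk hne hv
  obtain ⟨i, -, hi⟩ := hζ'.eq_pow_of_pow_eq_one (ξ := (y : 𝓞 K ⧸ v.asIdeal))
    (by rw [← Units.val_pow_eq_pow_val, hy, Units.val_one])
  refine ⟨hζ.toRootsOfUnity ^ i, Units.ext ?_⟩
  rw [map_pow, Units.val_pow_eq_pow_val, ← hi]
  rfl

theorem pow_card_div_pow {K : Type*} [Field K] [NumberField K] (N : ℕ) [NeZero N]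
    [IsCyclotomicExtension {N} ℚ K] (v : HeightOneSpectrum (𝓞 K))
    (hv : (Ideal.absNorm v.asIdeal).Coprime N) :
    N ∣ Nat.card (𝓞 K ⧸ v.asIdeal) - 1 ∧
      ∀ y : (𝓞 K ⧸ v.asIdeal)ˣ, (y ^ ((Nat.card (𝓞 K ⧸ v.asIdeal) - 1) / N)) ^ N = 1 := by
  have hne : Ideal.absNorm v.asIdeal ≠ 1 := mt Ideal.absNorm_eq_one_iff.mp v.isPrime.ne_top
  have hmax := v.isMaximal
  let _ : Field (𝓞 K ⧸ v.asIdeal) := Ideal.Quotient.field v.asIdeal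
  have : Finite (𝓞 K ⧸ v.asIdeal) := Ring.HasFiniteQuotients.finiteQuotient v.ne_bot
  have hζ := (IsCyclotomicExtension.zeta_spec N ℚ K).toInteger_isPrimitiveRoot
  have hζ' := hζ.idealQuotient_mk hne hv
  have hdvd : N ∣ Nat.card (𝓞 K ⧸ v.asIdeal) - 1 := by
    rw [← Nat.card_units, hζ'.eq_orderOf, ← (hζ'.isUnit (NeZero.ne N)).unit_spec, orderOf_units]
    exact orderOf_dvd_natCard _
  refine ⟨hdvd, fun y ↦ ?_⟩
  rw [← pow_mul, Nat.div_mul_cancel hdvd, ← Nat.card_units]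
  exact pow_card_eq_one'

/-- The character `χ` of the multiplicative group of the residue field of `v`, with values in the
`N`-th roots of unity of `K`, such that `χ x ≡ x ^ (-(q - 1) / N)` modulo `v`, where `q` is the
cardinality of the residue field. -/
def residueChar {K : Type*} [Field K] [NumberField K] (N : ℕ) [NeZero N]
    [IsCyclotomicExtension {N} ℚ K] (v : HeightOneSpectrum (𝓞 K))
    (hv : (Ideal.absNorm v.asIdeal).Coprime N) :
    (𝓞 K ⧸ v.asIdeal)ˣ →* rootsOfUnity N (𝓞 K) where
  toFun x := (existsUnique_rootsOfUnity N v hv _ ((pow_card_div_pow N v hv).2 x⁻¹)).choose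
  map_one' := by
    refine (existsUnique_rootsOfUnity N v hv _ ((pow_card_div_pow N v hv).2 1⁻¹)).unique
      (existsUnique_rootsOfUnity N v hv _ ((pow_card_div_pow N v hv).2 1⁻¹)).choose_spec.1 ?_
    rw [map_one, inv_one, one_pow]
  map_mul' x y := by
    refine (existsUnique_rootsOfUnity N v hv _ ((pow_card_div_pow N v hv).2 (x * y)⁻¹)).unique
      (existsUnique_rootsOfUnity N v hv _ ((pow_card_div_pow N v hv).2 (x * y)⁻¹)).choose_spec.1 ?_
    rw [map_mul,
      (existsUnique_rootsOfUnity N v hv _ ((pow_card_div_pow N v hv).2 x⁻¹)).choose_spec.1,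
      (existsUnique_rootsOfUnity N v hv _ ((pow_card_div_pow N v hv).2 y⁻¹)).choose_spec.1,
      mul_inv, mul_pow]

theorem residueChar_spec {K : Type*} [Field K] [NumberField K] (N : ℕ) [NeZero N]
    [IsCyclotomicExtension {N} ℚ K] (v : HeightOneSpectrum (𝓞 K))
    (hv : (Ideal.absNorm v.asIdeal).Coprime N) (x : (𝓞 K ⧸ v.asIdeal)ˣ) :
    Ideal.rootsOfUnityMapQuot v.asIdeal N (residueChar N v hv x) =
      x⁻¹ ^ ((Nat.card (𝓞 K ⧸ v.asIdeal) - 1) / N) :=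
  (existsUnique_rootsOfUnity N v hv _ ((pow_card_div_pow N v hv).2 x⁻¹)).choose_spec.1

theorem residueChar_ne_one {K : Type*} [Field K] [NumberField K] (N : ℕ) [NeZero N]
    [IsCyclotomicExtension {N} ℚ K] (v : HeightOneSpectrum (𝓞 K))
    (hv : (Ideal.absNorm v.asIdeal).Coprime N) (hN : 1 < N) :
    residueChar N v hv ≠ 1 := by
  intro h
  have hmax := v.isMaximal
  let _ : Field (𝓞 K ⧸ v.asIdeal) := Ideal.Quotient.field v.asIdeal
  have : Finite (𝓞 K ⧸ v.asIdeal) := Ring.HasFiniteQuotients.finiteQuotient v.ne_bot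
  have h1 : ∀ x : (𝓞 K ⧸ v.asIdeal)ˣ, x ^ ((Nat.card (𝓞 K ⧸ v.asIdeal) - 1) / N) = 1 := by
    intro x
    have h2 := residueChar_spec N v hv x⁻¹
    rw [h, MonoidHom.one_apply, map_one, inv_inv] at h2
    exact h2.symm
  obtain ⟨g, hg⟩ := IsCyclic.exists_generator (α := (𝓞 K ⧸ v.asIdeal)ˣ)
  have h3 := orderOf_dvd_of_pow_eq_one (h1 g)
  rw [orderOf_eq_card_of_forall_mem_zpowers hg, Nat.card_units] at h3
  have hpos : 0 < Nat.card (𝓞 K ⧸ v.asIdeal) - 1 := by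
    have := Finite.one_lt_card (α := 𝓞 K ⧸ v.asIdeal)
    omega
  have h4 := Nat.div_lt_self hpos hN
  have h5 : 0 < (Nat.card (𝓞 K ⧸ v.asIdeal) - 1) / N :=
    Nat.div_pos (Nat.le_of_dvd hpos (pow_card_div_pow N v hv).1) (NeZero.pos N)
  exact absurd (Nat.le_of_dvd h5 h3) (not_le.mpr h4)

/-- The additive character `a ↦ z ^ Tr(a)` of a finite field of characteristic `l`, where
`z ^ l = 1` and the trace is the one to the prime field. -/
def traceChar (F : Type*) [Field F] [Finite F] {E : Type*} [Field E] (z : E)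
    (hz : z ^ ringChar F = 1) : AddChar F E :=
  haveI : NeZero (ringChar F) := ⟨CharP.ringChar_ne_zero_of_finite F⟩
  letI : Algebra (ZMod (ringChar F)) F := ZMod.algebra F (ringChar F)
  (AddChar.zmodChar (ringChar F) hz).compAddMonoidHom
    (Algebra.trace (ZMod (ringChar F)) F).toAddMonoidHom

/-- The Gauss sum `-∑ χ(a) z ^ Tr(a)`, over the nonzero elements `a` of a finite field `F`. -/
def fieldGaussSum (F : Type*) [Field F] [Finite F] {E : Type*} [Field E] (χ : Fˣ →* Eˣ) (z : E)
    (hz : z ^ ringChar F = 1) : E :=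
  letI : Fintype F := Fintype.ofFinite F;
  -gaussSum (MulChar.ofUnitHom χ) (traceChar F z hz)

theorem fieldGaussSum_ne_zero (F : Type*) [Field F] [Finite F] {E : Type*} [Field E] [CharZero E]
    (χ : Fˣ →* Eˣ) (hχ : χ ≠ 1) (z : E) (hz : IsPrimitiveRoot z (ringChar F)) :
    fieldGaussSum F χ z hz.pow_eq_one ≠ 0 := by
  let _ : Fintype F := Fintype.ofFinite F
  have : NeZero (ringChar F) := ⟨CharP.ringChar_ne_zero_of_finite F⟩
  have : Fact (ringChar F).Prime := ⟨CharP.char_is_prime F _⟩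
  let _ : Algebra (ZMod (ringChar F)) F := ZMod.algebra F (ringChar F)
  have hcard : (Fintype.card F : E) ≠ 0 := Nat.cast_ne_zero.mpr Fintype.card_ne_zero
  refine (neg_ne_zero (α := E)).mpr (gaussSum_ne_zero_of_nontrivial hcard
    (χ := MulChar.ofUnitHom χ) ?_ (ψ := traceChar F z hz.pow_eq_one)
    (AddChar.IsPrimitive.of_ne_one ?_))
  · intro h
    refine hχ (MonoidHom.ext fun x ↦ Units.ext ?_)
    rw [← MulChar.ofUnitHom_coe, h, MulChar.one_apply_coe, MonoidHom.one_apply, Units.val_one]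
  · obtain ⟨a, ha⟩ := FiniteField.trace_to_zmod_nondegenerate F one_ne_zero
    rw [one_mul] at ha
    refine AddChar.ne_one_iff.mpr ⟨a, fun hf ↦ ha ?_⟩
    exact ((AddChar.zmodChar_primitive_of_primitive_root (ringChar F) hz).zmod_char_eq_one_iff
      (ringChar F) _).mp hf

end Gauss

/-- A choice, for every prime `l`, of a primitive `l`-th root of unity `ζ_l`. -/
abbrev RootChoice : Type := ∀ l : Nat.Primes, {z : ℂ // IsPrimitiveRoot z (l : ℕ)}

theorem root_mem_OmegaCyc (p n : ℕ) [hp : Fact p.Prime] {l : ℕ} (hl : l.Prime) (hlp : l ≠ p)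
    {z : ℂ} (hz : IsPrimitiveRoot z l) : z ∈ omegaCycField p n := by
  have h : z ∈ omegaField p := IntermediateField.subset_adjoin _ _
    ⟨l, hl.ne_zero, (Nat.coprime_primes hl hp.out).mpr hlp, hz.pow_eq_one⟩
  exact (omegaCycField p n).algebraMap_mem ⟨z, h⟩

section Jacobi

theorem coprime_of_notMem (p n : ℕ) [hp : Fact p.Prime] (v : HeightOneSpectrum (𝓞 (Cyc p n)))
    (hv : (p : 𝓞 (Cyc p n)) ∉ v.asIdeal) : (Ideal.absNorm v.asIdeal).Coprime (p ^ (n + 1)) :=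
  card_quotient_coprime hp.out v hv (n + 1)

theorem finite_quotient {K : Type*} [Field K] [NumberField K] (v : HeightOneSpectrum (𝓞 K)) :
    Finite (𝓞 K ⧸ v.asIdeal) :=
  Ring.HasFiniteQuotients.finiteQuotient v.ne_bot

/-- The residue characteristic of a prime ideal of a number field. -/
def residuePrime {K : Type*} [Field K] [NumberField K] (v : HeightOneSpectrum (𝓞 K)) :
    Nat.Primes :=
  ⟨ringChar (𝓞 K ⧸ v.asIdeal), by
    have hmax := v.isMaximal
    have := finite_quotient v
    let _ : Field (𝓞 K ⧸ v.asIdeal) := Ideal.Quotient.field v.asIdeal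
    exact CharP.char_is_prime (𝓞 K ⧸ v.asIdeal) _⟩

theorem residuePrime_ne {p : ℕ} {K : Type*} [Field K] [NumberField K]
    (v : HeightOneSpectrum (𝓞 K)) (hv : (p : 𝓞 K) ∉ v.asIdeal) :
    (residuePrime v : ℕ) ≠ p := by
  rintro h
  apply hv
  rw [← Ideal.Quotient.eq_zero_iff_mem, map_natCast, ← h]
  exact ringChar.Nat.cast_ringChar

/-- The chosen `l`-th root of unity `ζ_l`, as an element of `Ω(ζ_{p ^ (n + 1)})`, where `l` is the
residue characteristic of `v`. -/
def rootAt (p n : ℕ) [Fact p.Prime] (ζ : RootChoice) (v : HeightOneSpectrum (𝓞 (Cyc p n)))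
    (hv : (p : 𝓞 (Cyc p n)) ∉ v.asIdeal) : OmegaCyc p n :=
  ⟨ζ (residuePrime v), root_mem_OmegaCyc p n (residuePrime v).2 (residuePrime_ne v hv)
    (ζ (residuePrime v)).2⟩

theorem rootAt_isPrimitiveRoot (p n : ℕ) [Fact p.Prime] (ζ : RootChoice)
    (v : HeightOneSpectrum (𝓞 (Cyc p n))) (hv : (p : 𝓞 (Cyc p n)) ∉ v.asIdeal) :
    IsPrimitiveRoot (rootAt p n ζ v hv) (ringChar (𝓞 (Cyc p n) ⧸ v.asIdeal)) :=
  IsPrimitiveRoot.of_map_of_injective (f := omegaCycVal p n) (ζ (residuePrime v)).2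
    (omegaCycVal p n).injective

/-- The embedding of the units of the ring of integers of `k_n` in those of
`Ω(ζ_{p ^ (n + 1)})`. -/
def integerUnits (p n : ℕ) : (𝓞 (Cyc p n))ˣ →* (OmegaCyc p n)ˣ :=
  (Units.map (algebraMap (Cyc p n) (OmegaCyc p n)).toMonoidHom).comp
    (Units.map (algebraMap (𝓞 (Cyc p n)) (Cyc p n)).toMonoidHom)

/-- The character `χ` of the residue field of `v`, with values in `Ω(ζ_{p ^ (n + 1)})`. -/
def gaussChar (p n : ℕ) [Fact p.Prime] (v : HeightOneSpectrum (𝓞 (Cyc p n)))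
    (hv : (p : 𝓞 (Cyc p n)) ∉ v.asIdeal) :
    (𝓞 (Cyc p n) ⧸ v.asIdeal)ˣ →* (OmegaCyc p n)ˣ :=
  (integerUnits p n).comp ((rootsOfUnity (p ^ (n + 1)) (𝓞 (Cyc p n))).subtype.comp
    (residueChar (p ^ (n + 1)) v (coprime_of_notMem p n v hv)))

theorem gaussChar_ne_one (p n : ℕ) [hp : Fact p.Prime] (v : HeightOneSpectrum (𝓞 (Cyc p n)))
    (hv : (p : 𝓞 (Cyc p n)) ∉ v.asIdeal) : gaussChar p n v hv ≠ 1 := by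
  intro h
  refine residueChar_ne_one (p ^ (n + 1)) v (coprime_of_notMem p n v hv)
    (Nat.one_lt_pow (Nat.succ_ne_zero n) hp.out.one_lt) (MonoidHom.ext fun x ↦ ?_)
  have h1 : gaussChar p n v hv x = 1 := by rw [h, MonoidHom.one_apply]
  have hinj : Function.Injective (integerUnits p n) :=
    (Units.map_injective (algebraMap (Cyc p n) (OmegaCyc p n)).injective).comp
      (Units.map_injective RingOfIntegers.coe_injective)
  rw [MonoidHom.one_apply]
  exact Subtype.ext (hinj (h1.trans (map_one (integerUnits p n)).symm))

/-- The Gauss sum `τ_n(v)` of a prime ideal `v` of `k_n` not above `p`. -/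
def primeGaussSum (p n : ℕ) [Fact p.Prime] (ζ : RootChoice)
    (v : HeightOneSpectrum (𝓞 (Cyc p n))) (hv : (p : 𝓞 (Cyc p n)) ∉ v.asIdeal) :
    OmegaCyc p n :=
  haveI := v.isMaximal
  haveI := finite_quotient v
  letI : Field (𝓞 (Cyc p n) ⧸ v.asIdeal) := Ideal.Quotient.field v.asIdeal
  fieldGaussSum (𝓞 (Cyc p n) ⧸ v.asIdeal) (gaussChar p n v hv) (rootAt p n ζ v hv)
    (rootAt_isPrimitiveRoot p n ζ v hv).pow_eq_one

theorem primeGaussSum_ne_zero (p n : ℕ) [Fact p.Prime] (ζ : RootChoice)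
    (v : HeightOneSpectrum (𝓞 (Cyc p n))) (hv : (p : 𝓞 (Cyc p n)) ∉ v.asIdeal) :
    primeGaussSum p n ζ v hv ≠ 0 := by
  have := v.isMaximal
  have := finite_quotient v
  let _ : Field (𝓞 (Cyc p n) ⧸ v.asIdeal) := Ideal.Quotient.field v.asIdeal
  exact fieldGaussSum_ne_zero (𝓞 (Cyc p n) ⧸ v.asIdeal) (gaussChar p n v hv)
    (gaussChar_ne_one p n v hv) _ (rootAt_isPrimitiveRoot p n ζ v hv)

/-- The group `I_n` of fractional ideals of `k_n` prime to `p`. -/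
abbrev I (p n : ℕ) [Fact p.Prime] : Subgroup (FracIdeals (Cyc p n)) :=
  primeToP p (Cyc p n)

open Classical in
/-- The homomorphism `τ_n : I_n → Ω(ζ_{p ^ (n + 1)})ˣ`: the multiplicative extension of the Gauss
sums of prime ideals (the value attached to the prime above `p` plays no role on `I_n`). -/
def tau (p n : ℕ) [Fact p.Prime] (ζ : RootChoice) : I p n →* (OmegaCyc p n)ˣ :=
  (primeExt fun v ↦ if hv : (p : 𝓞 (Cyc p n)) ∈ v.asIdeal then 1 else
    Units.mk0 (primeGaussSum p n ζ v hv) (primeGaussSum_ne_zero p n ζ v hv)).comp (I p n).subtype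

/-- The exponentiation `u ↦ u ^ δ = ∏ σ(u) ^ (δ_σ)` of `Ω(ζ_{p ^ (n + 1)})ˣ` by `δ ∈ ℤ[G_n]`, where
`G_n = Gal(k_n / ℚ)` is identified with `Gal(Ω(ζ_{p ^ (n + 1)}) / Ω)`. -/
def groupRingPow (p n : ℕ) [Fact p.Prime] (δ : MonoidAlgebra ℤ Gal(Cyc p n/ℚ))
    (u : (OmegaCyc p n)ˣ) : (OmegaCyc p n)ˣ :=
  δ.coeff.prod fun σ m ↦ (Units.mapEquiv (galLift p n σ).toMulEquiv u) ^ m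

theorem groupRingPow_add (p n : ℕ) [Fact p.Prime] (δ ε : MonoidAlgebra ℤ Gal(Cyc p n/ℚ))
    (u : (OmegaCyc p n)ˣ) :
    groupRingPow p n (δ + ε) u = groupRingPow p n δ u * groupRingPow p n ε u := by
  classical
  rw [groupRingPow, MonoidAlgebra.coeff_add]
  exact Finsupp.prod_add_index' (fun _ ↦ zpow_zero _) fun _ _ _ ↦ zpow_add _ _ _

theorem groupRingPow_zero (p n : ℕ) [Fact p.Prime] (u : (OmegaCyc p n)ˣ) :
    groupRingPow p n 0 u = 1 := by
  rw [groupRingPow, MonoidAlgebra.coeff_zero, Finsupp.prod_zero_index]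

theorem groupRingPow_neg (p n : ℕ) [Fact p.Prime] (δ : MonoidAlgebra ℤ Gal(Cyc p n/ℚ))
    (u : (OmegaCyc p n)ˣ) : groupRingPow p n (-δ) u = (groupRingPow p n δ u)⁻¹ := by
  rw [eq_inv_iff_mul_eq_one, ← groupRingPow_add, neg_add_cancel, groupRingPow_zero]

/-- The action of `σ ∈ G_n` on `I_n`. -/
def galIdeal (p n : ℕ) [Fact p.Prime] (σ : Gal(Cyc p n/ℚ)) : I p n →* I p n :=
  ((idealMap σ.toRingEquiv).comp (I p n).subtype).codRestrict (I p n)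
    fun a ↦ idealMap_mem_primeToP σ.toRingEquiv a.2

/-- The group `Hom(I_n, k_nˣ)` of group homomorphisms. -/
abbrev IdealHom (p n : ℕ) [Fact p.Prime] : Type :=
  I p n →* (Cyc p n)ˣ

/-- The group `Hom_{ℤ[G_n]}(I_n, k_nˣ)` of equivariant homomorphisms. -/
def equivariantHom (p n : ℕ) [Fact p.Prime] : Subgroup (IdealHom p n) where
  carrier := {f | ∀ (σ : Gal(Cyc p n/ℚ)) (a : I p n),
    f (galIdeal p n σ a) = Units.mapEquiv σ.toMulEquiv (f a)}
  mul_mem' {f g} hf hg σ a := by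
    rw [MonoidHom.mul_apply, MonoidHom.mul_apply, map_mul, hf, hg]
  one_mem' σ a := by rw [MonoidHom.one_apply, MonoidHom.one_apply, map_one]
  inv_mem' {f} hf σ a := by rw [MonoidHom.inv_apply, MonoidHom.inv_apply, map_inv, hf]

/-- The Jacobi module `𝒥_n = ℤ[G_n] τ_n ∩ Hom_{ℤ[G_n]}(I_n, k_nˣ)`. -/
def jacobiModule (p n : ℕ) [Fact p.Prime] (ζ : RootChoice) :
    Subgroup (IdealHom p n) where
  carrier := {f | f ∈ equivariantHom p n ∧ ∃ δ : MonoidAlgebra ℤ Gal(Cyc p n/ℚ), ∀ a : I p n,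
    Units.map (algebraMap (Cyc p n) (OmegaCyc p n)).toMonoidHom (f a) =
      groupRingPow p n δ (tau p n ζ a)}
  mul_mem' := by
    rintro f g ⟨hf, δ, hδ⟩ ⟨hg, ε, hε⟩
    exact ⟨mul_mem hf hg, δ + ε, fun a ↦ by
      rw [MonoidHom.mul_apply, map_mul, hδ, hε, groupRingPow_add]⟩
  one_mem' := ⟨one_mem _, 0, fun a ↦ by rw [MonoidHom.one_apply, map_one, groupRingPow_zero]⟩
  inv_mem' := by
    rintro f ⟨hf, δ, hδ⟩
    exact ⟨inv_mem hf, -δ, fun a ↦ by rw [MonoidHom.inv_apply, map_inv, hδ, groupRingPow_neg]⟩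

/-- Complex conjugation `σ_{-1} ∈ G_n`, i.e. the automorphism `ζ ↦ ζ ^ (-1)` on
`p ^ (n + 1)`-th roots of unity. -/
def sigmaNegOne (p n : ℕ) [hp : Fact p.Prime] : Gal(Cyc p n/ℚ) :=
  (IsCyclotomicExtension.Rat.galEquivZMod (p ^ (n + 1)) (Cyc p n)).symm (-1)

/-- The minus part `𝒥_n⁻ = {f ∈ 𝒥_n | σ_{-1} f = f⁻¹}` of the Jacobi module. -/
def jacobiMinus (p n : ℕ) [Fact p.Prime] (ζ : RootChoice) :
    Subgroup (IdealHom p n) where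
  carrier := {f | f ∈ jacobiModule p n ζ ∧
    ∀ a : I p n, Units.mapEquiv (sigmaNegOne p n).toMulEquiv (f a) = (f a)⁻¹}
  mul_mem' := by
    rintro f g ⟨hf, hf'⟩ ⟨hg, hg'⟩
    exact ⟨mul_mem hf hg, fun a ↦ by rw [MonoidHom.mul_apply, map_mul, hf', hg', mul_inv]⟩
  one_mem' := ⟨one_mem _, fun a ↦ by rw [MonoidHom.one_apply, map_one, inv_one]⟩
  inv_mem' := by
    rintro f ⟨hf, hf'⟩
    exact ⟨inv_mem hf, fun a ↦ by rw [MonoidHom.inv_apply, map_inv, hf']⟩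

/-- The group `Hom_{ℤ[G_n]}(I_n, μ_{2 p ^ (n + 1)})`. -/
def rootHom (p n : ℕ) [Fact p.Prime] : Subgroup (IdealHom p n) where
  carrier := {f | f ∈ equivariantHom p n ∧
    ∀ a : I p n, f a ∈ rootsOfUnity (2 * p ^ (n + 1)) (Cyc p n)}
  mul_mem' := by
    rintro f g ⟨hf, hf'⟩ ⟨hg, hg'⟩
    exact ⟨mul_mem hf hg, fun a ↦ mul_mem (hf' a) (hg' a)⟩
  one_mem' := ⟨one_mem _, fun a ↦ one_mem _⟩
  inv_mem' := by
    rintro f ⟨hf, hf'⟩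
    exact ⟨inv_mem hf, fun a ↦ inv_mem (hf' a)⟩

/-- The norm `N_{n + 1, n} : I_{n + 1} → I_n`. -/
def normIdeal (p n : ℕ) [Fact p.Prime] : I p (n + 1) →* I p n :=
  ((idealNorm (Cyc p n) (Cyc p (n + 1))).comp (I p (n + 1)).subtype).codRestrict (I p n)
    fun a ↦ idealNorm_mem_primeToP a.2

/-- The inclusion of `k_nˣ` in `k_{n + 1}ˣ`. -/
def inclUnits (p n : ℕ) : (Cyc p n)ˣ →* (Cyc p (n + 1))ˣ :=
  Units.map (algebraMap (Cyc p n) (Cyc p (n + 1))).toMonoidHom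

/-- The norm `N_{n + 1, n} : k_{n + 1}ˣ → k_nˣ`. -/
def normUnits (p n : ℕ) : (Cyc p (n + 1))ˣ →* (Cyc p n)ˣ :=
  Units.map (Algebra.norm (Cyc p n))

/-- The map `f ↦ N_{n + 1, n} ∘ f` from `Hom(I_{n + 1}, k_{n + 1}ˣ)` to itself. -/
def normPost (p n : ℕ) [Fact p.Prime] :
    IdealHom p (n + 1) →* IdealHom p (n + 1) where
  toFun f := (inclUnits p n).comp ((normUnits p n).comp f)
  map_one' := by simp only [MonoidHom.comp_one]
  map_mul' f g := by simp only [MonoidHom.comp_mul]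

/-- The map `g ↦ g ∘ N_{n + 1, n}` from `Hom(I_n, k_nˣ)` to `Hom(I_{n + 1}, k_{n + 1}ˣ)`. -/
def normPre (p n : ℕ) [Fact p.Prime] :
    IdealHom p n →* IdealHom p (n + 1) where
  toFun g := (inclUnits p n).comp (g.comp (normIdeal p n))
  map_one' := by simp only [MonoidHom.one_comp, MonoidHom.comp_one]
  map_mul' f g := by simp only [MonoidHom.mul_comp, MonoidHom.comp_mul]

end Jacobi

end JacobiNorm

end

/-!
# Norm compatibility of the minus part of the Jacobi modules

Write `κ` for the cyclotomic character of `G_n`. For `δ = ∑ δ_σ σ` in `ℤ[G_n]` let its weight be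
`∑ δ_σ κ(σ)` in `ℤ / p ^ (n + 1)` and its degree be `∑ δ_σ`. The minus part of the Jacobi module
consists of the `δ τ_n` with `δ` of weight and degree `0` (`mem_jacobiMinus_iff`):

* moving `ζ_l` to `ζ_l ^ a` over `k_n` multiplies `δ τ_n(𝔩)` by a value of `χ ^ (-weight)`. As `k_n`
  and `ℚ(ζ_l)` are linearly disjoint, `δ τ_n` has values in `k_n` exactly when the weight is `0`
  (`exists_map_eq_groupRingPow` and `weight_eq_zero`, which uses a prime of residue degree one);
* `τ_n(𝔩)` times its conjugate under `σ_{-1}` is the cardinality `q` of the residue field, so the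
  minus part is cut out by `q ^ degree = 1` (`mul_sigmaNegOne_eq`).

Let `δ` in `ℤ[G_{n + 1}]` have weight and degree `0`, and let `res δ` be its restriction in `ℤ[G_n]`.
The quotient of `N ∘ δ τ_{n + 1}` by `(res δ) τ_n ∘ N` takes values in the roots of unity
(`normPost_div_normPre_mem_rootHom`). This is the Hasse–Davenport product formula, but only roots of
unity have to be controlled, so it is enough to compare absolute values. At the archimedean places
both homomorphisms have absolute value `1`, since they lie in the minus part. At the finite places,
Stickelberger's theorem gives the valuation of a Gauss sum in terms of digit sums
(`associated_gaussSum_pow`), and summing it over the `p` lifts modulo `p ^ (n + 2)` of a class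
modulo `p ^ (n + 1)` gives the product formula up to units (`prod_valuation_fieldGaussSum`), with an
extra power of `q` which disappears in degree `0` (`valuation_normPost_eq`). All finite places are
treated at once through the valuation rings `A` of `ℂ`: the intersection of these rings is the ring
of algebraic integers, and an algebraic integer whose conjugates have absolute value `1` is a root
of unity (`pow_eq_one_of_integral`).

It follows that the left side of the norm relation is contained in the right side. The other
inclusion holds because every element of `ℤ[G_n]` of weight and degree `0` is the restriction of
such an element of `ℤ[G_{n + 1}]` (`exists_resRing_eq`).
-/

noncomputable section

namespace JacobiNorm

/-! ### Digit sums -/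

/-- The exponent `C` with `(q - 1) C = (l - 1) ∑_{i < f} (l ^ i a mod (q - 1))`: for `q = l ^ f` and
`a < q - 1` it is the sum of the digits of `a` in base `l`. -/
def digitExp (l f a : ℕ) : ℕ :=
  ∑ i ∈ Finset.range f, l * (l ^ i * a % (l ^ f - 1)) / (l ^ f - 1)

theorem pow_succ_mul_mod (l m a i : ℕ) :
    l ^ (i + 1) * a % m + m * (l * (l ^ i * a % m) / m) = l * (l ^ i * a % m) := by
  have h : l ^ (i + 1) * a % m = l * (l ^ i * a % m) % m := by
    rw [Nat.mul_mod_mod]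
    congr 1
    ring
  rw [h]
  exact Nat.mod_add_div _ _

theorem pow_mul_mod_pow_sub_one (l f a : ℕ) (hl : 0 < l) :
    l ^ f * a % (l ^ f - 1) = a % (l ^ f - 1) := by
  obtain ⟨m, hm⟩ := Nat.exists_eq_add_of_lt (Nat.pow_pos hl : 0 < l ^ f)
  rw [hm]
  simp [Nat.add_mul, Nat.add_mod]

theorem mul_digitExp (l f a : ℕ) (hl : 0 < l) :
    (l ^ f - 1) * digitExp l f a =
      (l - 1) * ∑ i ∈ Finset.range f, l ^ i * a % (l ^ f - 1) := by
  have h1 : ∑ i ∈ Finset.range f, l ^ (i + 1) * a % (l ^ f - 1) =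
      ∑ i ∈ Finset.range f, l ^ i * a % (l ^ f - 1) := by
    have h2 := Finset.sum_range_succ (fun i ↦ l ^ i * a % (l ^ f - 1)) f
    rw [Finset.sum_range_succ', pow_mul_mod_pow_sub_one l f a hl, pow_zero, one_mul] at h2
    omega
  have h3 := Finset.sum_congr (rfl : Finset.range f = Finset.range f)
    fun i _ ↦ pow_succ_mul_mod l (l ^ f - 1) a i
  rw [Finset.sum_add_distrib, ← Finset.mul_sum, ← Finset.mul_sum, h1] at h3
  obtain ⟨k, rfl⟩ := Nat.exists_eq_add_of_lt hl
  rw [digitExp]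
  simp only [zero_add, Nat.add_sub_cancel] at h3 ⊢
  rw [Nat.add_mul, one_mul] at h3
  omega

/-- The digits in base `l` of `a` and of `l ^ f - 1 - a` add up to `l - 1` place by place. -/
theorem digitExp_add_digitExp (l f a b : ℕ) (hl : l.Prime) (hab : a + b = l ^ f - 1) (ha : 0 < a)
    (hb : 0 < b) : digitExp l f a + digitExp l f b = (l - 1) * f := by
  have hm : 0 < l ^ f - 1 := by omega
  have hcop : ∀ i, (l ^ f - 1).Coprime (l ^ i) := by
    intro i
    refine Nat.Coprime.pow_right _ (Nat.Coprime.symm ((Nat.Prime.coprime_iff_not_dvd hl).mpr ?_))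
    intro h
    have hf : f ≠ 0 := by rintro rfl; simp at hm
    have h1 : l ∣ l ^ f := dvd_pow_self l hf
    have h2 : l ∣ 1 := by
      have := (Nat.dvd_sub h1 h)
      rwa [Nat.sub_sub_self (Nat.pow_pos hl.pos)] at this
    exact hl.one_lt.ne' (Nat.dvd_one.mp h2)
  have hsum : ∀ i, l ^ i * a % (l ^ f - 1) + l ^ i * b % (l ^ f - 1) = l ^ f - 1 := by
    intro i
    have hdvd : (l ^ f - 1) ∣ l ^ i * a % (l ^ f - 1) + l ^ i * b % (l ^ f - 1) := by
      apply Nat.dvd_of_mod_eq_zero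
      rw [← Nat.add_mod, ← Nat.mul_add, hab, Nat.mul_mod_left]
    have hpos : 0 < l ^ i * a % (l ^ f - 1) := by
      refine Nat.pos_of_ne_zero fun h ↦ ?_
      have h1 := (hcop i).dvd_of_dvd_mul_left (Nat.dvd_of_mod_eq_zero h)
      have := Nat.le_of_dvd ha h1
      omega
    have h1 := Nat.mod_lt (l ^ i * a) hm
    have h2 := Nat.mod_lt (l ^ i * b) hm
    obtain ⟨k, hk⟩ := hdvd
    have : k = 1 := by
      have h3 : k < 2 := by
        by_contra h
        have := Nat.mul_le_mul_left (l ^ f - 1) (not_lt.mp h)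
        omega
      have h4 : k ≠ 0 := by
        rintro rfl
        omega
      omega
    rw [hk, this, mul_one]
  refine Nat.eq_of_mul_eq_mul_left hm ?_
  rw [Nat.mul_add, mul_digitExp l f a hl.pos, mul_digitExp l f b hl.pos, ← Nat.mul_add,
    ← Finset.sum_add_distrib, Finset.sum_congr rfl fun i _ ↦ hsum i, Finset.sum_const,
    Finset.card_range, smul_eq_mul]
  ring

/-! ### Divisibility of Gauss sums by powers of `z - 1` -/

section GaussSums

variable {F A : Type*} [Field F] [Fintype F] [CommRing A] [IsDomain A]

theorem gaussSum_mul_dvd (χ φ : MulChar F A) {ψ : AddChar F A} (hψ : ψ ≠ 1) :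
    gaussSum (χ * φ) ψ ∣ gaussSum χ ψ * gaussSum φ ψ := by
  by_cases h : χ * φ = 1
  · rw [h, gaussSum_one_left hψ]
    exact (isUnit_one.neg).dvd
  · exact ⟨_, (jacobiSum_mul_nontrivial h ψ).symm⟩

theorem gaussSum_mul_gaussSum_inv {χ : MulChar F A} (hχ : χ ≠ 1) {ψ : AddChar F A}
    (hψ : ψ.IsPrimitive) :
    gaussSum χ ψ * gaussSum χ⁻¹ ψ = χ (-1) * Fintype.card F := by
  rw [← mul_gaussSum_inv_eq_gaussSum χ⁻¹, mul_left_comm, gaussSum_mul_gaussSum_eq_card hχ hψ,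
    MulChar.inv_apply', inv_neg_one]

theorem associated_prime_sub_one_pow {l : ℕ} (hl : l.Prime) {z : A} (hz : IsPrimitiveRoot z l) :
    Associated (l : A) ((z - 1) ^ (l - 1)) := by
  obtain ⟨k, rfl⟩ := Nat.exists_eq_add_of_lt hl.pos
  simp only [zero_add, Nat.add_sub_cancel] at *
  have h := hz.prod_pow_sub_one_eq_order
  push_cast
  rw [← h]
  refine (associated_unit_mul_left _ _ (isUnit_one.neg.pow _)).trans ?_
  have h2 : (z - 1) ^ k = ∏ _i ∈ Finset.range k, (z - 1) := by simp
  rw [h2]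
  refine Associated.prod _ _ _ fun i hi ↦ Associated.symm ?_
  refine hz.associated_sub_one_pow_sub_one_of_coprime ?_
  refine Nat.Coprime.symm ((Nat.Prime.coprime_iff_not_dvd hl).mpr fun hd ↦ ?_)
  have := Nat.le_of_dvd (Nat.succ_pos i) hd
  have := Finset.mem_range.mp hi
  omega

variable {l : ℕ} [Fact l.Prime] [CharP F l] [Algebra (ZMod l) F] {ψ : AddChar F A} {z : A}

omit [IsDomain A] in
theorem isPrimitive_of_trace (hz : IsPrimitiveRoot z l)
    (hψ : ∀ x, ψ x = z ^ (Algebra.trace (ZMod l) F x).val) : ψ.IsPrimitive := by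
  obtain rfl : l = ringChar F := (ringChar.eq F l).symm
  refine AddChar.IsPrimitive.of_ne_one ?_
  obtain ⟨a, ha⟩ := FiniteField.trace_to_zmod_nondegenerate F one_ne_zero
  rw [one_mul] at ha
  refine AddChar.ne_one_iff.mpr ⟨a, fun hf ↦ ha ?_⟩
  rw [hψ] at hf
  exact (ZMod.val_eq_zero _).mp (Nat.eq_zero_of_dvd_of_lt ((hz.pow_eq_one_iff_dvd _).mp hf)
    (ZMod.val_lt _))

omit [IsDomain A] [CharP F l] in
theorem gaussSum_frobenius (hψ : ∀ x, ψ x = z ^ (Algebra.trace (ZMod l) F x).val)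
    (χ : MulChar F A) : gaussSum (χ ^ l) ψ = gaussSum χ ψ := by
  have hl := (Fact.out : l.Prime)
  let e := FiniteField.frobeniusAlgEquivOfAlgebraic (ZMod l) F
  have he : ∀ x, e x = x ^ l := fun x ↦ by
    simp [e, ZMod.card]
  refine Fintype.sum_bijective e e.bijective _ _ fun x ↦ ?_
  rw [hψ (e x), Algebra.trace_eq_of_algEquiv, ← hψ, he, map_pow, MulChar.pow_apply' _ hl.ne_zero]

section LocalRing

variable [IsLocalRing A] {ω : MulChar F A} {ι : F →+* IsLocalRing.ResidueField A}

omit [Fintype F] [Algebra (ZMod l) F] in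
theorem residue_sub_one_eq_zero (ι : F →+* IsLocalRing.ResidueField A) (hz : IsPrimitiveRoot z l) :
    IsLocalRing.residue A (z - 1) = 0 := by
  have hl := (Fact.out : l.Prime)
  have h1 : IsLocalRing.residue A (l : A) = 0 := by
    rw [map_natCast, ← map_natCast ι, CharP.cast_eq_zero, map_zero]
  obtain ⟨u, hu⟩ := associated_prime_sub_one_pow hl hz
  have h2 : IsLocalRing.residue A ((z - 1) ^ (l - 1)) = 0 := by
    rw [← hu, map_mul, h1, zero_mul]
  rw [map_pow] at h2
  exact pow_eq_zero_iff (by have := hl.two_le; omega) |>.mp h2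

omit [CharP F l] in
/-- Only the first term of `Tr(x) = ∑ x ^ (l ^ i)` contributes: `∑ x ^ (l ^ i - 1)` vanishes for
`0 < i < f`. -/
theorem sum_inv_mul_trace (hq : 2 < Fintype.card F) :
    ∑ x : F, x⁻¹ * algebraMap (ZMod l) F (Algebra.trace (ZMod l) F x) = -1 := by
  classical
  have hl := (Fact.out : l.Prime)
  have hcard : Fintype.card F = l ^ Module.finrank (ZMod l) F := by
    rw [Module.card_eq_pow_finrank (K := ZMod l), ZMod.card]
  set f := Module.finrank (ZMod l) F with hf
  have hf0 : 0 < f := Module.finrank_pos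
  simp_rw [FiniteField.algebraMap_trace_eq_sum_pow, Finset.mul_sum]
  rw [Finset.sum_comm]
  simp_rw [Nat.card_zmod]
  rw [← hf, Finset.sum_eq_single 0]
  · rw [← Finset.sum_sdiff (Finset.subset_univ {(0 : F)})]
    have h1 : ∀ x ∈ Finset.univ \ {(0 : F)}, x⁻¹ * x ^ l ^ 0 = 1 := by
      intro x hx
      have : x ≠ 0 := by simpa using hx
      simp [this]
    rw [Finset.sum_congr rfl h1, Finset.sum_const, Finset.card_sdiff_of_subset (Finset.subset_univ _),
      Finset.card_univ, Finset.card_singleton, nsmul_one, Nat.cast_sub (by omega)]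
    simp
  · intro i hi hi0
    have hi' := Finset.mem_range.mp hi
    have h2 : 1 < l ^ i := Nat.one_lt_pow hi0 hl.one_lt
    have h3 : l ^ i < l ^ f := Nat.pow_lt_pow_right hl.one_lt hi'
    rw [← FiniteField.sum_pow_lt_card_sub_one (K := F) (l ^ i - 1) (by omega)]
    refine Finset.sum_congr rfl fun x _ ↦ ?_
    by_cases hx : x = 0
    · subst hx
      rw [inv_zero, zero_mul, zero_pow (by omega)]
    · rw [pow_sub₀ x hx h2.le, pow_one, mul_comm]
  · intro h
    exact absurd (Finset.mem_range.mpr hf0) h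

/-- The Gauss sum of the inverse of the Teichmüller character is `z - 1` times a unit: modulo
`(z - 1) ^ 2` one has `z ^ Tr(x) = 1 + Tr(x) (z - 1)`, and `∑ x⁻¹ Tr(x) = -1`. -/
theorem associated_gaussSum_inv (hz : IsPrimitiveRoot z l)
    (hψ : ∀ x, ψ x = z ^ (Algebra.trace (ZMod l) F x).val)
    (hω : ∀ x, IsLocalRing.residue A (ω x) = ι x) (hq : 2 < Fintype.card F) :
    Associated (gaussSum ω⁻¹ ψ) (z - 1) := by
  have hl := (Fact.out : l.Prime)
  have hres : IsLocalRing.residue A z = 1 := by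
    have := residue_sub_one_eq_zero ι hz
    rwa [map_sub, map_one, sub_eq_zero] at this
  have hωinv : ∀ x, IsLocalRing.residue A (ω⁻¹ x) = ι x⁻¹ := fun x ↦ by
    rw [MulChar.inv_apply', hω]
  have hne : ω⁻¹ ≠ 1 := by
    intro h
    obtain ⟨x, hx0, hx1⟩ : ∃ x : F, x ≠ 0 ∧ x ≠ 1 := by
      classical
      by_contra! hcon
      have : (Finset.univ : Finset F) ⊆ {0, 1} := fun x _ ↦ by
        by_cases hx : x = 0
        · simp [hx]
        · simp [hcon x hx]
      have h1 := Finset.card_le_card this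
      have h2 := Finset.card_le_two (a := (0 : F)) (b := 1)
      rw [Finset.card_univ] at h1
      omega
    have h1 := hωinv x⁻¹
    rw [h, MulChar.one_apply (isUnit_iff_ne_zero.mpr (inv_ne_zero hx0)), map_one, inv_inv] at h1
    exact hx1 (ι.injective (by rw [← h1, map_one]))
  let S : A := ∑ x : F, ω⁻¹ x * ∑ i ∈ Finset.range (Algebra.trace (ZMod l) F x).val, z ^ i
  have h1 : gaussSum ω⁻¹ ψ = S * (z - 1) := by
    have h2 : gaussSum ω⁻¹ ψ = ∑ x : F, ω⁻¹ x + S * (z - 1) := by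
      rw [gaussSum, Finset.sum_mul, ← Finset.sum_add_distrib]
      refine Finset.sum_congr rfl fun x _ ↦ ?_
      rw [mul_assoc, geom_sum_mul, hψ]
      ring
    rw [h2, MulChar.sum_eq_zero_of_ne_one hne, zero_add]
  have h2 : IsLocalRing.residue A S = -1 := by
    have h3 := congrArg ι (sum_inv_mul_trace (F := F) (l := l) hq)
    rw [map_neg, map_one] at h3
    rw [← h3]
    simp only [S, map_sum, map_mul, map_pow, hωinv, hres, one_pow]
    refine Finset.sum_congr rfl fun x _ ↦ ?_
    congr 1
    rw [Finset.sum_const, Finset.card_range, nsmul_one]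
    conv_rhs => rw [← ZMod.natCast_zmod_val (Algebra.trace (ZMod l) F x)]
    rw [map_natCast, map_natCast]
  have h3 : IsUnit S := by
    by_contra hS
    have h4 := (IsLocalRing.residue_eq_zero_iff S).mpr ((IsLocalRing.mem_maximalIdeal S).mpr hS)
    rw [h4] at h2
    exact one_ne_zero (neg_eq_zero.mp h2.symm)
  rw [h1]
  exact associated_unit_mul_left _ _ h3

omit [IsDomain A] [IsLocalRing A] in
theorem inv_pow_eq_of_mod_eq {a b : ℕ} (h : a % (Fintype.card F - 1) = b % (Fintype.card F - 1)) :
    (ω⁻¹) ^ a = (ω⁻¹) ^ b := by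
  have h1 : (ω⁻¹) ^ (Fintype.card F - 1) = 1 := by
    classical
    rw [← Fintype.card_units]
    exact MulChar.pow_card_eq_one _
  rw [← Nat.mod_add_div a (Fintype.card F - 1), ← Nat.mod_add_div b (Fintype.card F - 1), h,
    pow_add, pow_add, pow_mul, pow_mul, h1, one_pow, one_pow]

omit [IsDomain A] in
theorem inv_pow_ne_one (hω : ∀ x, IsLocalRing.residue A (ω x) = ι x) {a : ℕ} (ha0 : 0 < a)
    (ha : a < Fintype.card F - 1) : ω⁻¹ ^ a ≠ 1 := by
  intro h
  obtain ⟨g, hg⟩ := IsCyclic.exists_generator (α := Fˣ)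
  have h1 : g⁻¹ ^ a = 1 := by
    refine Units.ext (ι.injective ?_)
    rw [Units.val_pow_eq_pow_val, map_pow, ← hω, Units.val_one, map_one, ← map_pow,
      Units.val_inv_eq_inv_val, ← MulChar.inv_apply', ← MulChar.pow_apply' _ ha0.ne', h,
      MulChar.one_apply_coe, map_one]
  rw [inv_pow, inv_eq_one] at h1
  classical
  have h2 := orderOf_dvd_of_pow_eq_one h1
  rw [orderOf_eq_card_of_forall_mem_zpowers hg, Nat.card_eq_fintype_card, Fintype.card_units] at h2
  exact absurd (Nat.le_of_dvd ha0 h2) (not_le.mpr ha)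

/-- The Gauss sum of the `(-a)`-th power of the Teichmüller character divides `(z - 1) ^ C`, where
`C` is the digit sum of `a`. -/
theorem gaussSum_dvd_pow_digitExp (hz : IsPrimitiveRoot z l)
    (hψ : ∀ x, ψ x = z ^ (Algebra.trace (ZMod l) F x).val)
    (hω : ∀ x, IsLocalRing.residue A (ω x) = ι x) (hq : 2 < Fintype.card F) {f : ℕ}
    (hf : Fintype.card F = l ^ f) {a : ℕ} (ha : a < Fintype.card F - 1) :
    gaussSum (ω⁻¹ ^ a) ψ ∣ (z - 1) ^ digitExp l f a := by
  have hl := (Fact.out : l.Prime)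
  have hψ1 : ψ ≠ 1 := by
    intro h
    have h1 := isPrimitive_of_trace hz hψ one_ne_zero
    rw [h] at h1
    exact h1 (by ext; simp)
  have h1 : ∀ c, gaussSum (ω⁻¹ ^ c) ψ ∣ (z - 1) ^ c := by
    intro c
    induction c with
    | zero =>
      rw [pow_zero, gaussSum_one_left hψ1]
      exact isUnit_one.neg.dvd
    | succ c ih =>
      rw [pow_succ, pow_succ]
      exact (gaussSum_mul_dvd _ _ hψ1).trans
        (mul_dvd_mul ih (associated_gaussSum_inv hz hψ hω hq).dvd)
  let m := l ^ f - 1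
  have ham : a < m := by rwa [hf] at ha
  let c : ℕ → ℕ := fun i ↦ l * (l ^ i * a % m) / m
  -- `c i` are the digits of `a`, from the leading one on, and `D k` is the number formed by the
  -- first `k` of them; Frobenius invariance allows the step from `D k` to `l * D k`
  let D : ℕ → ℕ := fun k ↦ Nat.rec 0 (fun i d ↦ l * d + c i) k
  have hD : ∀ k, D (k + 1) = l * D k + c k := fun k ↦ rfl
  have h2 : ∀ k, l ^ k * a = m * D k + l ^ k * a % m ∧
      gaussSum (ω⁻¹ ^ D k) ψ ∣ (z - 1) ^ ∑ i ∈ Finset.range k, c i := by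
    intro k
    induction k with
    | zero =>
      refine ⟨?_, ?_⟩
      · rw [pow_zero, one_mul, Nat.mod_eq_of_lt ham]
        simp [D]
      · exact h1 0
    | succ k ih =>
      refine ⟨?_, ?_⟩
      · have h3 := pow_succ_mul_mod l m a k
        rw [hD, pow_succ', mul_assoc]
        conv_lhs => rw [ih.1]
        rw [pow_succ', mul_assoc] at h3
        simp only [c]
        nlinarith
      · rw [hD, pow_add, Finset.sum_range_succ, pow_add]
        refine (gaussSum_mul_dvd _ _ hψ1).trans (mul_dvd_mul ?_ (h1 _))
        rw [mul_comm l, pow_mul, gaussSum_frobenius hψ]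
        exact ih.2
  obtain ⟨h3, h4⟩ := h2 f
  have hm : 0 < m := by
    simp only [m]
    omega
  have hDa : D f = a := by
    rw [pow_mul_mod_pow_sub_one l f a hl.pos, Nat.mod_eq_of_lt ham] at h3
    have h5 : l ^ f = m + 1 := by
      simp only [m]
      omega
    rw [h5, Nat.add_mul, one_mul] at h3
    exact (Nat.eq_of_mul_eq_mul_left hm (by omega)).symm
  rw [hDa] at h4
  exact h4

/-- **Stickelberger's theorem**, locally: the Gauss sum of the `(-a)`-th power of the Teichmüller
character is `(z - 1) ^ C` up to a unit, where `C` is the digit sum of `a`. It divides that power,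
and the product of the Gauss sums at `a` and `q - 1 - a` is `q` up to sign, so equality holds. -/
theorem associated_gaussSum_pow_digitExp (hz : IsPrimitiveRoot z l)
    (hψ : ∀ x, ψ x = z ^ (Algebra.trace (ZMod l) F x).val)
    (hω : ∀ x, IsLocalRing.residue A (ω x) = ι x) (hq : 2 < Fintype.card F) {f : ℕ}
    (hf : Fintype.card F = l ^ f) {a : ℕ} (ha0 : 0 < a) (ha : a < Fintype.card F - 1)
    (h0 : (l : A) ≠ 0) :
    Associated (gaussSum (ω⁻¹ ^ a) ψ) ((z - 1) ^ digitExp l f a) := by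
  have hl := (Fact.out : l.Prime)
  have hne := inv_pow_ne_one hω ha0 ha
  have hprim := isPrimitive_of_trace hz hψ
  have hb0 : 0 < Fintype.card F - 1 - a := by omega
  have hb : Fintype.card F - 1 - a < Fintype.card F - 1 := by omega
  obtain ⟨u, hu⟩ := gaussSum_dvd_pow_digitExp hz hψ hω hq hf ha
  obtain ⟨w, hw⟩ := gaussSum_dvd_pow_digitExp hz hψ hω hq hf hb
  have hinv : ω⁻¹ ^ (Fintype.card F - 1 - a) = (ω⁻¹ ^ a)⁻¹ := by
    rw [eq_inv_iff_mul_eq_one, ← pow_add, ← pow_zero ω⁻¹]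
    refine inv_pow_eq_of_mod_eq ?_
    rw [Nat.sub_add_cancel (by omega), Nat.mod_self, Nat.zero_mod]
  have h1 : Associated ((z - 1) ^ digitExp l f a * (z - 1) ^ digitExp l f (Fintype.card F - 1 - a))
      (gaussSum (ω⁻¹ ^ a) ψ * gaussSum (ω⁻¹ ^ (Fintype.card F - 1 - a)) ψ) := by
    rw [hinv, gaussSum_mul_gaussSum_inv hne hprim, ← pow_add,
      digitExp_add_digitExp l f _ _ hl (by omega) ha0 hb0, hf, pow_mul, Nat.cast_pow]
    have h2 := (associated_prime_sub_one_pow hl hz).symm.pow_pow (n := f)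
    refine h2.trans (associated_unit_mul_left _ _ ?_).symm
    exact (isUnit_one.neg).map _
  have h3 : gaussSum (ω⁻¹ ^ a) ψ * gaussSum (ω⁻¹ ^ (Fintype.card F - 1 - a)) ψ ≠ 0 := by
    rw [hinv, gaussSum_mul_gaussSum_inv hne hprim, hf, Nat.cast_pow]
    exact mul_ne_zero ((isUnit_one.neg).map _).ne_zero (pow_ne_zero _ h0)
  rw [hu, hw] at h1
  obtain ⟨t, ht⟩ := h1
  have h4 : u * (w * t) = 1 := by
    refine mul_left_cancel₀ h3 ?_
    rw [mul_one]
    conv_rhs => rw [← ht]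
    ring
  rw [hu]
  exact (associated_mul_unit_right _ _ (IsUnit.of_mul_eq_one _ h4))

/-- Stickelberger's theorem for all exponents, in a form without quotients. -/
theorem associated_gaussSum_pow (hz : IsPrimitiveRoot z l)
    (hψ : ∀ x, ψ x = z ^ (Algebra.trace (ZMod l) F x).val)
    (hω : ∀ x, IsLocalRing.residue A (ω x) = ι x) (hq : 2 < Fintype.card F) {f : ℕ}
    (hf : Fintype.card F = l ^ f) (h0 : (l : A) ≠ 0) (a : ℕ) :
    Associated (gaussSum (ω⁻¹ ^ a) ψ ^ (Fintype.card F - 1))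
      ((z - 1) ^ ((l - 1) * ∑ i ∈ Finset.range f, l ^ i * a % (Fintype.card F - 1))) := by
  have hl := (Fact.out : l.Prime)
  have hprim := isPrimitive_of_trace hz hψ
  have h1 : (ω⁻¹) ^ a = (ω⁻¹) ^ (a % (Fintype.card F - 1)) :=
    inv_pow_eq_of_mod_eq (Nat.mod_mod _ _).symm
  have h2 : ∀ i, l ^ i * a % (Fintype.card F - 1) =
      l ^ i * (a % (Fintype.card F - 1)) % (Fintype.card F - 1) :=
    fun i ↦ (Nat.mul_mod_mod _ _ _).symm
  simp_rw [h2]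
  rw [h1]
  have hlt := Nat.mod_lt a (by omega : 0 < Fintype.card F - 1)
  generalize a % (Fintype.card F - 1) = r at hlt
  rcases Nat.eq_zero_or_pos r with rfl | hr
  · have hψ1 : ψ ≠ 1 := by
      intro h
      have h1 := hprim one_ne_zero
      rw [h] at h1
      exact h1 (by ext; simp)
    simp only [mul_zero, Nat.zero_mod, Finset.sum_const_zero, pow_zero, gaussSum_one_left hψ1]
    exact associated_one_iff_isUnit.mpr (isUnit_one.neg.pow _)
  · rw [hf, ← mul_digitExp l f r hl.pos, mul_comm, pow_mul, ← hf]
    exact (associated_gaussSum_pow_digitExp hz hψ hω hq hf hr hlt h0).pow_pow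

end LocalRing

end GaussSums

/-! ### Valuations of complex Gauss sums -/

section Valuations

open Polynomial

theorem isAlgClosed_residueField {K : Type*} [Field K] [IsAlgClosed K] (A : ValuationSubring K) :
    IsAlgClosed (IsLocalRing.ResidueField A) := by
  refine IsAlgClosed.of_exists_root _ fun P hP hirr ↦ ?_
  obtain ⟨P', hP', hdeg, hmonic⟩ := Polynomial.lifts_and_natDegree_eq_and_monic
    (Polynomial.map_surjective _ IsLocalRing.residue_surjective P) hP
  have hdeg0 : (P'.map (algebraMap A K)).degree ≠ 0 := by
    rw [hmonic.degree_map, Polynomial.degree_eq_natDegree hmonic.ne_zero, hdeg]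
    exact_mod_cast hirr.natDegree_pos.ne'
  obtain ⟨x, hx⟩ := IsAlgClosed.exists_root _ hdeg0
  have hint : IsIntegral A x := ⟨P', hmonic, by rwa [Polynomial.IsRoot, Polynomial.eval_map] at hx⟩
  obtain ⟨y, rfl⟩ := (IsIntegrallyClosed.isIntegral_iff).mp hint
  refine ⟨IsLocalRing.residue A y, ?_⟩
  rw [Polynomial.IsRoot, Polynomial.eval_map, Polynomial.eval₂_at_apply] at hx
  have h0 : P'.eval y = 0 := (IsFractionRing.injective A K) (by rw [hx, map_zero])
  rw [← hP', Polynomial.eval_map, Polynomial.eval₂_at_apply, h0, map_zero]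

theorem isIntegral_mem {K : Type*} [Field K] (A : ValuationSubring K) {x : K}
    (hx : IsIntegral ℤ x) : x ∈ A := by
  have h : IsIntegral A x := hx.tower_top
  obtain ⟨y, rfl⟩ := (IsIntegrallyClosed.isIntegral_iff).mp h
  exact y.2

theorem mem_of_pow_eq_one {K : Type*} [Field K] (A : ValuationSubring K) {x : K} {n : ℕ}
    (hn : 0 < n) (hx : x ^ n = 1) : x ∈ A :=
  isIntegral_mem A (IsIntegral.of_pow hn (hx ▸ isIntegral_one))

/-- The Teichmüller character of a finite subfield of the residue field of a valuation ring
of `ℂ`. -/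
theorem exists_teichmuller (A : ValuationSubring ℂ) {F : Type*} [Field F] [Fintype F]
    (ι : F →+* IsLocalRing.ResidueField A) :
    ∃ ω : MulChar F A, ∀ x, IsLocalRing.residue A (ω x) = ι x := by
  classical
  obtain ⟨g, hg⟩ := IsCyclic.exists_generator (α := Fˣ)
  set n := Fintype.card Fˣ with hn
  have hn0 : 0 < n := Fintype.card_pos
  have hξ := Complex.isPrimitiveRoot_exp n hn0.ne'
  let ξ : A := ⟨_, mem_of_pow_eq_one A hn0 hξ.pow_eq_one⟩
  have hξ' : IsPrimitiveRoot ξ n :=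
    IsPrimitiveRoot.of_map_of_injective (f := algebraMap A ℂ) hξ (IsFractionRing.injective A ℂ)
  obtain ⟨y, hy⟩ := IsLocalRing.residue_surjective (ι g)
  have h1 := congrArg (Polynomial.eval y) (Polynomial.X_pow_sub_one_eq_prod hn0 hξ')
  have h2 : IsLocalRing.residue A (y ^ n - 1) = 0 := by
    rw [map_sub, map_pow, hy, map_one, ← map_pow, ← Units.val_pow_eq_pow_val, hn,
      pow_card_eq_one, Units.val_one, map_one, sub_self]
  rw [Polynomial.eval_prod] at h1
  simp only [Polynomial.eval_sub, Polynomial.eval_pow, Polynomial.eval_X, Polynomial.eval_one,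
    Polynomial.eval_C] at h1
  rw [h1, map_prod, Finset.prod_eq_zero_iff] at h2
  obtain ⟨η, hη, hη0⟩ := h2
  have hηn : η ^ n = 1 := (Polynomial.mem_nthRootsFinset hn0 1).mp hη
  rw [map_sub, hy, sub_eq_zero] at hη0
  have hmem : (Units.ofPowEqOne η n hηn hn0.ne') ∈ rootsOfUnity n A :=
    Units.ext (by simp)
  refine ⟨MulChar.ofRootOfUnity hmem hg, fun x ↦ ?_⟩
  by_cases hx : x = 0
  · rw [hx, MulChar.map_zero, map_zero, map_zero]
  · obtain ⟨k, hk⟩ := (mem_powers_iff_mem_zpowers).mpr (hg (Units.mk0 x hx))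
    have hxk : x = (g : F) ^ k := by
      have := congrArg Units.val hk
      simpa using this.symm
    rw [hxk, map_pow, map_pow, map_pow, MulChar.ofRootOfUnity_spec, hη0]
    simp

variable (A : ValuationSubring ℂ) {F : Type*} [Field F] [Fintype F] {l : ℕ} [Fact l.Prime]
  [CharP F l] [Algebra (ZMod l) F] {ψ : AddChar F ℂ} {z : ℂ}

omit [Fact l.Prime] [CharP F l] [Algebra (ZMod l) F] in
theorem valuation_gaussSum_eq_one (hlA : A.valuation (l : ℂ) = 1) (χ : MulChar F ℂ)
    (hψ : ψ.IsPrimitive) {f : ℕ} (hf : Fintype.card F = l ^ f) :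
    A.valuation (gaussSum χ ψ) = 1 := by
  have hmem : ∀ φ : MulChar F ℂ, A.valuation (gaussSum φ ψ) ≤ 1 := by
    classical
    intro φ
    rw [A.valuation_le_one_iff]
    refine sum_mem fun x _ ↦ mul_mem ?_ ?_
    · by_cases hx : x = 0
      · rw [hx, MulChar.map_zero]
        exact zero_mem A
      · refine mem_of_pow_eq_one A (Fintype.card_pos (α := Fˣ)) ?_
        rw [← map_pow, ← Units.val_mk0 hx, ← Units.val_pow_eq_pow_val, pow_card_eq_one,
          Units.val_one, map_one]
    · refine mem_of_pow_eq_one A (Fintype.card_pos (α := F)) ?_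
      rw [← AddChar.map_nsmul_eq_pow, card_nsmul_eq_zero, AddChar.map_zero_eq_one]
  by_cases hχ : χ = 1
  · have hψ1 : ψ ≠ 1 := by
      intro h
      have h1 := hψ one_ne_zero
      rw [h] at h1
      exact h1 (by ext; simp)
    rw [hχ, gaussSum_one_left hψ1, Valuation.map_neg, map_one]
  · have h1 := congrArg A.valuation (gaussSum_mul_gaussSum_inv hχ hψ)
    have h2 : A.valuation (χ (-1)) = 1 := by
      have h3 : A.valuation (χ (-1)) ^ 2 = 1 := by
        rw [← map_pow, ← map_pow, neg_one_sq, map_one, map_one]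
      exact (pow_eq_one_iff_of_nonneg zero_le two_ne_zero).mp h3
    rw [map_mul, map_mul, h2, hf, Nat.cast_pow, map_pow, hlA, one_pow, one_mul] at h1
    refine le_antisymm (hmem χ) ?_
    rw [← h1]
    exact mul_le_of_le_one_right' (hmem χ⁻¹)

omit [Fintype F] [CharP F l] in
theorem exists_embedding [Finite F] (hlA : A.valuation (l : ℂ) < 1) :
    Nonempty (F →+* IsLocalRing.ResidueField A) := by
  have hl0 : ((l : ℕ) : IsLocalRing.ResidueField A) = 0 := by
    have h : (l : A) ∈ IsLocalRing.maximalIdeal A := by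
      rw [ValuationSubring.valuation_lt_one_iff]
      simpa using hlA
    rw [← map_natCast (IsLocalRing.residue A)]
    exact (IsLocalRing.residue_eq_zero_iff _).mpr h
  have hchar : CharP (IsLocalRing.ResidueField A) l :=
    (CharP.charP_iff_prime_eq_zero Fact.out).mpr hl0
  let _ : Algebra (ZMod l) (IsLocalRing.ResidueField A) := ZMod.algebra _ l
  have := isAlgClosed_residueField A
  exact ⟨(IsAlgClosed.lift : F →ₐ[ZMod l] IsLocalRing.ResidueField A).toRingHom⟩

/-- The valuation of the Gauss sum of a character `χ` of order dividing `N`, which is expressed in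
terms of the Teichmüller character `ω` by its value at a generator `g`. -/
theorem valuation_gaussSum_pow {ι : F →+* IsLocalRing.ResidueField A} {ω : MulChar F A}
    (hω : ∀ x, IsLocalRing.residue A (ω x) = ι x) (hz : IsPrimitiveRoot z l)
    (hψ : ∀ x, ψ x = z ^ (Algebra.trace (ZMod l) F x).val)
    (hq : 2 < Fintype.card F) {f : ℕ} (hf : Fintype.card F = l ^ f) {N e : ℕ}
    (hN : Fintype.card F - 1 = N * e) {χ : MulChar F ℂ} {g : Fˣ}
    (hg : ∀ x, x ∈ Subgroup.zpowers g) {b : ℕ} (hb : χ g * (ω g : ℂ) ^ (b * e) = 1) (c : ℕ) :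
    A.valuation (gaussSum (χ ^ c) ψ) ^ N =
      A.valuation (z - 1) ^ ((l - 1) * ∑ i ∈ Finset.range f, l ^ i * (b * c) % N) := by
  have hl := (Fact.out : l.Prime)
  let zA : A := ⟨z, mem_of_pow_eq_one A hl.pos hz.pow_eq_one⟩
  have hzA : IsPrimitiveRoot zA l :=
    IsPrimitiveRoot.of_map_of_injective (f := algebraMap A ℂ) hz (IsFractionRing.injective A ℂ)
  let ψA : AddChar F A := (AddChar.zmodChar l hzA.pow_eq_one).compAddMonoidHom
    (Algebra.trace (ZMod l) F).toAddMonoidHom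
  have hψA : ∀ x, ψA x = zA ^ (Algebra.trace (ZMod l) F x).val := fun x ↦ rfl
  have h0 : (l : A) ≠ 0 := by
    intro h
    have := congrArg (algebraMap A ℂ) h
    rw [map_natCast, map_zero] at this
    exact hl.ne_zero (by exact_mod_cast this)
  have h1 := associated_gaussSum_pow hzA hψA hω hq hf h0 (b * c * e)
  have hχ : χ ^ c = (ω⁻¹ ^ (b * c * e)).ringHomComp (algebraMap A ℂ) := by
    rw [MulChar.eq_iff hg, MulChar.pow_apply_coe, MulChar.ringHomComp_apply,
      MulChar.pow_apply_coe, map_pow, mul_right_comm, pow_mul]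
    congr 1
    have h2 : ((ω⁻¹ g : A) : ℂ) * (ω g : ℂ) = 1 := by
      rw [← MulMemClass.coe_mul, ← MulChar.mul_apply, inv_mul_cancel, MulChar.one_apply_coe]
      rfl
    have h3 : (ω g : ℂ) ^ (b * e) ≠ 0 := fun h ↦ by
      rw [h, mul_zero] at hb
      exact zero_ne_one hb
    refine mul_right_cancel₀ h3 ?_
    rw [hb, ValuationSubring.algebraMap_apply, ← mul_pow, h2, one_pow]
  have h2 : gaussSum (χ ^ c) ψ = algebraMap A ℂ (gaussSum (ω⁻¹ ^ (b * c * e)) ψA) := by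
    rw [gaussSum, gaussSum, map_sum]
    refine Finset.sum_congr rfl fun x _ ↦ ?_
    rw [hχ, MulChar.ringHomComp_apply, map_mul, hψ, hψA, map_pow]
    rfl
  have he : e ≠ 0 := by
    rintro rfl
    omega
  refine (pow_left_inj₀ zero_le zero_le he).mp ?_
  obtain ⟨u, hu⟩ := h1
  have h3 := congrArg (fun x : A ↦ A.valuation (x : ℂ)) hu
  simp only [MulMemClass.coe_mul, SubmonoidClass.coe_pow, map_mul, map_pow] at h3
  rw [ValuationSubring.valuation_unit, mul_one, hN] at h3
  rw [← pow_mul, h2]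
  refine h3.trans ?_
  rw [← pow_mul]
  congr 1
  rw [mul_assoc (l - 1), Finset.sum_mul]
  congr 1
  refine Finset.sum_congr rfl fun i _ ↦ ?_
  rw [← mul_assoc, Nat.mul_mod_mul_right]

theorem sum_range_mul_pow_mul_mod {l f M : ℕ} (hM : l ^ f % M = 1 % M) (s u : ℕ) :
    ∑ i ∈ Finset.range (f * s), l ^ i * u % M = s * ∑ i ∈ Finset.range f, l ^ i * u % M := by
  induction s with
  | zero => simp
  | succ s ih =>
    rw [Nat.mul_succ, Finset.sum_range_add, ih, Nat.add_mul, one_mul]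
    congr 1
    refine Finset.sum_congr rfl fun i _ ↦ ?_
    have h : l ^ (f * s) % M = 1 % M := by
      rw [pow_mul, Nat.pow_mod, hM, ← Nat.pow_mod, one_pow]
    rw [pow_add, mul_assoc, Nat.mul_mod, h, ← Nat.mul_mod, one_mul]

variable {F₀ : Type*} [Field F₀] [Fintype F₀] [Algebra F₀ F] [CharP F₀ l] [Algebra (ZMod l) F₀]
  {ψ₀ : AddChar F₀ ℂ}

/-- The product formula for Gauss sums, up to units of a valuation ring: both sides have the
same valuation by Stickelberger's theorem. In the application `κ` runs through the residues
modulo `p * M` which are congruent to `κ₀` modulo `M`. -/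
theorem prod_valuation_gaussSum (hz : IsPrimitiveRoot z l)
    (hψ : ∀ x, ψ x = z ^ (Algebra.trace (ZMod l) F x).val)
    (hψ₀ : ∀ x, ψ₀ x = z ^ (Algebra.trace (ZMod l) F₀ x).val)
    (hq₀ : 2 < Fintype.card F₀) {f s : ℕ} (hf₀ : Fintype.card F₀ = l ^ f)
    (hf : Fintype.card F = l ^ (f * s)) {p M e e₀ : ℕ} (hM : Fintype.card F₀ - 1 = M * e₀)
    (hN : Fintype.card F - 1 = p * M * e) (hcop : l.Coprime (p * M)) {χ : MulChar F ℂ}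
    {χ₀ : MulChar F₀ ℂ} {g : Fˣ} (hg : ∀ x, x ∈ Subgroup.zpowers g) {g₀ : F₀ˣ}
    (hg₀ : ∀ x, x ∈ Subgroup.zpowers g₀)
    {t : ℕ} (ht : Fintype.card F - 1 = (Fintype.card F₀ - 1) * t)
    (hgg : algebraMap F₀ F g₀ = g ^ t) (hχ : IsPrimitiveRoot (χ g) (p * M))
    (hχ₀ : χ₀ g₀ = χ g ^ p) {R : Type*} [Fintype R] (κ : R → ℕ) (κ₀ h : ℕ)
    (hκ : ∀ u : ℕ, u.Coprime (p * M) →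
      ∑ r, u * κ r % (p * M) = p * (u * κ₀ % M) + M * (p * h)) :
    ∏ r, A.valuation (gaussSum (χ ^ κ r) ψ) =
      A.valuation (gaussSum (χ₀ ^ κ₀) ψ₀) ^ s * A.valuation (Fintype.card F : ℂ) ^ h := by
  classical
  have hl := (Fact.out : l.Prime)
  have hlle : A.valuation (l : ℂ) ≤ 1 := by
    rw [A.valuation_le_one_iff]
    exact natCast_mem A l
  have hcardle : Fintype.card F₀ ≤ Fintype.card F :=
    Fintype.card_le_of_injective _ (algebraMap F₀ F).injective
  have hpM : p * M ≠ 0 := by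
    intro h0
    rw [h0, zero_mul] at hN
    omega
  -- if `l` is a unit of `A`, then so are all the Gauss sums
  rcases hlle.lt_or_eq with hlA | hlA
  swap
  · have hprim := isPrimitive_of_trace hz hψ
    have hprim₀ := isPrimitive_of_trace hz hψ₀
    rw [valuation_gaussSum_eq_one A hlA _ hprim₀ hf₀, hf, Nat.cast_pow, map_pow, hlA, one_pow,
      one_pow, one_pow, one_mul]
    exact Finset.prod_eq_one fun r _ ↦ valuation_gaussSum_eq_one A hlA _ hprim hf
  obtain ⟨ι⟩ := exists_embedding (F := F) A hlA
  obtain ⟨ω, hω⟩ := exists_teichmuller A ι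
  let ω₀ : MulChar F₀ A := MulChar.ofUnitHom
    (ω.toUnitHom.comp (Units.map (algebraMap F₀ F).toMonoidHom))
  have hω₀u : ∀ x : F₀ˣ, ω₀ x = ω (algebraMap F₀ F x) := fun x ↦ by
    simp [ω₀]
  have hω₀ : ∀ x, IsLocalRing.residue A (ω₀ x) = (ι.comp (algebraMap F₀ F)) x := by
    intro x
    by_cases hx : x = 0
    · rw [hx, MulChar.map_zero, map_zero, map_zero]
    · have := hω₀u (Units.mk0 x hx)
      rw [Units.val_mk0] at this
      rw [this, hω, RingHom.comp_apply]
  -- the Teichmüller character is faithful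
  have hprimω : IsPrimitiveRoot (ω g : ℂ) (p * M * e) := by
    have hord : orderOf g = p * M * e := by
      rw [orderOf_eq_card_of_forall_mem_zpowers hg, Nat.card_eq_fintype_card, Fintype.card_units,
        hN]
    rw [← hord]
    refine ⟨?_, fun k hk ↦ orderOf_dvd_of_pow_eq_one (Units.ext (ι.injective ?_))⟩
    · rw [← SubmonoidClass.coe_pow, ← map_pow, ← Units.val_pow_eq_pow_val, pow_orderOf_eq_one,
        Units.val_one, map_one]
      rfl
    · have h1 : ω g ^ k = 1 := Subtype.ext (by simpa using hk)
      rw [Units.val_pow_eq_pow_val, map_pow, ← hω, ← map_pow, h1, map_one, Units.val_one, map_one]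
  have he : e ≠ 0 := by
    rintro rfl
    omega
  have hprimN : IsPrimitiveRoot ((ω g : ℂ) ^ e) (p * M) :=
    hprimω.pow (by positivity) (mul_comm _ _)
  have : NeZero (p * M) := ⟨hpM⟩
  -- `χ` is the power `ω ^ (-b e)` of the Teichmüller character, with `b` prime to `p M`
  obtain ⟨b, -, hb⟩ := hprimN.eq_pow_of_pow_eq_one (ξ := (χ g)⁻¹)
    (by rw [inv_pow, hχ.pow_eq_one, inv_one])
  have hbcop : b.Coprime (p * M) := by
    refine (hprimN.pow_iff_coprime (Nat.pos_of_ne_zero hpM) b).mp ?_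
    rw [hb]
    exact hχ.inv
  have hχg : χ g ≠ 0 := hχ.ne_zero hpM
  have hb1 : χ g * (ω g : ℂ) ^ (b * e) = 1 := by
    rw [mul_comm b, pow_mul, hb, mul_inv_cancel₀ hχg]
  have hb₀ : χ₀ g₀ * (ω₀ g₀ : ℂ) ^ (b * e₀) = 1 := by
    have h1 : t * e₀ = p * e := by
      have hM0 : M ≠ 0 := right_ne_zero_of_mul hpM
      rw [hN, hM] at ht
      exact Nat.eq_of_mul_eq_mul_left (Nat.pos_of_ne_zero hM0) (by linarith)
    rw [hω₀u, hgg, map_pow, SubmonoidClass.coe_pow, ← pow_mul, hχ₀,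
      show t * (b * e₀) = (b * e) * p by rw [mul_left_comm, h1]; ring, pow_mul, ← mul_pow, hb1,
      one_pow]
  have hv := valuation_gaussSum_pow A hω hz hψ (by omega) hf hN hg hb1
  have hv₀ := valuation_gaussSum_pow A hω₀ hz hψ₀ hq₀ hf₀ hM hg₀ hb₀ κ₀
  have hvl : A.valuation (l : ℂ) = A.valuation (z - 1) ^ (l - 1) := by
    let zA : A := ⟨z, mem_of_pow_eq_one A hl.pos hz.pow_eq_one⟩
    have hzA : IsPrimitiveRoot zA l :=
      IsPrimitiveRoot.of_map_of_injective (f := algebraMap A ℂ) hz (IsFractionRing.injective A ℂ)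
    obtain ⟨u, hu⟩ := associated_prime_sub_one_pow hl hzA
    have h3 := congrArg (fun x : A ↦ A.valuation (x : ℂ)) hu
    simp only [MulMemClass.coe_mul, SubmonoidClass.coe_pow, map_mul, map_pow] at h3
    rw [ValuationSubring.valuation_unit, mul_one] at h3
    exact h3
  -- compare the `(p M)`-th powers, which are known powers of the valuation of `z - 1`
  refine (pow_left_inj₀ zero_le zero_le hpM).mp ?_
  rw [← Finset.prod_pow, Finset.prod_congr rfl fun r _ ↦ hv (κ r), Finset.prod_pow_eq_pow_sum,
    ← Finset.mul_sum, Finset.sum_comm]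
  have hinner : ∀ i, ∑ r, l ^ i * (b * κ r) % (p * M) =
      p * (l ^ i * (b * κ₀) % M) + M * (p * h) := by
    intro i
    have := hκ (l ^ i * b) (Nat.Coprime.mul_left (hcop.pow_left i) hbcop)
    simpa only [mul_assoc] using this
  have hlM : l ^ f % M = 1 % M := by
    rw [← hf₀, show Fintype.card F₀ = M * e₀ + 1 by omega, Nat.mul_add_mod]
  rw [Finset.sum_congr rfl fun i _ ↦ hinner i, Finset.sum_add_distrib, ← Finset.mul_sum,
    sum_range_mul_pow_mul_mod hlM, Finset.sum_const, Finset.card_range, smul_eq_mul, mul_pow,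
    ← pow_mul, show s * (p * M) = M * (s * p) by ring,
    pow_mul (A.valuation (gaussSum (χ₀ ^ κ₀) ψ₀)), hv₀, hf, Nat.cast_pow, map_pow, hvl,
    ← pow_mul, ← pow_mul, ← pow_mul, ← pow_mul, ← pow_add]
  congr 1
  ring

end Valuations

/-! ### Formal properties of the Gauss sums of finite fields -/

section FieldGaussSum

variable (F : Type*) [Field F] [Finite F] {E : Type*} [Field E]

theorem traceChar_apply {z : E} (hz : z ^ ringChar F = 1) {l : ℕ} (hl : ringChar F = l)
    [Algebra (ZMod l) F] (x : F) :
    traceChar F z hz x = z ^ (Algebra.trace (ZMod l) F x).val := by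
  subst hl
  rw [traceChar]
  rw [show (ZMod.algebra F (ringChar F) : Algebra (ZMod (ringChar F)) F) = ‹_› from
    Subsingleton.elim _ _]
  rfl

omit [Finite F] in
theorem ofUnitHom_pow (χ : Fˣ →* Eˣ) (c : ℕ) :
    MulChar.ofUnitHom (χ ^ c) = MulChar.ofUnitHom χ ^ c := by
  ext u
  rw [MulChar.pow_apply_coe, MulChar.ofUnitHom_coe, MulChar.ofUnitHom_coe, MonoidHom.pow_apply,
    Units.val_pow_eq_pow_val]

omit [Finite F] in
theorem ofUnitHom_inv (χ : Fˣ →* Eˣ) :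
    MulChar.ofUnitHom χ⁻¹ = (MulChar.ofUnitHom χ)⁻¹ := by
  ext u
  rw [MulChar.inv_apply_eq_inv, MulChar.ofUnitHom_coe, MulChar.ofUnitHom_coe, Ring.inverse_unit,
    MonoidHom.inv_apply]

theorem fieldGaussSum_eq [Fintype F] (χ : Fˣ →* Eˣ) {z : E} (hz : z ^ ringChar F = 1) :
    fieldGaussSum F χ z hz = -gaussSum (MulChar.ofUnitHom χ) (traceChar F z hz) := by
  rw [fieldGaussSum]
  congr!

theorem map_fieldGaussSum {E' : Type*} [Field E'] (φ : E →+* E') (χ : Fˣ →* Eˣ) {z : E}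
    (hz : z ^ ringChar F = 1) (hz' : φ z ^ ringChar F = 1) :
    φ (fieldGaussSum F χ z hz) =
      fieldGaussSum F ((Units.map φ.toMonoidHom).comp χ) (φ z) hz' := by
  classical
  let _ : Fintype F := Fintype.ofFinite F
  let _ : Algebra (ZMod (ringChar F)) F := ZMod.algebra F (ringChar F)
  rw [fieldGaussSum_eq, fieldGaussSum_eq, map_neg, gaussSum, gaussSum, map_sum]
  congr 1
  refine Finset.sum_congr rfl fun x _ ↦ ?_
  rw [map_mul, traceChar_apply F _ rfl, traceChar_apply F _ rfl, map_pow]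
  congr 1
  by_cases hx : x = 0
  · rw [hx, MulChar.map_zero, MulChar.map_zero, map_zero]
  · rw [← Units.val_mk0 hx, MulChar.ofUnitHom_coe, MulChar.ofUnitHom_coe]
    rfl

theorem fieldGaussSum_pow (χ : Fˣ →* Eˣ) {z : E} (hz : z ^ ringChar F = 1) {a : ℕ} {u : Fˣ}
    (hu : (u : F) = a) (hz' : (z ^ a) ^ ringChar F = 1) :
    fieldGaussSum F χ (z ^ a) hz' = ((χ u)⁻¹ : Eˣ) * fieldGaussSum F χ z hz := by
  let _ : Fintype F := Fintype.ofFinite F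
  let _ : Algebra (ZMod (ringChar F)) F := ZMod.algebra F (ringChar F)
  have h1 : traceChar F (z ^ a) hz' = (traceChar F z hz).mulShift u := by
    ext x
    rw [hu, AddChar.mulShift_spec', traceChar_apply F _ rfl, traceChar_apply F _ rfl, ← pow_mul, ← pow_mul,
      mul_comm]
  rw [fieldGaussSum_eq, fieldGaussSum_eq, h1, gaussSum_mulShift_eq, mul_neg,
    MulChar.inv_apply_eq_inv, MulChar.ofUnitHom_coe, Ring.inverse_unit]

theorem fieldGaussSum_congr_root (χ : Fˣ →* Eˣ) {z z' : E} (h : z = z')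
    (hz : z ^ ringChar F = 1) (hz' : z' ^ ringChar F = 1) :
    fieldGaussSum F χ z hz = fieldGaussSum F χ z' hz' := by
  subst h
  rfl

theorem fieldGaussSum_ringEquiv {F' : Type*} [Field F'] [Finite F'] (e : F ≃+* F')
    (χ : F'ˣ →* Eˣ) {z : E} (hz : z ^ ringChar F = 1) (hz' : z ^ ringChar F' = 1) :
    fieldGaussSum F' χ z hz' =
      fieldGaussSum F (χ.comp (Units.map (e : F →+* F').toMonoidHom)) z hz := by
  let _ : Fintype F := Fintype.ofFinite F
  let _ : Fintype F' := Fintype.ofFinite F'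
  have : CharP F' (ringChar F) := charP_of_injective_ringHom (f := (e : F →+* F')) e.injective _
  let _ : Algebra (ZMod (ringChar F)) F := ZMod.algebra F (ringChar F)
  let _ : Algebra (ZMod (ringChar F)) F' := ZMod.algebra F' (ringChar F)
  rw [fieldGaussSum_eq, fieldGaussSum_eq]
  congr 1
  refine (Fintype.sum_bijective e e.bijective _ _ fun x ↦ ?_).symm
  rw [traceChar_apply F _ rfl, traceChar_apply F' _ (ringChar.eq F' (ringChar F))]
  congr 1
  · by_cases hx : x = 0
    · rw [hx, MulChar.map_zero, map_zero e, MulChar.map_zero]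
    · rw [← Units.val_mk0 hx]
      rw [show e (Units.mk0 x hx) = (Units.map (e : F →+* F').toMonoidHom (Units.mk0 x hx) : F'ˣ)
        from rfl, MulChar.ofUnitHom_coe, MulChar.ofUnitHom_coe]
      rfl
  · rw [Algebra.trace_eq_of_equiv_equiv (RingEquiv.refl (ZMod (ringChar F))) e
      (Subsingleton.elim _ _)]
    rfl

theorem fieldGaussSum_mul_inv [CharZero E] (χ : Fˣ →* Eˣ) (hχ : χ ≠ 1) (hχ1 : χ (-1) = 1) {z : E}
    (hz : IsPrimitiveRoot z (ringChar F)) :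
    fieldGaussSum F χ z hz.pow_eq_one * fieldGaussSum F χ⁻¹ z hz.pow_eq_one = Nat.card F := by
  let _ : Fintype F := Fintype.ofFinite F
  have : Fact (ringChar F).Prime := ⟨CharP.char_is_prime F _⟩
  let _ : Algebra (ZMod (ringChar F)) F := ZMod.algebra F (ringChar F)
  have hne : MulChar.ofUnitHom χ ≠ 1 := by
    intro h
    refine hχ (MonoidHom.ext fun x ↦ Units.ext ?_)
    rw [← MulChar.ofUnitHom_coe, h, MulChar.one_apply_coe, MonoidHom.one_apply, Units.val_one]
  rw [fieldGaussSum_eq, fieldGaussSum_eq, neg_mul_neg, ofUnitHom_inv,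
    gaussSum_mul_gaussSum_inv hne (isPrimitive_of_trace hz fun x ↦ traceChar_apply F _ rfl x),
    show (-1 : F) = ((-1 : Fˣ) : F) by simp, MulChar.ofUnitHom_coe, hχ1, Units.val_one, one_mul,
    Nat.card_eq_fintype_card]

end FieldGaussSum

section Complex

variable (A : ValuationSubring ℂ) (F₀ F : Type*) [Field F₀] [Finite F₀] [Field F] [Finite F]
  [Algebra F₀ F]

/-- The product formula for Gauss sums of finite fields, up to units of a valuation ring. The
condition on `χ` and `χ₀` says that `χ ^ p = χ₀ ∘ N`, where `N` is the norm. -/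
theorem prod_valuation_fieldGaussSum {s : ℕ} (hs : Nat.card F = Nat.card F₀ ^ s) {z : ℂ}
    (hz : IsPrimitiveRoot z (ringChar F)) (hz₀ : IsPrimitiveRoot z (ringChar F₀))
    {p M : ℕ} (hq₀ : 2 < Nat.card F₀) (hM : M ∣ Nat.card F₀ - 1) (hN : p * M ∣ Nat.card F - 1)
    (χ : Fˣ →* ℂˣ) (χ₀ : F₀ˣ →* ℂˣ)
    (hχ : ∀ g : Fˣ, (∀ x, x ∈ Subgroup.zpowers g) → IsPrimitiveRoot (χ g : ℂ) (p * M))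
    (hχ₀ : ∀ (x : Fˣ) (y : F₀ˣ),
      algebraMap F₀ F y = (x : F) ^ ((Nat.card F - 1) / (Nat.card F₀ - 1)) → χ₀ y = χ x ^ p)
    {R : Type*} [Fintype R] (κ : R → ℕ) (κ₀ h : ℕ)
    (hκ : ∀ u : ℕ, u.Coprime (p * M) →
      ∑ r, u * κ r % (p * M) = p * (u * κ₀ % M) + M * (p * h)) :
    ∏ r, A.valuation (fieldGaussSum F (χ ^ κ r) z hz.pow_eq_one) =
      A.valuation (fieldGaussSum F₀ (χ₀ ^ κ₀) z hz₀.pow_eq_one) ^ s *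
        A.valuation (Nat.card F : ℂ) ^ h := by
  classical
  let _ : Fintype F := Fintype.ofFinite F
  let _ : Fintype F₀ := Fintype.ofFinite F₀
  rw [Nat.card_eq_fintype_card, Nat.card_eq_fintype_card] at hs hχ₀
  rw [Nat.card_eq_fintype_card] at hq₀ hM hN ⊢
  obtain ⟨f, hprime, hf⟩ := FiniteField.card F₀ (ringChar F₀)
  have hl : ringChar F = ringChar F₀ := (Algebra.ringChar_eq F₀ F).symm
  have : Fact (ringChar F₀).Prime := ⟨hprime⟩
  have : CharP F (ringChar F₀) := hl ▸ ringChar.charP F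
  let _ : Algebra (ZMod (ringChar F₀)) F := ZMod.algebra F (ringChar F₀)
  let _ : Algebra (ZMod (ringChar F₀)) F₀ := ZMod.algebra F₀ (ringChar F₀)
  have hfF : Fintype.card F = ringChar F₀ ^ ((f : ℕ) * s) := by rw [hs, hf, pow_mul]
  obtain ⟨e₀, he₀⟩ := hM
  obtain ⟨e, he⟩ := hN
  obtain ⟨t, ht⟩ : Fintype.card F₀ - 1 ∣ Fintype.card F - 1 := by
    rw [hs]
    simpa using Nat.sub_dvd_pow_sub_pow (Fintype.card F₀) 1 s
  have htdiv : (Fintype.card F - 1) / (Fintype.card F₀ - 1) = t := by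
    rw [ht, Nat.mul_div_cancel_left _ (by omega)]
  have hcop : (ringChar F₀).Coprime (p * M) := by
    refine (Nat.Prime.coprime_iff_not_dvd hprime).mpr fun hd ↦ ?_
    have h1 : ringChar F₀ ∣ Fintype.card F - 1 := hd.trans ⟨e, he⟩
    have h2 : ringChar F₀ ∣ Fintype.card F := by
      have h0 : (f : ℕ) * s ≠ 0 := by
        intro h0
        rw [h0, pow_zero] at hfF
        exact (Fintype.one_lt_card (α := F)).ne' hfF
      rw [hfF]
      exact dvd_pow_self _ h0
    have h3 := Nat.dvd_sub h2 h1
    rw [Nat.sub_sub_self Fintype.card_pos] at h3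
    exact hprime.one_lt.ne' (Nat.dvd_one.mp h3)
  obtain ⟨g, hg⟩ := IsCyclic.exists_generator (α := Fˣ)
  have hfin : Module.finrank F₀ F = s := by
    have h1 := Module.card_eq_pow_finrank (K := F₀) (V := F)
    rw [hs] at h1
    exact (Nat.pow_right_injective (Fintype.one_lt_card (α := F₀)) h1).symm
  -- the norm of `g` generates `F₀ˣ`
  let g₀ : F₀ˣ := Units.map (Algebra.norm F₀) g
  have hg₀ : ∀ x, x ∈ Subgroup.zpowers g₀ := by
    intro x
    obtain ⟨y, rfl⟩ := FiniteField.unitsMap_norm_surjective F₀ F x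
    obtain ⟨k, rfl⟩ := hg y
    exact ⟨k, by simp [g₀]⟩
  have hgg : algebraMap F₀ F g₀ = (g : F) ^ t := by
    change algebraMap F₀ F (Algebra.norm F₀ (g : F)) = _
    rw [FiniteField.algebraMap_norm_eq_pow_sum, hfin, Nat.card_eq_fintype_card,
      Nat.geomSum_eq Fintype.one_lt_card, ← hs, htdiv]
  have key := prod_valuation_gaussSum A (l := ringChar F₀) hz₀ (F := F) (F₀ := F₀)
    (ψ := traceChar F z hz.pow_eq_one) (ψ₀ := traceChar F₀ z hz₀.pow_eq_one)
    (fun x ↦ traceChar_apply F _ hl x) (fun x ↦ traceChar_apply F₀ _ rfl x) hq₀ hf hfF he₀ he hcop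
    (χ := MulChar.ofUnitHom χ) (χ₀ := MulChar.ofUnitHom χ₀) hg hg₀ ht hgg
    (by rw [MulChar.ofUnitHom_coe]; exact hχ g hg)
    (by rw [MulChar.ofUnitHom_coe, MulChar.ofUnitHom_coe, hχ₀ g g₀ (by rw [htdiv, hgg]),
      Units.val_pow_eq_pow_val]) κ κ₀ h hκ
  simp_rw [fieldGaussSum_eq, ofUnitHom_pow, Valuation.map_neg]
  exact key

end Complex

/-! ### Homomorphisms from `Ω(ζ_{p ^ (n + 1)})` to `ℂ` over `k_n` -/

section Descent

variable (p n : ℕ) [Fact p.Prime]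

instance instAlgebraCycComplex : Algebra (Cyc p n) ℂ := (cycVal p n).toAlgebra

omit [Fact p.Prime] in
theorem algebraMap_cyc_complex (x : Cyc p n) : algebraMap (Cyc p n) ℂ x = cycVal p n x := rfl

/-- The embedding of `Ω(ζ_{p ^ (n + 1)})` in `ℂ`, as a homomorphism over `k_n`. -/
def omegaCycAlgHom : OmegaCyc p n →ₐ[Cyc p n] ℂ where
  __ := omegaCycVal p n
  commutes' x := omegaCycVal_algebraMap' p n x

theorem isAlgebraic_cyc_omegaCyc : Algebra.IsAlgebraic (Cyc p n) (OmegaCyc p n) := by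
  have hroot : ∀ {K : Type} [Field K] [Algebra K ℂ] {m : ℕ} {x : ℂ}, m ≠ 0 → x ^ m = 1 →
      IsIntegral K x := fun {K _ _ m x} hm hx ↦
    IsIntegral.of_pow (Nat.pos_of_ne_zero hm) (hx ▸ isIntegral_one)
  have h1 : Algebra.IsAlgebraic ℚ (omegaField p) :=
    IntermediateField.isAlgebraic_adjoin fun x ⟨m, hm, _, hx⟩ ↦ hroot hm hx
  have h2 : Algebra.IsAlgebraic (omegaField p) (omegaCycField p n) :=
    IntermediateField.isAlgebraic_adjoin fun x hx ↦
      hroot (pow_ne_zero (n + 1) (Fact.out : p.Prime).ne_zero) hx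
  have h3 : Algebra.IsAlgebraic ℚ (omegaCycField p n) :=
    Algebra.IsAlgebraic.trans ℚ (omegaField p) (omegaCycField p n)
  refine ⟨fun x ↦ ?_⟩
  have h4 : IsAlgebraic ℚ (omegaCycVal p n x) :=
    (h3.isAlgebraic x).algHom ((omegaCycField p n).val.restrictScalars ℚ)
  have : IsScalarTower ℚ (Cyc p n) ℂ := IsScalarTower.of_algebraMap_eq' (Subsingleton.elim _ _)
  have h5 : IsIntegral (Cyc p n) (omegaCycAlgHom p n x) := h4.isIntegral.tower_top
  exact ((isIntegral_algHom_iff (omegaCycAlgHom p n) (omegaCycVal p n).injective).mp h5).isAlgebraic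

theorem mem_range_of_forall_algHom (x : OmegaCyc p n)
    (h : ∀ φ : OmegaCyc p n →ₐ[Cyc p n] ℂ, φ x = omegaCycVal p n x) :
    ∃ y : Cyc p n, algebraMap (Cyc p n) (OmegaCyc p n) y = x := by
  have := isAlgebraic_cyc_omegaCyc p n
  have h1 := Algebra.IsAlgebraic.range_eval_eq_rootSet_minpoly (F := Cyc p n) ℂ x
  have h2 : (minpoly (Cyc p n) x).rootSet ℂ = {omegaCycVal p n x} := by
    rw [← h1]
    ext y
    constructor
    · rintro ⟨φ, rfl⟩
      exact h φ
    · rintro rfl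
      exact ⟨omegaCycAlgHom p n, rfl⟩
  have hint : IsIntegral (Cyc p n) x := (this.isAlgebraic x).isIntegral
  have h3 := Polynomial.card_rootSet_eq_natDegree (K := ℂ) (minpoly.irreducible hint).separable
    (IsAlgClosed.splits _)
  rw [← Nat.card_eq_fintype_card, h2, Nat.card_unique] at h3
  exact minpoly.natDegree_eq_one_iff.mp h3.symm

theorem minpoly_eq_cyclotomic {l : ℕ} (hl : l.Prime) (hlp : l ≠ p) {z : OmegaCyc p n}
    (hz : IsPrimitiveRoot z l) :
    minpoly (Cyc p n) z = Polynomial.cyclotomic l (Cyc p n) := by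
  have hp : p.Prime := Fact.out
  have hint : IsIntegral (Cyc p n) z := ⟨Polynomial.X ^ l - 1,
    Polynomial.monic_X_pow_sub_C 1 hl.ne_zero, by simp [hz.pow_eq_one]⟩
  have hdvd : minpoly (Cyc p n) z ∣ Polynomial.cyclotomic l (Cyc p n) := by
    refine minpoly.dvd _ _ ?_
    rw [Polynomial.aeval_def, Polynomial.eval₂_eq_eval_map, Polynomial.map_cyclotomic]
    exact hz.isRoot_cyclotomic hl.pos
  have : NeZero (p ^ (n + 1)) := ⟨pow_ne_zero _ hp.ne_zero⟩
  let L := IntermediateField.adjoin (Cyc p n) {z}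
  have hfin : FiniteDimensional (Cyc p n) L := IntermediateField.adjoin.finiteDimensional hint
  have htower : IsScalarTower ℚ (Cyc p n) L :=
    IsScalarTower.of_algebraMap_eq' (Subsingleton.elim _ _)
  have hfin' : FiniteDimensional ℚ L := FiniteDimensional.trans ℚ (Cyc p n) L
  have hx := (IsCyclotomicExtension.zeta_spec (p ^ (n + 1)) ℚ (Cyc p n)).map_of_injective
    (algebraMap (Cyc p n) L).injective
  have hy : IsPrimitiveRoot (IntermediateField.AdjoinSimple.gen (Cyc p n) z) l :=
    IsPrimitiveRoot.of_map_of_injective (f := algebraMap L (OmegaCyc p n))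
      (by rwa [IntermediateField.AdjoinSimple.algebraMap_gen]) (algebraMap L _).injective
  have hcop : (p ^ (n + 1)).Coprime l :=
    Nat.Coprime.pow_left _ ((Nat.coprime_primes hp hl).mpr hlp.symm)
  have h1 := IsPrimitiveRoot.lcm_totient_le_finrank hx hy
    (Polynomial.cyclotomic.irreducible_rat (Nat.lcm_pos (NeZero.pos _) hl.pos))
  rw [hcop.lcm_eq_mul, Nat.totient_mul hcop, ← Module.finrank_mul_finrank ℚ (Cyc p n) L,
    IsCyclotomicExtension.finrank (n := p ^ (n + 1)) (Cyc p n)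
      (Polynomial.cyclotomic.irreducible_rat (NeZero.pos _)),
    IntermediateField.adjoin.finrank hint] at h1
  have h2 := le_of_mul_le_mul_left h1 (Nat.totient_pos.mpr (NeZero.pos _))
  refine (Polynomial.eq_of_monic_of_dvd_of_natDegree_le (minpoly.monic hint)
    (Polynomial.cyclotomic.monic _ _) hdvd ?_).symm
  rwa [Polynomial.natDegree_cyclotomic]

/-- The fields `k_n` and `ℚ(ζ_l)` are linearly disjoint, so `ζ_l` can be moved to any of its
conjugates by a homomorphism which is the identity on `k_n`. -/
theorem exists_algHom_pow {l : ℕ} (hl : l.Prime) (hlp : l ≠ p) {z : OmegaCyc p n}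
    (hz : IsPrimitiveRoot z l) {a : ℕ} (ha : a.Coprime l) :
    ∃ φ : OmegaCyc p n →ₐ[Cyc p n] ℂ, φ z = omegaCycVal p n z ^ a := by
  have := isAlgebraic_cyc_omegaCyc p n
  have h1 := Algebra.IsAlgebraic.range_eval_eq_rootSet_minpoly (F := Cyc p n) ℂ z
  have h2 : omegaCycVal p n z ^ a ∈ (minpoly (Cyc p n) z).rootSet ℂ := by
    rw [minpoly_eq_cyclotomic p n hl hlp hz, Polynomial.mem_rootSet]
    refine ⟨Polynomial.cyclotomic_ne_zero _ _, ?_⟩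
    rw [Polynomial.aeval_def, Polynomial.eval₂_eq_eval_map, Polynomial.map_cyclotomic]
    exact ((hz.map_of_injective (omegaCycVal p n).injective).pow_of_coprime a ha).isRoot_cyclotomic
      hl.pos
  rw [← h1] at h2
  exact h2

end Descent

/-! ### The complex Gauss sums of the primes of `k_n` -/

/-- The residue field of a prime ideal is a field. -/
abbrev residueFieldInst {K : Type*} [Field K] [NumberField K] (v : HeightOneSpectrum (𝓞 K)) :
    Field (𝓞 K ⧸ v.asIdeal) :=
  haveI := v.isMaximal
  Ideal.Quotient.field v.asIdeal

attribute [local instance] residueFieldInst finite_quotient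

section ComplexGaussSum

variable (p n : ℕ) [hp : Fact p.Prime]

/-- The isomorphism `G_n ≃ (ℤ / p ^ (n + 1))ˣ`. -/
abbrev cycChar : Gal(Cyc p n/ℚ) ≃* (ZMod (p ^ (n + 1)))ˣ :=
  IsCyclotomicExtension.Rat.galEquivZMod (p ^ (n + 1)) (Cyc p n)

theorem galLift_algebraMap (σ : Gal(Cyc p n/ℚ)) (x : Cyc p n) :
    galLift p n σ (algebraMap (Cyc p n) (OmegaCyc p n) x) =
      algebraMap (Cyc p n) (OmegaCyc p n) (σ x) := by
  rw [← galRestrict_apply]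
  congr 2
  exact (MulEquiv.ofBijective (galRestrict p n) (galRestrict_bijective p n)).apply_symm_apply σ

variable (ζ : RootChoice) (v : HeightOneSpectrum (𝓞 (Cyc p n)))
  (hv : (p : 𝓞 (Cyc p n)) ∉ v.asIdeal)

theorem galLift_rootAt (σ : Gal(Cyc p n/ℚ)) :
    galLift p n σ (rootAt p n ζ v hv) = rootAt p n ζ v hv :=
  (galLift p n σ).commutes ⟨ζ (residuePrime v), IntermediateField.subset_adjoin _ _
    ⟨residuePrime v, (residuePrime v).2.ne_zero,
      (Nat.coprime_primes (residuePrime v).2 hp.out).mpr (residuePrime_ne v hv),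
      (ζ (residuePrime v)).2.pow_eq_one⟩⟩

/-- The character `χ` of the residue field of `v`, with complex values. -/
def complexChar : (𝓞 (Cyc p n) ⧸ v.asIdeal)ˣ →* ℂˣ :=
  (Units.map (omegaCycVal p n).toMonoidHom).comp (gaussChar p n v hv)

omit hp in
theorem integerUnits_val (u : (𝓞 (Cyc p n))ˣ) :
    (integerUnits p n u : OmegaCyc p n) =
      algebraMap (Cyc p n) (OmegaCyc p n) (algebraMap (𝓞 (Cyc p n)) (Cyc p n) u) :=
  rfl

theorem gaussChar_apply (x : (𝓞 (Cyc p n) ⧸ v.asIdeal)ˣ) :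
    gaussChar p n v hv x = integerUnits p n
      (residueChar (p ^ (n + 1)) v (coprime_of_notMem p n v hv) x : (𝓞 (Cyc p n))ˣ) := by
  rw [gaussChar, MonoidHom.comp_apply, MonoidHom.comp_apply]
  rfl

theorem complexChar_val (x : (𝓞 (Cyc p n) ⧸ v.asIdeal)ˣ) :
    (complexChar p n v hv x : ℂ) = cycVal p n
      ((residueChar (p ^ (n + 1)) v (coprime_of_notMem p n v hv) x : (𝓞 (Cyc p n))ˣ) :
        𝓞 (Cyc p n)) := by
  rw [complexChar, MonoidHom.comp_apply, gaussChar_apply, Units.coe_map]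
  change omegaCycVal p n (integerUnits p n _ : OmegaCyc p n) = _
  rw [integerUnits_val, omegaCycVal_algebraMap']

theorem residueChar_pow_eq_one (x : (𝓞 (Cyc p n) ⧸ v.asIdeal)ˣ) :
    (((residueChar (p ^ (n + 1)) v (coprime_of_notMem p n v hv) x : (𝓞 (Cyc p n))ˣ) :
        𝓞 (Cyc p n)) : Cyc p n) ^ p ^ (n + 1) = 1 := by
  have h := (residueChar (p ^ (n + 1)) v (coprime_of_notMem p n v hv) x).2
  rw [mem_rootsOfUnity] at h
  rw [← map_pow, ← Units.val_pow_eq_pow_val, h, Units.val_one, map_one]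

theorem complexChar_pow_eq_one (x : (𝓞 (Cyc p n) ⧸ v.asIdeal)ˣ) :
    complexChar p n v hv x ^ p ^ (n + 1) = 1 := by
  refine Units.ext ?_
  rw [Units.val_pow_eq_pow_val, complexChar_val, ← map_pow, residueChar_pow_eq_one p n v hv,
    map_one, Units.val_one]

theorem isPrimitiveRoot_complexChar {g : (𝓞 (Cyc p n) ⧸ v.asIdeal)ˣ}
    (hg : ∀ x, x ∈ Subgroup.zpowers g) :
    IsPrimitiveRoot (complexChar p n v hv g : ℂ) (p ^ (n + 1)) := by
  have hN := pow_card_div_pow (p ^ (n + 1)) v (coprime_of_notMem p n v hv)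
  refine ⟨by rw [← Units.val_pow_eq_pow_val, complexChar_pow_eq_one, Units.val_one], fun k hk ↦ ?_⟩
  rw [complexChar_val, ← map_pow, ← map_pow, ← map_one (cycVal p n)] at hk
  have h1 : residueChar (p ^ (n + 1)) v (coprime_of_notMem p n v hv) g ^ k = 1 := by
    refine Subtype.ext (Units.ext (RingOfIntegers.coe_injective ?_))
    have := (cycVal p n).injective hk
    simpa using this
  have h2 := congrArg (Ideal.rootsOfUnityMapQuot v.asIdeal (p ^ (n + 1))) h1
  rw [map_pow, residueChar_spec, map_one, ← pow_mul, inv_pow, inv_eq_one] at h2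
  have h3 := orderOf_dvd_of_pow_eq_one h2
  rw [orderOf_eq_card_of_forall_mem_zpowers hg, Nat.card_units] at h3
  have hpos : 0 < Nat.card (𝓞 (Cyc p n) ⧸ v.asIdeal) - 1 := by
    have := Finite.one_lt_card (α := 𝓞 (Cyc p n) ⧸ v.asIdeal)
    omega
  obtain ⟨e, he⟩ := hN.1
  rw [he, Nat.mul_div_cancel_left _ (NeZero.pos _), mul_comm] at h3
  have he0 : 0 < e := by
    refine Nat.pos_of_ne_zero ?_
    rintro rfl
    omega
  exact Nat.dvd_of_mul_dvd_mul_left he0 h3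

theorem complexChar_neg_one (h2 : p ≠ 2) : complexChar p n v hv (-1) = 1 := by
  have h3 := complexChar_pow_eq_one p n v hv (-1)
  have h4 : complexChar p n v hv (-1) ^ 2 = 1 := by rw [← map_pow, neg_one_sq, map_one]
  have hodd : Odd (p ^ (n + 1)) := (hp.out.odd_of_ne_two h2).pow
  obtain ⟨k, hk⟩ := hodd
  rwa [hk, pow_add, pow_mul, h4, one_pow, one_mul, pow_one] at h3

/-- The complex Gauss sum attached to the prime `v` and to the power `χ ^ c` of its character. -/
def complexGaussSum (c : ℕ) : ℂ :=
  fieldGaussSum (𝓞 (Cyc p n) ⧸ v.asIdeal) (complexChar p n v hv ^ c) (ζ (residuePrime v))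
    (ζ (residuePrime v)).2.pow_eq_one

theorem map_primeGaussSum (φ : OmegaCyc p n →+* ℂ) (c a : ℕ)
    (h1 : ∀ y : Cyc p n, y ^ p ^ (n + 1) = 1 →
      φ (algebraMap (Cyc p n) (OmegaCyc p n) y) = cycVal p n y ^ c)
    (h2 : φ (rootAt p n ζ v hv) = (ζ (residuePrime v) : ℂ) ^ a) :
    φ (primeGaussSum p n ζ v hv) =
      fieldGaussSum (𝓞 (Cyc p n) ⧸ v.asIdeal) (complexChar p n v hv ^ c)
        ((ζ (residuePrime v) : ℂ) ^ a)
        (by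
          rw [pow_right_comm]
          exact (congrArg (· ^ a) (ζ (residuePrime v)).2.pow_eq_one).trans (one_pow a)) := by
  rw [primeGaussSum, map_fieldGaussSum _ φ _ _ (by
    rw [← map_pow, (rootAt_isPrimitiveRoot p n ζ v hv).pow_eq_one, map_one])]
  have hχ : (Units.map φ.toMonoidHom).comp (gaussChar p n v hv) = complexChar p n v hv ^ c := by
    refine MonoidHom.ext fun x ↦ Units.ext ?_
    rw [MonoidHom.pow_apply, Units.val_pow_eq_pow_val, complexChar_val]
    exact h1 _ (residueChar_pow_eq_one p n v hv x)
  rw [hχ]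
  exact fieldGaussSum_congr_root _ _ h2 _ _

theorem omegaCycVal_galLift_primeGaussSum (σ : Gal(Cyc p n/ℚ)) :
    omegaCycVal p n (galLift p n σ (primeGaussSum p n ζ v hv)) =
      complexGaussSum p n ζ v hv (cycChar p n σ : ZMod (p ^ (n + 1))).val := by
  have h := map_primeGaussSum p n ζ v hv
    ((omegaCycVal p n).comp (galLift p n σ).toRingEquiv.toRingHom)
    (cycChar p n σ : ZMod (p ^ (n + 1))).val 1 (fun y hy ↦ ?_) ?_
  · refine h.trans ?_
    exact fieldGaussSum_congr_root _ _ (pow_one _) _ _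
  · change omegaCycVal p n (galLift p n σ _) = _
    rw [galLift_algebraMap, omegaCycVal_algebraMap',
      IsCyclotomicExtension.Rat.galEquivZMod_apply_of_pow_eq (p ^ (n + 1)) (Cyc p n) σ hy, map_pow]
  · change omegaCycVal p n (galLift p n σ _) = _
    rw [galLift_rootAt, pow_one]
    rfl

/-- Moving `ζ_l` to `ζ_l ^ a` by a homomorphism over `k_n` multiplies a Gauss sum by the value at
`a` of the inverse of its character. -/
theorem algHom_galLift_primeGaussSum (φ : OmegaCyc p n →ₐ[Cyc p n] ℂ) {a : ℕ}
    (hφ : φ (rootAt p n ζ v hv) = (ζ (residuePrime v) : ℂ) ^ a)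
    {u : (𝓞 (Cyc p n) ⧸ v.asIdeal)ˣ} (hu : (u : 𝓞 (Cyc p n) ⧸ v.asIdeal) = a)
    (σ : Gal(Cyc p n/ℚ)) :
    φ (galLift p n σ (primeGaussSum p n ζ v hv)) =
      ((complexChar p n v hv u ^ (cycChar p n σ : ZMod (p ^ (n + 1))).val)⁻¹ : ℂˣ) *
        omegaCycVal p n (galLift p n σ (primeGaussSum p n ζ v hv)) := by
  have h := map_primeGaussSum p n ζ v hv
    (φ.toRingHom.comp (galLift p n σ).toRingEquiv.toRingHom)
    (cycChar p n σ : ZMod (p ^ (n + 1))).val a (fun y hy ↦ ?_) ?_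
  · refine h.trans ?_
    rw [omegaCycVal_galLift_primeGaussSum, complexGaussSum, fieldGaussSum_pow _ _ _ hu]
    rfl
  · change φ (galLift p n σ _) = _
    rw [galLift_algebraMap, AlgHom.commutes, algebraMap_cyc_complex,
      IsCyclotomicExtension.Rat.galEquivZMod_apply_of_pow_eq (p ^ (n + 1)) (Cyc p n) σ hy, map_pow]
  · change φ (galLift p n σ _) = _
    rw [galLift_rootAt, hφ]

theorem complexGaussSum_mul (h2 : p ≠ 2) {c d : ℕ} (hc : ¬ p ^ (n + 1) ∣ c)
    (hcd : p ^ (n + 1) ∣ c + d) :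
    complexGaussSum p n ζ v hv c * complexGaussSum p n ζ v hv d =
      Nat.card (𝓞 (Cyc p n) ⧸ v.asIdeal) := by
  have hne : complexChar p n v hv ^ c ≠ 1 := by
    intro h
    obtain ⟨g, hg⟩ := IsCyclic.exists_generator (α := (𝓞 (Cyc p n) ⧸ v.asIdeal)ˣ)
    refine hc ((isPrimitiveRoot_complexChar p n v hv hg).dvd_of_pow_eq_one c ?_)
    rw [← Units.val_pow_eq_pow_val, ← MonoidHom.pow_apply, h, MonoidHom.one_apply, Units.val_one]
  have hinv : complexChar p n v hv ^ d = (complexChar p n v hv ^ c)⁻¹ := by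
    obtain ⟨k, hk⟩ := hcd
    refine MonoidHom.ext fun x ↦ ?_
    rw [MonoidHom.inv_apply, MonoidHom.pow_apply, MonoidHom.pow_apply, eq_inv_iff_mul_eq_one,
      ← pow_add, add_comm, hk, pow_mul, complexChar_pow_eq_one, one_pow]
  rw [complexGaussSum, complexGaussSum, hinv]
  refine fieldGaussSum_mul_inv _ _ hne ?_ (ζ (residuePrime v)).2
  rw [MonoidHom.pow_apply, complexChar_neg_one p n v hv h2, one_pow]

end ComplexGaussSum

/-! ### Elements of the group ring acting on Gauss sums -/

section GroupRing

variable (p n : ℕ) [hp : Fact p.Prime]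

theorem groupRingPow_eq_prod (δ : MonoidAlgebra ℤ Gal(Cyc p n/ℚ)) (u : (OmegaCyc p n)ˣ) :
    groupRingPow p n δ u =
      ∏ σ, (Units.mapEquiv (galLift p n σ).toMulEquiv u) ^ δ.coeff σ :=
  Finsupp.prod_fintype _ _ fun _ ↦ zpow_zero _

theorem groupRingPow_val (δ : MonoidAlgebra ℤ Gal(Cyc p n/ℚ)) (u : (OmegaCyc p n)ˣ) :
    (groupRingPow p n δ u : OmegaCyc p n) = ∏ σ, galLift p n σ u ^ δ.coeff σ := by
  rw [groupRingPow_eq_prod, Units.coe_prod]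
  exact Finset.prod_congr rfl fun σ _ ↦ Units.val_zpow_eq_zpow_val _ _

/-- Exponentiation by an element of the group ring, as a homomorphism. -/
def groupRingPowHom (δ : MonoidAlgebra ℤ Gal(Cyc p n/ℚ)) : (OmegaCyc p n)ˣ →* (OmegaCyc p n)ˣ where
  toFun := groupRingPow p n δ
  map_one' := by
    rw [groupRingPow_eq_prod]
    exact Finset.prod_eq_one fun σ _ ↦ by rw [map_one, one_zpow]
  map_mul' u v := by
    rw [groupRingPow_eq_prod, groupRingPow_eq_prod, groupRingPow_eq_prod, ← Finset.prod_mul_distrib]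
    exact Finset.prod_congr rfl fun σ _ ↦ by rw [map_mul, mul_zpow]

/-- The sum `∑ δ_σ` of the coefficients of an element of `ℤ[G_n]`. -/
def degree (δ : MonoidAlgebra ℤ Gal(Cyc p n/ℚ)) : ℤ :=
  ∑ σ, δ.coeff σ

/-- The image `∑ δ_σ κ(σ)` of an element of `ℤ[G_n]` under the ring homomorphism to
`ℤ / p ^ (n + 1)` induced by the cyclotomic character `κ`. -/
def weight (δ : MonoidAlgebra ℤ Gal(Cyc p n/ℚ)) : ZMod (p ^ (n + 1)) :=
  ∑ σ, (δ.coeff σ : ZMod (p ^ (n + 1))) * (cycChar p n σ : ZMod (p ^ (n + 1)))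

/-- The value at `x` of the product of the powers `χ ^ (κ(σ) δ_σ)` of a character `χ` of order
dividing `p ^ (n + 1)` only depends on the weight of `δ`. -/
theorem prod_pow_cycChar_zpow (δ : MonoidAlgebra ℤ Gal(Cyc p n/ℚ)) {x : ℂˣ}
    (hx : x ^ p ^ (n + 1) = 1) :
    ∏ σ, (x ^ (cycChar p n σ : ZMod (p ^ (n + 1))).val) ^ δ.coeff σ =
      x ^ (weight p n δ).val := by
  have h1 : ∀ σ, (x ^ (cycChar p n σ : ZMod (p ^ (n + 1))).val) ^ δ.coeff σ =
      x ^ (δ.coeff σ * ((cycChar p n σ : ZMod (p ^ (n + 1))).val : ℤ)) := by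
    intro σ
    rw [mul_comm, zpow_mul, zpow_natCast]
  have h2 : ∀ (s : Finset Gal(Cyc p n/ℚ)) (m : Gal(Cyc p n/ℚ) → ℤ),
      ∏ σ ∈ s, x ^ m σ = x ^ ∑ σ ∈ s, m σ := fun s m ↦
    (congrArg Additive.toMul (map_sum (zmultiplesHom (Additive ℂˣ) (Additive.ofMul x)) m s)).symm
  rw [Finset.prod_congr rfl fun σ _ ↦ h1 σ, h2, ← zpow_natCast]
  rw [← orderOf_dvd_iff_pow_eq_one] at hx
  rw [zpow_eq_zpow_iff_modEq]
  refine Int.ModEq.of_dvd (Int.natCast_dvd_natCast.mpr hx) ?_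
  rw [← ZMod.intCast_eq_intCast_iff]
  push_cast
  rw [ZMod.natCast_val, ZMod.cast_id', id, weight]
  refine Finset.sum_congr rfl fun σ _ ↦ ?_
  rw [ZMod.natCast_val, ZMod.cast_id', id]

end GroupRing

section Primes

variable (p n : ℕ) [hp : Fact p.Prime] (ζ : RootChoice)

/-- A prime ideal of `k_n` which is prime to `p`, as an element of `I_n`. -/
def primeI (v : HeightOneSpectrum (𝓞 (Cyc p n))) (hv : (p : 𝓞 (Cyc p n)) ∉ v.asIdeal) : I p n :=
  ⟨primeUnit v, fun w hw ↦ FractionalIdeal.count_maximal_coprime _ w fun h ↦ hv (h ▸ hw)⟩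

/-- The group `I_n` is generated by the primes. -/
theorem mem_of_forall_primeI (H : Subgroup (I p n)) (h : ∀ v hv, primeI p n v hv ∈ H) (a : I p n) :
    a ∈ H := by
  suffices h1 : (a : FracIdeals (Cyc p n)) ∈ H.map (I p n).subtype by
    obtain ⟨b, hb, hab⟩ := h1
    rwa [← Subtype.ext hab]
  rw [eq_finprod_primeUnit (a : FracIdeals (Cyc p n))]
  refine finprod_induction (· ∈ H.map (I p n).subtype) (one_mem _) (fun _ _ ↦ mul_mem) fun v ↦ ?_
  by_cases hv : (p : 𝓞 (Cyc p n)) ∈ v.asIdeal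
  · rw [a.2 v hv, zpow_zero]
    exact one_mem _
  · exact Subgroup.zpow_mem (H.map (I p n).subtype) ⟨primeI p n v hv, h v hv, rfl⟩ _

theorem hom_ext_primeI {A : Type*} [Group A] {f g : I p n →* A}
    (h : ∀ v hv, f (primeI p n v hv) = g (primeI p n v hv)) : f = g :=
  MonoidHom.ext fun a ↦ mem_of_forall_primeI p n (f.eqLocus g) h a

theorem tau_primeI (v : HeightOneSpectrum (𝓞 (Cyc p n))) (hv : (p : 𝓞 (Cyc p n)) ∉ v.asIdeal) :
    (tau p n ζ (primeI p n v hv) : OmegaCyc p n) = primeGaussSum p n ζ v hv := by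
  have h : tau p n ζ (primeI p n v hv) =
      Units.mk0 (primeGaussSum p n ζ v hv) (primeGaussSum_ne_zero p n ζ v hv) :=
    (primeExt_primeUnit _ v).trans (dif_neg hv)
  rw [h, Units.val_mk0]

theorem groupRingPow_tau_primeI (δ : MonoidAlgebra ℤ Gal(Cyc p n/ℚ))
    (v : HeightOneSpectrum (𝓞 (Cyc p n))) (hv : (p : 𝓞 (Cyc p n)) ∉ v.asIdeal) :
    omegaCycVal p n (groupRingPow p n δ (tau p n ζ (primeI p n v hv))) =
      ∏ σ, complexGaussSum p n ζ v hv (cycChar p n σ : ZMod (p ^ (n + 1))).val ^ δ.coeff σ := by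
  rw [groupRingPow_val, map_prod]
  refine Finset.prod_congr rfl fun σ _ ↦ ?_
  rw [map_zpow₀, tau_primeI, omegaCycVal_galLift_primeGaussSum]

theorem algHom_groupRingPow_tau_primeI (δ : MonoidAlgebra ℤ Gal(Cyc p n/ℚ))
    (v : HeightOneSpectrum (𝓞 (Cyc p n))) (hv : (p : 𝓞 (Cyc p n)) ∉ v.asIdeal)
    (φ : OmegaCyc p n →ₐ[Cyc p n] ℂ) {a : ℕ}
    (hφ : φ (rootAt p n ζ v hv) = (ζ (residuePrime v) : ℂ) ^ a)
    {u : (𝓞 (Cyc p n) ⧸ v.asIdeal)ˣ} (hu : (u : 𝓞 (Cyc p n) ⧸ v.asIdeal) = a) :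
    φ (groupRingPow p n δ (tau p n ζ (primeI p n v hv))) =
      ((complexChar p n v hv u ^ (weight p n δ).val)⁻¹ : ℂˣ) *
        omegaCycVal p n (groupRingPow p n δ (tau p n ζ (primeI p n v hv))) := by
  rw [groupRingPow_val, map_prod, map_prod,
    ← prod_pow_cycChar_zpow p n δ (complexChar_pow_eq_one p n v hv u), ← Finset.prod_inv_distrib,
    Units.coe_prod, ← Finset.prod_mul_distrib]
  refine Finset.prod_congr rfl fun σ _ ↦ ?_
  rw [map_zpow₀, map_zpow₀, tau_primeI, algHom_galLift_primeGaussSum p n ζ v hv φ hφ hu,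
    mul_zpow, ← inv_zpow, Units.val_zpow_eq_zpow_val]

/-- For `δ` of weight `0`, the values of `δ τ_n` lie in `k_n`. -/
theorem exists_map_eq_groupRingPow (δ : MonoidAlgebra ℤ Gal(Cyc p n/ℚ)) (hδ : weight p n δ = 0)
    (a : I p n) : ∃ y : (Cyc p n)ˣ,
      Units.map (algebraMap (Cyc p n) (OmegaCyc p n)).toMonoidHom y =
        groupRingPow p n δ (tau p n ζ a) := by
  refine mem_of_forall_primeI p n
    (((Units.map (algebraMap (Cyc p n) (OmegaCyc p n)).toMonoidHom).range).comap
      ((groupRingPowHom p n δ).comp (tau p n ζ))) (fun v hv ↦ ?_) a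
  have key : ∀ φ : OmegaCyc p n →ₐ[Cyc p n] ℂ,
      φ (groupRingPow p n δ (tau p n ζ (primeI p n v hv))) =
        omegaCycVal p n (groupRingPow p n δ (tau p n ζ (primeI p n v hv))) := by
    intro φ
    have hr := rootAt_isPrimitiveRoot p n ζ v hv
    have hl : (ringChar (𝓞 (Cyc p n) ⧸ v.asIdeal)).Prime := (residuePrime v).2
    have hl0 : NeZero (ringChar (𝓞 (Cyc p n) ⧸ v.asIdeal)) := ⟨hl.ne_zero⟩
    obtain ⟨a, -, ha, hφ⟩ := (IsPrimitiveRoot.isPrimitiveRoot_iff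
      (hr.map_of_injective (omegaCycVal p n).injective)).mp
      (hr.map_of_injective φ.toRingHom.injective)
    have hu : (a : 𝓞 (Cyc p n) ⧸ v.asIdeal) ≠ 0 := by
      rw [ne_eq, ringChar.spec]
      exact (Nat.Prime.coprime_iff_not_dvd hl).mp ha.symm
    rw [algHom_groupRingPow_tau_primeI p n ζ δ v hv φ (a := a) hφ.symm (u := Units.mk0 _ hu) rfl,
      hδ, ZMod.val_zero, pow_zero, inv_one, Units.val_one, one_mul]
  -- an element of `Ω(ζ_{p ^ (n + 1)})` fixed by all homomorphisms over `k_n` lies in `k_n`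
  obtain ⟨y, hy⟩ := mem_range_of_forall_algHom p n _ key
  have hy0 : y ≠ 0 := by
    rintro rfl
    rw [map_zero] at hy
    exact Units.ne_zero _ hy.symm
  exact ⟨Units.mk0 y hy0, Units.ext hy⟩

omit hp in
theorem map_cyc_omegaCyc_injective : Function.Injective
    (Units.map (algebraMap (Cyc p n) (OmegaCyc p n)).toMonoidHom) :=
  Units.map_injective (algebraMap (Cyc p n) (OmegaCyc p n)).injective

/-- The homomorphism `δ τ_n`, with values in `k_nˣ`, for `δ` of weight `0`. -/
def jacobiHom (δ : MonoidAlgebra ℤ Gal(Cyc p n/ℚ)) (hδ : weight p n δ = 0) : IdealHom p n where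
  toFun a := (exists_map_eq_groupRingPow p n ζ δ hδ a).choose
  map_one' := by
    apply map_cyc_omegaCyc_injective p n
    refine (exists_map_eq_groupRingPow p n ζ δ hδ 1).choose_spec.trans ?_
    rw [map_one, map_one]
    exact map_one (groupRingPowHom p n δ)
  map_mul' a b := by
    apply map_cyc_omegaCyc_injective p n
    refine (exists_map_eq_groupRingPow p n ζ δ hδ (a * b)).choose_spec.trans ?_
    rw [map_mul, map_mul, (exists_map_eq_groupRingPow p n ζ δ hδ a).choose_spec,
      (exists_map_eq_groupRingPow p n ζ δ hδ b).choose_spec]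
    exact map_mul (groupRingPowHom p n δ) _ _

theorem map_jacobiHom (δ : MonoidAlgebra ℤ Gal(Cyc p n/ℚ)) (hδ : weight p n δ = 0) (a : I p n) :
    Units.map (algebraMap (Cyc p n) (OmegaCyc p n)).toMonoidHom (jacobiHom p n ζ δ hδ a) =
      groupRingPow p n δ (tau p n ζ a) :=
  (exists_map_eq_groupRingPow p n ζ δ hδ a).choose_spec

theorem cycVal_eq_prod {δ : MonoidAlgebra ℤ Gal(Cyc p n/ℚ)} {f : IdealHom p n}
    (hf : ∀ a, Units.map (algebraMap (Cyc p n) (OmegaCyc p n)).toMonoidHom (f a) =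
      groupRingPow p n δ (tau p n ζ a))
    (v : HeightOneSpectrum (𝓞 (Cyc p n))) (hv : (p : 𝓞 (Cyc p n)) ∉ v.asIdeal) :
    cycVal p n (f (primeI p n v hv)) =
      ∏ σ, complexGaussSum p n ζ v hv (cycChar p n σ : ZMod (p ^ (n + 1))).val ^ δ.coeff σ := by
  rw [← groupRingPow_tau_primeI, ← hf, ← omegaCycVal_algebraMap']
  rfl

/-- There is a prime of `k_n` of residue degree one: the character of its residue field attains a
generator of `μ_{p ^ (n + 1)}` at the class of a natural number. -/
theorem exists_prime_degree_one : ∃ (v : HeightOneSpectrum (𝓞 (Cyc p n)))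
    (hv : (p : 𝓞 (Cyc p n)) ∉ v.asIdeal) (a : ℕ) (u : (𝓞 (Cyc p n) ⧸ v.asIdeal)ˣ),
    (u : 𝓞 (Cyc p n) ⧸ v.asIdeal) = a ∧ a.Coprime (residuePrime v) ∧
      IsPrimitiveRoot (complexChar p n v hv u : ℂ) (p ^ (n + 1)) := by
  -- a prime of `k_n` above `l` has residue degree the order of `l` modulo `p ^ (n + 1)`
  obtain ⟨l, hl, hpl, hl1⟩ := Nat.exists_prime_gt_modEq_one (k := p ^ (n + 1)) p (NeZero.ne _)
  have : Fact l.Prime := ⟨hl⟩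
  obtain ⟨⟨P, hP, hP'⟩⟩ := (Ideal.span {(l : ℤ)}).nonempty_primesOver (S := 𝓞 (Cyc p n))
  have hlZ : Ideal.span {(l : ℤ)} ≠ ⊥ := by simpa using hl.ne_zero
  have hdvd : ¬ l ∣ p ^ (n + 1) := fun h ↦
    hpl.ne' ((Nat.prime_dvd_prime_iff_eq hl hp.out).mp (hl.dvd_of_dvd_pow h))
  have hnorm : Ideal.absNorm P = l := by
    have h1 := IsCyclotomicExtension.Rat.inertiaDeg_eq_of_not_dvd l (Cyc p n) P hdvd
    have h2 := Ideal.absNorm_pow_inertiaDeg (Ideal.span {(l : ℤ)}) P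
    rw [h1, (ZMod.natCast_eq_natCast_iff l 1 _).mpr hl1, Nat.cast_one, orderOf_one, pow_one] at h2
    rw [← h2, Ideal.absNorm_span_singleton]
    simp
  obtain ⟨v, rfl⟩ : ∃ v : HeightOneSpectrum (𝓞 (Cyc p n)), v.asIdeal = P :=
    ⟨⟨P, hP, Ideal.ne_bot_of_liesOver_of_ne_bot hlZ P⟩, rfl⟩
  let _ : Fintype (𝓞 (Cyc p n) ⧸ v.asIdeal) := Fintype.ofFinite _
  have hcard : Fintype.card (𝓞 (Cyc p n) ⧸ v.asIdeal) = l := by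
    rw [← hnorm, Ideal.absNorm_apply, Submodule.cardQuot_apply, Nat.card_eq_fintype_card]
  have hchar : ringChar (𝓞 (Cyc p n) ⧸ v.asIdeal) = l :=
    (ringChar.eq_iff.mpr (charP_of_card_eq_prime hcard))
  have hv : (p : 𝓞 (Cyc p n)) ∉ v.asIdeal := by
    rw [← Ideal.Quotient.eq_zero_iff_mem, map_natCast, ringChar.spec, hchar]
    exact fun h ↦ hpl.ne' ((Nat.prime_dvd_prime_iff_eq hl hp.out).mp h)
  obtain ⟨g, hg⟩ := IsCyclic.exists_generator (α := (𝓞 (Cyc p n) ⧸ v.asIdeal)ˣ)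
  let e := ZMod.ringEquivOfPrime (𝓞 (Cyc p n) ⧸ v.asIdeal) hl hcard
  have ha : (g : 𝓞 (Cyc p n) ⧸ v.asIdeal) = (e.symm g).val := by
    rw [← map_natCast e, ZMod.natCast_rightInverse, e.apply_symm_apply]
  refine ⟨v, hv, (e.symm g).val, g, ha, ?_, isPrimitiveRoot_complexChar p n v hv hg⟩
  rw [Nat.coprime_comm, Nat.Prime.coprime_iff_not_dvd (residuePrime v).2]
  change ¬ ringChar _ ∣ _
  rw [← ringChar.spec, ← ha]
  exact g.ne_zero

end Primes

/-! ### Equivariance of the Gauss sums -/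

section Equivariance

variable (p n : ℕ) [hp : Fact p.Prime] (ζ : RootChoice)

/-- The image of a prime ideal under a Galois automorphism. -/
def galPrime (σ : Gal(Cyc p n/ℚ)) (v : HeightOneSpectrum (𝓞 (Cyc p n))) :
    HeightOneSpectrum (𝓞 (Cyc p n)) where
  asIdeal := v.asIdeal.map (RingOfIntegers.mapRingEquiv σ.toRingEquiv)
  isPrime := Ideal.map_isPrime_of_equiv _
  ne_bot := by
    rw [ne_eq, Ideal.map_eq_bot_iff_of_injective (RingEquiv.injective _)]
    exact v.ne_bot

omit hp in
theorem mem_galPrime {σ : Gal(Cyc p n/ℚ)} {v : HeightOneSpectrum (𝓞 (Cyc p n))} {x : 𝓞 (Cyc p n)} :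
    x ∈ (galPrime p n σ v).asIdeal ↔
      ∃ y ∈ v.asIdeal, RingOfIntegers.mapRingEquiv σ.toRingEquiv y = x :=
  Ideal.mem_map_of_equiv _ _

omit hp in
theorem notMem_galPrime (σ : Gal(Cyc p n/ℚ)) {v : HeightOneSpectrum (𝓞 (Cyc p n))}
    (hv : (p : 𝓞 (Cyc p n)) ∉ v.asIdeal) : (p : 𝓞 (Cyc p n)) ∉ (galPrime p n σ v).asIdeal := by
  intro h
  obtain ⟨y, hy, hyp⟩ := (mem_galPrime p n).mp h
  rw [← map_natCast (RingOfIntegers.mapRingEquiv σ.toRingEquiv)] at hyp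
  exact hv ((RingEquiv.injective _ hyp) ▸ hy)

theorem galIdeal_primeI (σ : Gal(Cyc p n/ℚ)) (v : HeightOneSpectrum (𝓞 (Cyc p n)))
    (hv : (p : 𝓞 (Cyc p n)) ∉ v.asIdeal) :
    galIdeal p n σ (primeI p n v hv) =
      primeI p n (galPrime p n σ v) (notMem_galPrime p n σ hv) := by
  refine Subtype.ext (Units.ext ?_)
  change (idealMap σ.toRingEquiv (primeUnit v) : FractionalIdeal (𝓞 (Cyc p n))⁰ (Cyc p n)) =
    ((v.asIdeal.map (RingOfIntegers.mapRingEquiv σ.toRingEquiv) : Ideal (𝓞 (Cyc p n))) :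
      FractionalIdeal (𝓞 (Cyc p n))⁰ (Cyc p n))
  ext x
  rw [mem_idealMap, FractionalIdeal.mem_coeIdeal]
  constructor
  · rintro ⟨y, hy, rfl⟩
    obtain ⟨z, hz, rfl⟩ := (FractionalIdeal.mem_coeIdeal _).mp hy
    exact ⟨RingOfIntegers.mapRingEquiv σ.toRingEquiv z, Ideal.mem_map_of_mem _ hz, rfl⟩
  · rintro ⟨z, hz, rfl⟩
    obtain ⟨y, hy, rfl⟩ := (Ideal.mem_map_of_equiv _ z).mp hz
    exact ⟨y, (FractionalIdeal.mem_coeIdeal _).mpr ⟨y, hy, rfl⟩, rfl⟩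

/-- The isomorphism of residue fields induced by a Galois automorphism. -/
def galResidue (σ : Gal(Cyc p n/ℚ)) (v : HeightOneSpectrum (𝓞 (Cyc p n))) :
    (𝓞 (Cyc p n) ⧸ v.asIdeal) ≃+* (𝓞 (Cyc p n) ⧸ (galPrime p n σ v).asIdeal) :=
  Ideal.quotientEquiv _ _ (RingOfIntegers.mapRingEquiv σ.toRingEquiv) rfl

theorem residuePrime_galPrime (σ : Gal(Cyc p n/ℚ)) (v : HeightOneSpectrum (𝓞 (Cyc p n))) :
    residuePrime (galPrime p n σ v) = residuePrime v :=
  Subtype.ext (ringChar.eq_iff.mpr (charP_of_injective_ringHom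
    (f := (galResidue p n σ v).toRingHom) (galResidue p n σ v).injective _))

/-- The isomorphism of the unit groups of residue fields induced by a Galois automorphism. -/
def galResidueUnits (σ : Gal(Cyc p n/ℚ)) (v : HeightOneSpectrum (𝓞 (Cyc p n))) :
    (𝓞 (Cyc p n) ⧸ v.asIdeal)ˣ →* (𝓞 (Cyc p n) ⧸ (galPrime p n σ v).asIdeal)ˣ :=
  (Units.mapEquiv (galResidue p n σ v).toMulEquiv).toMonoidHom

/-- Both sides are the root of unity which reduces to the same power of the image of `x`. -/
theorem complexChar_galPrime (σ : Gal(Cyc p n/ℚ)) (v : HeightOneSpectrum (𝓞 (Cyc p n)))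
    (hv : (p : 𝓞 (Cyc p n)) ∉ v.asIdeal) (x : (𝓞 (Cyc p n) ⧸ v.asIdeal)ˣ) :
    complexChar p n (galPrime p n σ v) (notMem_galPrime p n σ hv)
        (galResidueUnits p n σ v x) =
      complexChar p n v hv x ^ (cycChar p n σ : ZMod (p ^ (n + 1))).val := by
  have hv' := notMem_galPrime p n σ hv
  set u := residueChar (p ^ (n + 1)) v (coprime_of_notMem p n v hv) x with hu
  have hmap : Units.map (RingOfIntegers.mapRingEquiv σ.toRingEquiv : 𝓞 (Cyc p n) →+* _).toMonoidHom
      (u : (𝓞 (Cyc p n))ˣ) ∈ rootsOfUnity (p ^ (n + 1)) (𝓞 (Cyc p n)) := by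
    rw [mem_rootsOfUnity, ← map_pow, (mem_rootsOfUnity _ _).mp u.2, map_one]
  have h1 : residueChar (p ^ (n + 1)) (galPrime p n σ v) (coprime_of_notMem p n _ hv')
      (galResidueUnits p n σ v x) = ⟨_, hmap⟩ := by
    refine Ideal.rootsOfUnityMapQuot_injective (p ^ (n + 1))
      (mt Ideal.absNorm_eq_one_iff.mp (galPrime p n σ v).isPrime.ne_top)
      (coprime_of_notMem p n _ hv') ?_
    rw [residueChar_spec]
    have h2 := residueChar_spec (p ^ (n + 1)) v (coprime_of_notMem p n v hv) x
    have h3 := congrArg (galResidueUnits p n σ v) h2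
    rw [map_pow, map_inv, Nat.card_congr (galResidue p n σ v).toEquiv] at h3
    rw [← h3]
    exact Units.ext rfl
  refine Units.ext ?_
  rw [Units.val_pow_eq_pow_val, complexChar_val, complexChar_val, h1, ← map_pow]
  congr 1
  exact IsCyclotomicExtension.Rat.galEquivZMod_apply_of_pow_eq (p ^ (n + 1)) (Cyc p n) σ
    (residueChar_pow_eq_one p n v hv x)

theorem primeGaussSum_galPrime (σ : Gal(Cyc p n/ℚ)) (v : HeightOneSpectrum (𝓞 (Cyc p n)))
    (hv : (p : 𝓞 (Cyc p n)) ∉ v.asIdeal) :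
    primeGaussSum p n ζ (galPrime p n σ v) (notMem_galPrime p n σ hv) =
      galLift p n σ (primeGaussSum p n ζ v hv) := by
  apply (omegaCycVal p n).injective
  rw [omegaCycVal_galLift_primeGaussSum]
  have hN : Fact (1 < p ^ (n + 1)) := ⟨Nat.one_lt_pow (Nat.succ_ne_zero n) hp.out.one_lt⟩
  have h1 := omegaCycVal_galLift_primeGaussSum p n ζ (galPrime p n σ v) (notMem_galPrime p n σ hv) 1
  rw [map_one, map_one, Units.val_one, ZMod.val_one] at h1
  refine h1.trans ?_
  have hroot : (ζ (residuePrime (galPrime p n σ v)) : ℂ) = ζ (residuePrime v) := by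
    rw [residuePrime_galPrime]
  have hz : (ζ (residuePrime v) : ℂ) ^ ringChar (𝓞 (Cyc p n) ⧸ (galPrime p n σ v).asIdeal) = 1 := by
    rw [← hroot]
    exact (ζ (residuePrime (galPrime p n σ v))).2.pow_eq_one
  refine (fieldGaussSum_congr_root _ _ hroot _ hz).trans ((fieldGaussSum_ringEquiv _
    (galResidue p n σ v) _ (ζ (residuePrime v)).2.pow_eq_one hz).trans ?_)
  rw [complexGaussSum]
  congr 1
  refine MonoidHom.ext fun x ↦ ?_
  exact (pow_one (complexChar p n _ _ (galResidueUnits p n σ v x))).trans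
    (complexChar_galPrime p n σ v hv x)

theorem tau_galIdeal (σ : Gal(Cyc p n/ℚ)) (a : I p n) :
    tau p n ζ (galIdeal p n σ a) = Units.mapEquiv (galLift p n σ).toMulEquiv (tau p n ζ a) := by
  refine DFunLike.congr_fun (hom_ext_primeI p n (f := (tau p n ζ).comp (galIdeal p n σ))
    (g := (Units.mapEquiv (galLift p n σ).toMulEquiv).toMonoidHom.comp (tau p n ζ))
    fun v hv ↦ Units.ext ?_) a
  rw [MonoidHom.comp_apply, galIdeal_primeI, tau_primeI, primeGaussSum_galPrime, ← tau_primeI]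
  rfl

theorem groupRingPow_galLift (δ : MonoidAlgebra ℤ Gal(Cyc p n/ℚ)) (σ : Gal(Cyc p n/ℚ))
    (u : (OmegaCyc p n)ˣ) :
    groupRingPow p n δ (Units.mapEquiv (galLift p n σ).toMulEquiv u) =
      Units.mapEquiv (galLift p n σ).toMulEquiv (groupRingPow p n δ u) := by
  rw [groupRingPow_eq_prod, groupRingPow_eq_prod, map_prod]
  refine Finset.prod_congr rfl fun τ _ ↦ ?_
  rw [map_zpow]
  congr 1
  have hcomm : τ * σ = σ * τ := (cycChar p n).injective (by rw [map_mul, map_mul, mul_comm])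
  refine Units.ext ?_
  change galLift p n τ (galLift p n σ u) = galLift p n σ (galLift p n τ u)
  rw [← AlgEquiv.mul_apply, ← AlgEquiv.mul_apply, ← map_mul, ← map_mul, hcomm]

variable {p n ζ} in
theorem mem_equivariantHom {δ : MonoidAlgebra ℤ Gal(Cyc p n/ℚ)} {f : IdealHom p n}
    (hf : ∀ a, Units.map (algebraMap (Cyc p n) (OmegaCyc p n)).toMonoidHom (f a) =
      groupRingPow p n δ (tau p n ζ a)) : f ∈ equivariantHom p n := by
  intro σ a
  apply map_cyc_omegaCyc_injective p n
  rw [hf, tau_galIdeal, groupRingPow_galLift, ← hf]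
  exact Units.ext (galLift_algebraMap p n σ _)

end Equivariance

/-! ### The minus part of the Jacobi module -/

theorem prod_zpow_eq_zpow_sum {ι Γ : Type*} [CommGroupWithZero Γ] {a : Γ} (ha : a ≠ 0)
    (s : Finset ι) (m : ι → ℤ) : ∏ i ∈ s, a ^ m i = a ^ ∑ i ∈ s, m i := by
  induction s using Finset.cons_induction with
  | empty => simp
  | cons i s hi ih => rw [Finset.prod_cons, Finset.sum_cons, zpow_add₀ ha, ih]

section Minus

variable {p n : ℕ} [hp : Fact p.Prime] {ζ : RootChoice} {δ : MonoidAlgebra ℤ Gal(Cyc p n/ℚ)}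
  {f : IdealHom p n}

/-- If `δ τ_n` takes values in `k_n`, then `δ` has weight `0`: the automorphisms over `k_n` which
move `ζ_l` multiply the Gauss sums by values of characters. -/
theorem weight_eq_zero
    (hf : ∀ a, Units.map (algebraMap (Cyc p n) (OmegaCyc p n)).toMonoidHom (f a) =
      groupRingPow p n δ (tau p n ζ a)) : weight p n δ = 0 := by
  obtain ⟨v, hv, a, u, hu, ha, hχ⟩ := exists_prime_degree_one p n
  obtain ⟨φ, hφ⟩ := exists_algHom_pow p n (residuePrime v).2 (residuePrime_ne v hv)
    (rootAt_isPrimitiveRoot p n ζ v hv) ha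
  have h1 := algHom_groupRingPow_tau_primeI p n ζ δ v hv φ hφ hu
  have h2 : φ (groupRingPow p n δ (tau p n ζ (primeI p n v hv))) =
      omegaCycVal p n (groupRingPow p n δ (tau p n ζ (primeI p n v hv))) := by
    rw [← hf]
    exact (φ.commutes _).trans (omegaCycVal_algebraMap' p n _).symm
  rw [h2] at h1
  have h3 := mul_right_cancel₀ ((map_ne_zero _).mpr (Units.ne_zero _)) ((one_mul _).trans h1)
  rw [← Units.val_one, Units.val_inj, eq_comm, inv_eq_one] at h3
  replace hχ := IsPrimitiveRoot.coe_units_iff.mp hχ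
  have h4 := hχ.dvd_of_pow_eq_one _ h3
  rw [← ZMod.val_eq_zero]
  exact Nat.eq_zero_of_dvd_of_lt h4 (ZMod.val_lt _)

theorem cycVal_galois_eq_prod
    (hf : ∀ a, Units.map (algebraMap (Cyc p n) (OmegaCyc p n)).toMonoidHom (f a) =
      groupRingPow p n δ (tau p n ζ a)) (σ : Gal(Cyc p n/ℚ))
    (v : HeightOneSpectrum (𝓞 (Cyc p n))) (hv : (p : 𝓞 (Cyc p n)) ∉ v.asIdeal) :
    cycVal p n (σ (f (primeI p n v hv))) =
      ∏ τ, complexGaussSum p n ζ v hv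
        (cycChar p n (σ * τ) : ZMod (p ^ (n + 1))).val ^ δ.coeff τ := by
  rw [← omegaCycVal_algebraMap', ← galLift_algebraMap]
  have h1 : algebraMap (Cyc p n) (OmegaCyc p n) (f (primeI p n v hv)) =
      groupRingPow p n δ (tau p n ζ (primeI p n v hv)) := congrArg Units.val (hf _)
  rw [h1, groupRingPow_val, map_prod, map_prod]
  refine Finset.prod_congr rfl fun τ _ ↦ ?_
  rw [map_zpow₀, map_zpow₀, tau_primeI, ← AlgEquiv.mul_apply, ← map_mul,
    omegaCycVal_galLift_primeGaussSum]

/-- The Gauss sums at `κ(σ)` and `-κ(σ)` are conjugate, with product the cardinality of the residue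
field. -/
theorem mul_sigmaNegOne_eq (h2 : p ≠ 2)
    (hf : ∀ a, Units.map (algebraMap (Cyc p n) (OmegaCyc p n)).toMonoidHom (f a) =
      groupRingPow p n δ (tau p n ζ a))
    (v : HeightOneSpectrum (𝓞 (Cyc p n))) (hv : (p : 𝓞 (Cyc p n)) ∉ v.asIdeal) :
    cycVal p n (f (primeI p n v hv) * sigmaNegOne p n (f (primeI p n v hv))) =
      (Nat.card (𝓞 (Cyc p n) ⧸ v.asIdeal) : ℂ) ^ degree p n δ := by
  rw [map_mul, cycVal_eq_prod p n ζ hf, cycVal_galois_eq_prod hf, ← Finset.prod_mul_distrib]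
  have hN : Fact (1 < p ^ (n + 1)) := ⟨Nat.one_lt_pow (Nat.succ_ne_zero n) hp.out.one_lt⟩
  have h3 : ∀ τ, complexGaussSum p n ζ v hv (cycChar p n τ : ZMod (p ^ (n + 1))).val ^ δ.coeff τ *
      complexGaussSum p n ζ v hv
        (cycChar p n (sigmaNegOne p n * τ) : ZMod (p ^ (n + 1))).val ^ δ.coeff τ =
      (Nat.card (𝓞 (Cyc p n) ⧸ v.asIdeal) : ℂ) ^ δ.coeff τ := by
    intro τ
    rw [← mul_zpow, complexGaussSum_mul p n ζ v hv h2]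
    · rw [← ZMod.natCast_eq_zero_iff, ZMod.natCast_rightInverse]
      exact Units.ne_zero _
    · rw [← ZMod.natCast_eq_zero_iff, Nat.cast_add, ZMod.natCast_rightInverse,
        ZMod.natCast_rightInverse, map_mul, sigmaNegOne, MulEquiv.apply_symm_apply]
      simp
  have hq : (Nat.card (𝓞 (Cyc p n) ⧸ v.asIdeal) : ℂ) ≠ 0 := Nat.cast_ne_zero.mpr Nat.card_pos.ne'
  rw [Finset.prod_congr rfl fun τ _ ↦ h3 τ, degree, prod_zpow_eq_zpow_sum hq]

/-- `𝒥_n⁻` consists of the `δ τ_n` with `δ` of weight and degree `0`. -/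
theorem mem_jacobiMinus_iff (h2 : p ≠ 2) : f ∈ jacobiMinus p n ζ ↔
    ∃ δ : MonoidAlgebra ℤ Gal(Cyc p n/ℚ), weight p n δ = 0 ∧ degree p n δ = 0 ∧
      ∀ a, Units.map (algebraMap (Cyc p n) (OmegaCyc p n)).toMonoidHom (f a) =
        groupRingPow p n δ (tau p n ζ a) := by
  constructor
  · rintro ⟨⟨-, δ, hf⟩, hminus⟩
    refine ⟨δ, weight_eq_zero hf, ?_, hf⟩
    obtain ⟨v, hv, -⟩ := exists_prime_degree_one p n
    have h1 := mul_sigmaNegOne_eq h2 hf v hv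
    have h3 : (f (primeI p n v hv) : Cyc p n) * sigmaNegOne p n (f (primeI p n v hv)) = 1 := by
      have h4 : sigmaNegOne p n (f (primeI p n v hv)) =
        ((f (primeI p n v hv))⁻¹ : (Cyc p n)ˣ) := congrArg Units.val (hminus _)
      rw [h4, Units.mul_inv]
    rw [h3, map_one, eq_comm] at h1
    have h5 : ((Nat.card (𝓞 (Cyc p n) ⧸ v.asIdeal) : ℝ)) ^ degree p n δ = 1 := by
      rw [← Complex.ofReal_inj]
      push_cast
      exact h1
    refine (zpow_eq_one_iff_right₀ (Nat.cast_nonneg _) ?_).mp h5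
    exact_mod_cast Finite.one_lt_card.ne'
  · rintro ⟨δ, -, hdeg, hf⟩
    refine ⟨⟨mem_equivariantHom hf, δ, hf⟩, fun a ↦ ?_⟩
    refine DFunLike.congr_fun (hom_ext_primeI p n
      (f := (Units.mapEquiv (sigmaNegOne p n).toMulEquiv).toMonoidHom.comp f) (g := f⁻¹)
      fun v hv ↦ ?_) a
    have h1 := mul_sigmaNegOne_eq h2 hf v hv
    rw [hdeg, zpow_zero, ← map_one (cycVal p n)] at h1
    rw [MonoidHom.inv_apply, eq_inv_iff_mul_eq_one, mul_comm]
    exact Units.ext ((cycVal p n).injective h1)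

end Minus

/-! ### The extension `k_{n + 1} / k_n` -/

section Tower

variable (p n : ℕ) [hp : Fact p.Prime]

instance instIsScalarTowerSucc : IsScalarTower ℚ (Cyc p n) (Cyc p (n + 1)) :=
  IsScalarTower.of_algebraMap_eq' (Subsingleton.elim _ _)

instance instIsGaloisSucc : IsGalois (Cyc p n) (Cyc p (n + 1)) :=
  IsGalois.tower_top_of_isGalois ℚ (Cyc p n) (Cyc p (n + 1))

omit hp in
theorem cycVal_algebraMap_succ (x : Cyc p n) :
    cycVal p (n + 1) (algebraMap (Cyc p n) (Cyc p (n + 1)) x) = cycVal p n x :=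
  cycVal_cycIncl p n x

/-- The restriction `G_{n + 1} → G_n`. -/
def resGal : Gal(Cyc p (n + 1)/ℚ) →* Gal(Cyc p n/ℚ) :=
  AlgEquiv.restrictNormalHom (Cyc p n)

theorem algebraMap_resGal (σ : Gal(Cyc p (n + 1)/ℚ)) (x : Cyc p n) :
    algebraMap (Cyc p n) (Cyc p (n + 1)) (resGal p n σ x) =
      σ (algebraMap (Cyc p n) (Cyc p (n + 1)) x) :=
  AlgEquiv.restrictNormal_commutes σ (Cyc p n) x

theorem resGal_surjective : Function.Surjective (resGal p n) :=
  AlgEquiv.restrictNormalHom_surjective (Cyc p (n + 1))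

theorem cycChar_resGal (σ : Gal(Cyc p (n + 1)/ℚ)) :
    cycChar p n (resGal p n σ) = ZMod.unitsMap (pow_dvd_pow p (Nat.le_succ (n + 1)))
      (cycChar p (n + 1) σ) :=
  IsCyclotomicExtension.Rat.galEquivZMod_restrictNormal_apply (p ^ (n + 1 + 1)) (Cyc p (n + 1))
    (Cyc p n) _ σ

theorem val_cycChar_resGal (σ : Gal(Cyc p (n + 1)/ℚ)) :
    (cycChar p n (resGal p n σ) : ZMod (p ^ (n + 1))).val =
      (cycChar p (n + 1) σ : ZMod (p ^ (n + 1 + 1))).val % p ^ (n + 1) := by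
  rw [cycChar_resGal, ZMod.unitsMap_val, ← ZMod.natCast_val, ZMod.val_natCast]

theorem resGal_sigmaNegOne : resGal p n (sigmaNegOne p (n + 1)) = sigmaNegOne p n := by
  apply (cycChar p n).injective
  rw [cycChar_resGal, sigmaNegOne, sigmaNegOne, MulEquiv.apply_symm_apply,
    MulEquiv.apply_symm_apply]
  refine Units.ext ?_
  rw [ZMod.unitsMap_val, Units.val_neg, Units.val_one, Units.val_neg, Units.val_one,
    ZMod.cast_neg (pow_dvd_pow p (Nat.le_succ _)), ZMod.cast_one (pow_dvd_pow p (Nat.le_succ _))]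

/-- The inclusion `Gal(k_{n + 1} / k_n) → G_{n + 1}`. -/
def inclGal : Gal(Cyc p (n + 1)/Cyc p n) →* Gal(Cyc p (n + 1)/ℚ) :=
  AlgEquiv.restrictScalarsHom ℚ

omit hp in
theorem inclGal_apply (ρ : Gal(Cyc p (n + 1)/Cyc p n)) (x : Cyc p (n + 1)) :
    inclGal p n ρ x = ρ x := rfl

omit hp in
theorem inclGal_injective : Function.Injective (inclGal p n) :=
  AlgEquiv.restrictScalars_injective ℚ

theorem resGal_inclGal (ρ : Gal(Cyc p (n + 1)/Cyc p n)) : resGal p n (inclGal p n ρ) = 1 := by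
  refine AlgEquiv.ext fun x ↦ (algebraMap (Cyc p n) (Cyc p (n + 1))).injective ?_
  rw [algebraMap_resGal, inclGal_apply, AlgEquiv.commutes, AlgEquiv.one_apply]

theorem gal_mul_comm (σ τ : Gal(Cyc p n/ℚ)) : σ * τ = τ * σ :=
  (cycChar p n).injective (by rw [map_mul, map_mul, mul_comm])

theorem card_gal_succ : Fintype.card Gal(Cyc p (n + 1)/Cyc p n) = p := by
  have h1 : ∀ m, Module.finrank ℚ (Cyc p m) = p ^ m * (p - 1) := fun m ↦ by
    rw [IsCyclotomicExtension.finrank (n := p ^ (m + 1)) (Cyc p m)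
      (Polynomial.cyclotomic.irreducible_rat (NeZero.pos _)),
      Nat.totient_prime_pow_succ hp.out]
  have h2 := Module.finrank_mul_finrank ℚ (Cyc p n) (Cyc p (n + 1))
  have hpos : 0 < p ^ n * (p - 1) := Nat.mul_pos (NeZero.pos _) (Nat.sub_pos_of_lt hp.out.one_lt)
  rw [h1, h1] at h2
  rw [← Nat.card_eq_fintype_card, IsGalois.card_aut_eq_finrank]
  refine Nat.eq_of_mul_eq_mul_left hpos ?_
  rw [h2]
  ring

theorem algebraMap_norm_succ (x : Cyc p (n + 1)) :
    algebraMap (Cyc p n) (Cyc p (n + 1)) (Algebra.norm (Cyc p n) x) =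
      ∏ ρ : Gal(Cyc p (n + 1)/Cyc p n), inclGal p n ρ x :=
  Algebra.norm_eq_prod_automorphisms (Cyc p n) x

/-- The values of `κ` on a coset of `Gal(k_{n + 1} / k_n)` are the `p` lifts modulo
`p ^ (n + 2)` of a class modulo `p ^ (n + 1)`. -/
theorem sum_mul_cycChar_mod (σ : Gal(Cyc p (n + 1)/ℚ)) {u h : ℕ} (hu : u.Coprime p)
    (hph : p = 2 * h + 1) :
    ∑ ρ : Gal(Cyc p (n + 1)/Cyc p n),
        u * (cycChar p (n + 1) (inclGal p n ρ * σ) : ZMod (p ^ (n + 1 + 1))).val %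
          (p * p ^ (n + 1)) =
      p * (u * (cycChar p n (resGal p n σ) : ZMod (p ^ (n + 1))).val % p ^ (n + 1)) +
        p ^ (n + 1) * (p * h) := by
  classical
  set M := p ^ (n + 1) with hM
  have hMpos : 0 < M := NeZero.pos _
  have hpM : p ^ (n + 1 + 1) = p * M := by rw [pow_succ, mul_comm]
  set r := u * (cycChar p n (resGal p n σ) : ZMod (p ^ (n + 1))).val % M with hr
  set F : Gal(Cyc p (n + 1)/Cyc p n) → ℕ := fun ρ ↦
    u * (cycChar p (n + 1) (inclGal p n ρ * σ) : ZMod (p ^ (n + 1 + 1))).val % (p * M) with hF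
  have hlt : ∀ ρ, F ρ < p * M := fun ρ ↦ Nat.mod_lt _ (Nat.mul_pos hp.out.pos hMpos)
  have hmod : ∀ ρ, F ρ % M = r := by
    intro ρ
    have h1 := val_cycChar_resGal p n (inclGal p n ρ * σ)
    rw [map_mul, resGal_inclGal, one_mul] at h1
    rw [hF, hr, h1]
    simp only
    rw [Nat.mod_mod_of_dvd _ (Dvd.intro_left p rfl), Nat.mul_mod_mod]
  have hinj : Function.Injective F := by
    intro ρ ρ' heq
    have h1 : ((u : ℕ) : ZMod (p ^ (n + 1 + 1))) * (cycChar p (n + 1) (inclGal p n ρ * σ) :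
        ZMod (p ^ (n + 1 + 1))) = u * (cycChar p (n + 1) (inclGal p n ρ' * σ) :
        ZMod (p ^ (n + 1 + 1))) := by
      have h2 := (ZMod.natCast_eq_natCast_iff' _ _ (p * M)).mpr heq
      rw [← hpM] at h2
      push_cast at h2
      rwa [ZMod.natCast_rightInverse, ZMod.natCast_rightInverse] at h2
    have hunit : IsUnit ((u : ℕ) : ZMod (p ^ (n + 1 + 1))) :=
      (ZMod.isUnit_iff_coprime _ _).mpr (hu.pow_right _)
    have h3 := Units.ext (hunit.mul_left_cancel h1)
    exact inclGal_injective p n (mul_right_cancel ((cycChar p (n + 1)).injective h3))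
  -- the values of `F` are `p` numbers below `p M` congruent to `r` modulo `M`
  have himage : Finset.univ.image F = (Finset.range p).image fun j ↦ r + M * j := by
    refine Finset.eq_of_subset_of_card_le (fun m hm ↦ ?_) ?_
    · obtain ⟨ρ, -, rfl⟩ := Finset.mem_image.mp hm
      refine Finset.mem_image.mpr ⟨F ρ / M, Finset.mem_range.mpr ?_, ?_⟩
      · exact Nat.div_lt_of_lt_mul ((mul_comm p M) ▸ hlt ρ)
      · rw [← hmod ρ, Nat.mod_add_div]
    · rw [Finset.card_image_of_injective _ hinj, Finset.card_univ, card_gal_succ]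
      exact Finset.card_image_le.trans (Finset.card_range p).le
  have hsum : ∑ ρ, F ρ = ∑ j ∈ Finset.range p, (r + M * j) := by
    rw [← Finset.sum_image (f := fun m ↦ m) hinj.injOn, himage,
      Finset.sum_image fun a _ b _ hab ↦ Nat.eq_of_mul_eq_mul_left hMpos (Nat.add_left_cancel hab)]
  rw [hsum, Finset.sum_add_distrib, Finset.sum_const, Finset.card_range, smul_eq_mul,
    ← Finset.mul_sum]
  congr 2
  have hg := Finset.sum_range_id_mul_two p
  have hp1 : p - 1 = 2 * h := by omega
  rw [hp1] at hg
  linarith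

end Tower

section RestrictGroupRing

variable (p n : ℕ) [hp : Fact p.Prime]

/-- The map `ℤ[G_{n + 1}] → ℤ[G_n]` induced by restriction. -/
def resRing (δ : MonoidAlgebra ℤ Gal(Cyc p (n + 1)/ℚ)) : MonoidAlgebra ℤ Gal(Cyc p n/ℚ) :=
  MonoidAlgebra.mapDomain (resGal p n) δ

variable {p n} in
theorem sum_resRing {A : Type*} [AddCommGroup A] (δ : MonoidAlgebra ℤ Gal(Cyc p (n + 1)/ℚ))
    (F : Gal(Cyc p n/ℚ) → A) :
    ∑ τ, (resRing p n δ).coeff τ • F τ = ∑ σ, δ.coeff σ • F (resGal p n σ) := by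
  have h1 := Finsupp.sum_mapDomain_index (f := resGal p n) (s := δ.coeff)
    (h := fun τ m ↦ m • F τ) (fun _ ↦ zero_smul _ _) fun _ _ _ ↦ add_smul _ _ _
  exact ((Finsupp.sum_fintype _ (fun τ m ↦ m • F τ) fun _ ↦ zero_smul _ _).symm.trans h1).trans
    (Finsupp.sum_fintype _ (fun σ m ↦ m • F (resGal p n σ)) fun _ ↦ zero_smul _ _)

variable {p n} in
theorem prod_resRing {Γ : Type*} [CommGroupWithZero Γ]
    (δ : MonoidAlgebra ℤ Gal(Cyc p (n + 1)/ℚ)) {F : Gal(Cyc p n/ℚ) → Γ} (hF : ∀ τ, F τ ≠ 0) :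
    ∏ τ, F τ ^ (resRing p n δ).coeff τ = ∏ σ, F (resGal p n σ) ^ δ.coeff σ := by
  have h := congrArg (fun a ↦ ((Additive.toMul a : Γˣ) : Γ))
    (sum_resRing δ fun τ ↦ Additive.ofMul (Units.mk0 (F τ) (hF τ)))
  simpa only [toMul_sum, toMul_zsmul, toMul_ofMul, Units.coe_prod, Units.val_zpow_eq_zpow_val,
    Units.val_mk0] using h

theorem degree_resRing (δ : MonoidAlgebra ℤ Gal(Cyc p (n + 1)/ℚ)) :
    degree p n (resRing p n δ) = degree p (n + 1) δ := by
  have h := sum_resRing δ fun _ ↦ (1 : ℤ)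
  simp only [smul_eq_mul, mul_one] at h
  exact h

theorem weight_resRing (δ : MonoidAlgebra ℤ Gal(Cyc p (n + 1)/ℚ)) :
    weight p n (resRing p n δ) =
      ZMod.castHom (pow_dvd_pow p (Nat.le_succ (n + 1))) _ (weight p (n + 1) δ) := by
  have h := sum_resRing δ fun τ ↦ (cycChar p n τ : ZMod (p ^ (n + 1)))
  simp only [zsmul_eq_mul] at h
  rw [weight, h, weight, map_sum]
  refine Finset.sum_congr rfl fun σ _ ↦ ?_
  rw [map_mul, map_intCast, cycChar_resGal, ZMod.unitsMap_val, ZMod.castHom_apply]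

theorem degree_add (δ ε : MonoidAlgebra ℤ Gal(Cyc p n/ℚ)) :
    degree p n (δ + ε) = degree p n δ + degree p n ε :=
  Finset.sum_add_distrib

theorem weight_add (δ ε : MonoidAlgebra ℤ Gal(Cyc p n/ℚ)) :
    weight p n (δ + ε) = weight p n δ + weight p n ε := by
  rw [weight, weight, weight, ← Finset.sum_add_distrib]
  refine Finset.sum_congr rfl fun σ _ ↦ ?_
  rw [← add_mul, ← Int.cast_add]
  rfl

theorem degree_single (σ : Gal(Cyc p n/ℚ)) (m : ℤ) :
    degree p n (MonoidAlgebra.single σ m) = m := by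
  classical
  rw [degree, Finset.sum_eq_single σ]
  · exact Finsupp.single_eq_same
  · exact fun τ _ hτ ↦ Finsupp.single_eq_of_ne hτ
  · exact fun h ↦ absurd (Finset.mem_univ _) h

theorem weight_single (σ : Gal(Cyc p n/ℚ)) (m : ℤ) :
    weight p n (MonoidAlgebra.single σ m) = m * (cycChar p n σ : ZMod (p ^ (n + 1))) := by
  classical
  rw [weight, Finset.sum_eq_single σ]
  · rw [show (MonoidAlgebra.single σ m).coeff σ = m from Finsupp.single_eq_same]
  · intro τ _ hτ
    rw [show (MonoidAlgebra.single σ m).coeff τ = 0 from Finsupp.single_eq_of_ne hτ, Int.cast_zero,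
      zero_mul]
  · exact fun h ↦ absurd (Finset.mem_univ _) h

/-- An element of `ℤ[G_n]` of weight and degree `0` lifts to such an element of `ℤ[G_{n + 1}]`:
the weight of a lift is corrected by a multiple of `σ - 1`, where `κ(σ) = 1 + p ^ (n + 1)`. -/
theorem exists_resRing_eq (ε : MonoidAlgebra ℤ Gal(Cyc p n/ℚ)) (hw : weight p n ε = 0)
    (hd : degree p n ε = 0) : ∃ δ : MonoidAlgebra ℤ Gal(Cyc p (n + 1)/ℚ),
      weight p (n + 1) δ = 0 ∧ degree p (n + 1) δ = 0 ∧ resRing p n δ = ε := by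
  obtain ⟨s, hs⟩ := (resGal_surjective p n).hasRightInverse
  set δ₀ : MonoidAlgebra ℤ Gal(Cyc p (n + 1)/ℚ) := MonoidAlgebra.mapDomain s ε with hδ₀
  have h0 : resRing p n δ₀ = ε := by
    refine MonoidAlgebra.coeff_injective ?_
    change Finsupp.mapDomain (resGal p n) (Finsupp.mapDomain s ε.coeff) = ε.coeff
    rw [← Finsupp.mapDomain_comp, hs.id, Finsupp.mapDomain_id]
  have hd0 : degree p (n + 1) δ₀ = 0 := by rw [← degree_resRing, h0, hd]
  have hw0 := weight_resRing p n δ₀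
  rw [h0, hw] at hw0
  obtain ⟨m, hm⟩ : ∃ m : ℤ, weight p (n + 1) δ₀ = ((p ^ (n + 1) * m : ℤ) :
      ZMod (p ^ (n + 1 + 1))) := by
    obtain ⟨c, hc⟩ := ZMod.intCast_surjective (weight p (n + 1) δ₀)
    rw [← hc, map_intCast, eq_comm, ZMod.intCast_zmod_eq_zero_iff_dvd] at hw0
    obtain ⟨m, rfl⟩ := hw0
    exact ⟨m, by rw [← hc]; push_cast; rfl⟩
  have hcop : (1 + p ^ (n + 1)).Coprime (p ^ (n + 1 + 1)) := by
    refine Nat.Coprime.pow_right _ ((Nat.Prime.coprime_iff_not_dvd hp.out).mpr fun hdvd ↦ ?_).symm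
    rw [Nat.dvd_add_left (dvd_pow_self p (Nat.succ_ne_zero n))] at hdvd
    exact hp.out.one_lt.ne' (Nat.dvd_one.mp hdvd)
  set σ := (cycChar p (n + 1)).symm (ZMod.unitOfCoprime _ hcop) with hσ
  have hκ : cycChar p (n + 1) σ = ZMod.unitOfCoprime _ hcop := MulEquiv.apply_symm_apply _ _
  have hres : resGal p n σ = 1 := by
    apply (cycChar p n).injective
    rw [cycChar_resGal, hκ, map_one]
    refine Units.ext ?_
    rw [ZMod.unitsMap_val, ZMod.coe_unitOfCoprime, ZMod.cast_natCast (pow_dvd_pow p (Nat.le_succ _))]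
    push_cast
    have h1 : (p : ZMod (p ^ (n + 1))) ^ (n + 1) = 0 := by
      rw [← Nat.cast_pow, ZMod.natCast_self]
    rw [h1, add_zero]
  refine ⟨δ₀ + (MonoidAlgebra.single σ (-m) + MonoidAlgebra.single 1 m), ?_, ?_, ?_⟩
  · rw [weight_add, weight_add, weight_single, weight_single, hm, hκ, map_one, Units.val_one,
      ZMod.coe_unitOfCoprime]
    push_cast
    ring
  · rw [degree_add, degree_add, degree_single, degree_single, hd0]
    ring
  · rw [resRing, MonoidAlgebra.mapDomain_add, MonoidAlgebra.mapDomain_add,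
      MonoidAlgebra.mapDomain_single, MonoidAlgebra.mapDomain_single, hres, map_one,
      ← MonoidAlgebra.single_add, neg_add_cancel, MonoidAlgebra.single_zero, add_zero]
    exact h0

end RestrictGroupRing

/-! ### A criterion for roots of unity -/

section RootsOfUnity

variable (p n : ℕ) [hp : Fact p.Prime]

/-- The integral closure of `ℤ` is the intersection of all valuation rings. -/
theorem isIntegral_of_forall_valuationSubring {K : Type*} [Field K] {x : K}
    (h : ∀ A : ValuationSubring K, x ∈ A) : IsIntegral ℤ x := by
  have h1 : x ∈ (⨅ V : {V : ValuationSubring K // (∅ : Set K) ⊆ V.toSubring}, V.1.toSubring) :=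
    Subring.mem_iInf.mpr fun V ↦ h V.1
  rw [iInf_valuationSubring_superset] at h1
  have h2 : IsIntegral (Subring.closure (∅ : Set K)) x := h1
  have h3 : Algebra.IsIntegral ℤ (Subring.closure (∅ : Set K)) := ⟨fun y ↦ by
    obtain ⟨m, hm⟩ := Subring.mem_bot.mp ((Subring.closure_empty (R := K)).le y.2)
    rw [← Subtype.ext (a1 := (m : Subring.closure (∅ : Set K))) (a2 := y) (by simpa using hm)]
    exact isIntegral_algebraMap⟩
  exact isIntegral_trans x h2

/-- `σ_{-1}` is complex conjugation in every embedding. -/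
theorem map_sigmaNegOne (φ : Cyc p n →+* ℂ) (x : Cyc p n) :
    φ (sigmaNegOne p n x) = starRingEnd ℂ (φ x) := by
  have hζ := IsCyclotomicExtension.zeta_spec (p ^ (n + 1)) ℚ (Cyc p n)
  suffices h : (φ.comp (sigmaNegOne p n : Cyc p n →+* Cyc p n)).toRatAlgHom =
      ((starRingEnd ℂ).comp φ).toRatAlgHom from DFunLike.congr_fun h x
  refine (hζ.powerBasis ℚ).algHom_ext ?_
  rw [IsPrimitiveRoot.powerBasis_gen ℚ hζ]
  change φ (sigmaNegOne p n (IsCyclotomicExtension.zeta (p ^ (n + 1)) ℚ (Cyc p n))) =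
    starRingEnd ℂ (φ (IsCyclotomicExtension.zeta (p ^ (n + 1)) ℚ (Cyc p n)))
  set z := IsCyclotomicExtension.zeta (p ^ (n + 1)) ℚ (Cyc p n)
  have h1 : z * sigmaNegOne p n z = 1 := by
    rw [IsCyclotomicExtension.Rat.galEquivZMod_apply_of_pow_eq (p ^ (n + 1)) (Cyc p n) _
      hζ.pow_eq_one, ← pow_succ', hζ.pow_eq_one_iff_dvd, ← ZMod.natCast_eq_zero_iff, Nat.cast_succ,
      ZMod.natCast_rightInverse, sigmaNegOne, MulEquiv.apply_symm_apply, Units.val_neg,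
      Units.val_one, neg_add_cancel]
  have h2 : ‖φ z‖ = 1 := Complex.norm_eq_one_of_pow_eq_one
    (by rw [← map_pow, hζ.pow_eq_one, map_one]) (NeZero.ne (p ^ (n + 1)))
  have h3 : φ z * starRingEnd ℂ (φ z) = 1 := by
    rw [Complex.mul_conj, Complex.normSq_eq_norm_sq, h2]
    simp
  refine mul_left_cancel₀ ((map_ne_zero φ).mpr (hζ.ne_zero (NeZero.ne _))) ?_
  rw [h3, ← map_mul, h1, map_one]

/-- The hypothesis says that `x` has absolute value `1` in every embedding; `2 p ^ (n + 1)` is the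
number of roots of unity in `k_n`, as `p` is odd. -/
theorem pow_eq_one_of_integral (h2 : p ≠ 2) {x : Cyc p n} (hx : IsIntegral ℤ x)
    (h1 : x * sigmaNegOne p n x = 1) : x ^ (2 * p ^ (n + 1)) = 1 := by
  have h3 : ∀ φ : Cyc p n →+* ℂ, ‖φ x‖ = 1 := by
    intro φ
    have h4 := congrArg φ h1
    rw [map_mul, map_sigmaNegOne, map_one, Complex.mul_conj, Complex.normSq_eq_norm_sq] at h4
    have h5 : ‖φ x‖ ^ 2 = 1 := by exact_mod_cast h4
    exact (pow_eq_one_iff_of_nonneg (norm_nonneg _) two_ne_zero).mp h5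
  obtain ⟨m, hm, hxm⟩ := NumberField.Embeddings.pow_eq_one_of_norm_eq_one (Cyc p n) ℂ hx h3
  obtain ⟨y, rfl⟩ : ∃ y : 𝓞 (Cyc p n), algebraMap (𝓞 (Cyc p n)) (Cyc p n) y = x := ⟨⟨x, hx⟩, rfl⟩
  let u : (𝓞 (Cyc p n))ˣ := Units.ofPowEqOne y m
    (RingOfIntegers.coe_injective (by rw [map_pow, map_one]; exact hxm)) hm.ne'
  have hu : u ∈ NumberField.Units.torsion (Cyc p n) := by
    rw [NumberField.Units.torsion, CommGroup.mem_torsion, isOfFinOrder_iff_pow_eq_one]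
    exact ⟨m, hm, Units.pow_ofPowEqOne _ _⟩
  rw [← NumberField.Units.rootsOfUnity_eq_torsion, mem_rootsOfUnity,
    IsCyclotomicExtension.Rat.torsionOrder_eq (n := p ^ (n + 1)) (K := Cyc p n),
    if_neg (Nat.not_even_iff_odd.mpr (hp.out.odd_of_ne_two h2).pow)] at hu
  have h6 := congrArg (fun u : (𝓞 (Cyc p n))ˣ ↦ ((u : 𝓞 (Cyc p n)) : Cyc p n)) hu
  simpa [u] using h6

end RootsOfUnity

/-! ### Gauss sums of a prime of `k_{n + 1}` and of the prime below it -/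

section Under

variable (p n : ℕ) [hp : Fact p.Prime] (ζ : RootChoice)

/-- The prime of `k_n` below a prime of `k_{n + 1}`. -/
def underPrime (w : HeightOneSpectrum (𝓞 (Cyc p (n + 1)))) : HeightOneSpectrum (𝓞 (Cyc p n)) where
  asIdeal := w.asIdeal.under (𝓞 (Cyc p n))
  isPrime := inferInstance
  ne_bot := Ideal.IsIntegral.comap_ne_bot _ w.ne_bot

instance liesOver_underPrime (w : HeightOneSpectrum (𝓞 (Cyc p (n + 1)))) :
    w.asIdeal.LiesOver (underPrime p n w).asIdeal := ⟨rfl⟩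

omit hp in
theorem asIdeal_underPrime (w : HeightOneSpectrum (𝓞 (Cyc p (n + 1)))) :
    (underPrime p n w).asIdeal =
      w.asIdeal.comap (algebraMap (𝓞 (Cyc p n)) (𝓞 (Cyc p (n + 1)))) := rfl

omit hp in
theorem notMem_underPrime {w : HeightOneSpectrum (𝓞 (Cyc p (n + 1)))}
    (hw : (p : 𝓞 (Cyc p (n + 1))) ∉ w.asIdeal) :
    (p : 𝓞 (Cyc p n)) ∉ (underPrime p n w).asIdeal := by
  rwa [asIdeal_underPrime, Ideal.mem_comap, map_natCast]

/-- The exponent `s` is the residue degree of `w` over the prime below it. -/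
theorem exists_relNorm_eq (w : HeightOneSpectrum (𝓞 (Cyc p (n + 1)))) : ∃ s : ℕ,
    Ideal.relNorm (𝓞 (Cyc p n)) w.asIdeal = (underPrime p n w).asIdeal ^ s ∧
      Nat.card (𝓞 (Cyc p (n + 1)) ⧸ w.asIdeal) =
        Nat.card (𝓞 (Cyc p n) ⧸ (underPrime p n w).asIdeal) ^ s := by
  obtain ⟨s, hs⟩ := Ideal.exists_relNorm_eq_pow_of_isPrime w.asIdeal (underPrime p n w).asIdeal
  refine ⟨s, hs, ?_⟩
  have h1 := Ideal.absNorm_relNorm (𝓞 (Cyc p n)) (𝓞 (Cyc p (n + 1))) w.asIdeal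
  rw [hs, map_pow, Ideal.absNorm_apply, Ideal.absNorm_apply, Submodule.cardQuot_apply,
    Submodule.cardQuot_apply] at h1
  exact h1.symm

theorem normIdeal_primeI {w : HeightOneSpectrum (𝓞 (Cyc p (n + 1)))}
    (hw : (p : 𝓞 (Cyc p (n + 1))) ∉ w.asIdeal) {s : ℕ}
    (hs : Ideal.relNorm (𝓞 (Cyc p n)) w.asIdeal = (underPrime p n w).asIdeal ^ s) :
    normIdeal p n (primeI p (n + 1) w hw) =
      primeI p n (underPrime p n w) (notMem_underPrime p n hw) ^ s := by
  refine Subtype.ext ?_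
  have h1 : (normIdeal p n (primeI p (n + 1) w hw) : FracIdeals (Cyc p n)) =
      idealNorm (Cyc p n) (Cyc p (n + 1)) (primeUnit w) := rfl
  rw [h1, idealNorm, primeExt_primeUnit]
  refine Units.ext ?_
  rw [Units.val_mk0, hs, FractionalIdeal.coeIdeal_pow]
  rfl

/-- `χ_w ^ p = χ_v ∘ N`, where `N` is the norm of the residue field of `w` to the one of the prime
`v` below `w`. -/
theorem complexChar_underPrime {w : HeightOneSpectrum (𝓞 (Cyc p (n + 1)))}
    (hw : (p : 𝓞 (Cyc p (n + 1))) ∉ w.asIdeal)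
    (x : (𝓞 (Cyc p (n + 1)) ⧸ w.asIdeal)ˣ) (y : (𝓞 (Cyc p n) ⧸ (underPrime p n w).asIdeal)ˣ)
    (hxy : algebraMap (𝓞 (Cyc p n) ⧸ (underPrime p n w).asIdeal)
        (𝓞 (Cyc p (n + 1)) ⧸ w.asIdeal) y =
      (x : 𝓞 (Cyc p (n + 1)) ⧸ w.asIdeal) ^ ((Nat.card (𝓞 (Cyc p (n + 1)) ⧸ w.asIdeal) - 1) /
        (Nat.card (𝓞 (Cyc p n) ⧸ (underPrime p n w).asIdeal) - 1))) :
    complexChar p n (underPrime p n w) (notMem_underPrime p n hw) y =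
      complexChar p (n + 1) w hw x ^ p := by
  have hv := notMem_underPrime p n hw
  set q := Nat.card (𝓞 (Cyc p n) ⧸ (underPrime p n w).asIdeal) with hq
  set Q := Nat.card (𝓞 (Cyc p (n + 1)) ⧸ w.asIdeal) with hQ
  set a := residueChar (p ^ (n + 1)) (underPrime p n w) (coprime_of_notMem p n _ hv) y with ha
  set b := residueChar (p ^ (n + 1 + 1)) w (coprime_of_notMem p (n + 1) w hw) x with hb
  have hmap : Units.map (algebraMap (𝓞 (Cyc p n)) (𝓞 (Cyc p (n + 1)))).toMonoidHom
      (a : (𝓞 (Cyc p n))ˣ) ∈ rootsOfUnity (p ^ (n + 1 + 1)) (𝓞 (Cyc p (n + 1))) := by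
    rw [mem_rootsOfUnity, ← map_pow, pow_succ p (n + 1), pow_mul, (mem_rootsOfUnity _ _).mp a.2,
      one_pow, map_one]
  have hred := residueChar_spec (p ^ (n + 1)) (underPrime p n w) (coprime_of_notMem p n _ hv) y
  have hred' := residueChar_spec (p ^ (n + 1 + 1)) w (coprime_of_notMem p (n + 1) w hw) x
  have hexp : (Q - 1) / (q - 1) * ((q - 1) / p ^ (n + 1)) = (Q - 1) / p ^ (n + 1 + 1) * p := by
    obtain ⟨s, -, hs⟩ := exists_relNorm_eq p n w
    rw [← hQ, ← hq] at hs
    obtain ⟨e, he⟩ := (pow_card_div_pow (p ^ (n + 1)) _ (coprime_of_notMem p n _ hv)).1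
    obtain ⟨e', he'⟩ := (pow_card_div_pow (p ^ (n + 1 + 1)) _ (coprime_of_notMem p (n + 1) w hw)).1
    obtain ⟨t, ht⟩ : q - 1 ∣ Q - 1 := by
      rw [hs]
      simpa using Nat.sub_dvd_pow_sub_pow q 1 s
    rw [← hq] at he
    rw [← hQ] at he'
    have hq1 : 0 < q - 1 := Nat.sub_pos_of_lt Finite.one_lt_card
    have hP : 0 < p ^ (n + 1) := NeZero.pos _
    have hP' : 0 < p ^ (n + 1 + 1) := NeZero.pos _
    rw [ht, Nat.mul_div_cancel_left _ hq1, ← ht, he', Nat.mul_div_cancel_left _ hP', he,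
      Nat.mul_div_cancel_left _ hP]
    refine Nat.eq_of_mul_eq_mul_left hP ?_
    rw [mul_left_comm, ← he, mul_comm, ← ht, he', pow_succ]
    ring
  have key : (⟨_, hmap⟩ : rootsOfUnity (p ^ (n + 1 + 1)) (𝓞 (Cyc p (n + 1)))) = b ^ p := by
    refine Ideal.rootsOfUnityMapQuot_injective (p ^ (n + 1 + 1))
      (mt Ideal.absNorm_eq_one_iff.mp w.isPrime.ne_top) (coprime_of_notMem p (n + 1) w hw) ?_
    rw [map_pow, hred', ← pow_mul, ← hexp, inv_pow, pow_mul]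
    have h3 : Units.map (algebraMap (𝓞 (Cyc p n) ⧸ (underPrime p n w).asIdeal)
        (𝓞 (Cyc p (n + 1)) ⧸ w.asIdeal)).toMonoidHom y = x ^ ((Q - 1) / (q - 1)) :=
      Units.ext hxy
    rw [← h3, ← map_pow, ← map_inv, ← inv_pow, ← hred]
    exact Units.ext rfl
  refine Units.ext ?_
  have h4 := congrArg (fun u : rootsOfUnity (p ^ (n + 1 + 1)) (𝓞 (Cyc p (n + 1))) ↦
    cycVal p (n + 1) (((u : (𝓞 (Cyc p (n + 1)))ˣ) : 𝓞 (Cyc p (n + 1))) : Cyc p (n + 1))) key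
  rw [Units.val_pow_eq_pow_val, complexChar_val, complexChar_val, ← map_pow, ← hb, ← ha,
    ← cycVal_algebraMap_succ]
  refine Eq.trans ?_ (h4.trans ?_)
  · rfl
  · simp

theorem residuePrime_underPrime (w : HeightOneSpectrum (𝓞 (Cyc p (n + 1)))) :
    residuePrime (underPrime p n w) = residuePrime w :=
  Subtype.ext (ringChar.eq_iff.mpr (charP_of_injective_ringHom
    (f := algebraMap (𝓞 (Cyc p n) ⧸ (underPrime p n w).asIdeal) (𝓞 (Cyc p (n + 1)) ⧸ w.asIdeal))
    (RingHom.injective _) _)).symm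

/-- The product formula for the conjugates over `k_n` of a Gauss sum of a prime of `k_{n + 1}`, up to
units of `A`. The exponent `p / 2` is `(p - 1) / 2`. -/
theorem prod_valuation_complexGaussSum (h2 : p ≠ 2) (A : ValuationSubring ℂ)
    {w : HeightOneSpectrum (𝓞 (Cyc p (n + 1)))} (hw : (p : 𝓞 (Cyc p (n + 1))) ∉ w.asIdeal) {s : ℕ}
    (hs : Nat.card (𝓞 (Cyc p (n + 1)) ⧸ w.asIdeal) =
      Nat.card (𝓞 (Cyc p n) ⧸ (underPrime p n w).asIdeal) ^ s) (σ : Gal(Cyc p (n + 1)/ℚ)) :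
    ∏ ρ : Gal(Cyc p (n + 1)/Cyc p n), A.valuation (complexGaussSum p (n + 1) ζ w hw
        (cycChar p (n + 1) (inclGal p n ρ * σ) : ZMod (p ^ (n + 1 + 1))).val) =
      A.valuation (complexGaussSum p n ζ (underPrime p n w) (notMem_underPrime p n hw)
        (cycChar p n (resGal p n σ) : ZMod (p ^ (n + 1))).val) ^ s *
      A.valuation (Nat.card (𝓞 (Cyc p (n + 1)) ⧸ w.asIdeal) : ℂ) ^ (p / 2) := by
  have hv := notMem_underPrime p n hw
  have hM := (pow_card_div_pow (p ^ (n + 1)) _ (coprime_of_notMem p n _ hv)).1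
  have hN := (pow_card_div_pow (p ^ (n + 1 + 1)) _ (coprime_of_notMem p (n + 1) w hw)).1
  have hpM : p ^ (n + 1 + 1) = p * p ^ (n + 1) := by rw [pow_succ, mul_comm]
  have hroot : (ζ (residuePrime (underPrime p n w)) : ℂ) = ζ (residuePrime w) := by
    rw [residuePrime_underPrime]
  have hz₀ : IsPrimitiveRoot (ζ (residuePrime w) : ℂ)
      (ringChar (𝓞 (Cyc p n) ⧸ (underPrime p n w).asIdeal)) := by
    rw [← hroot]
    exact (ζ (residuePrime (underPrime p n w))).2
  have h3 : 2 < Nat.card (𝓞 (Cyc p n) ⧸ (underPrime p n w).asIdeal) := by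
    have h4 := Nat.le_of_dvd (Nat.sub_pos_of_lt Finite.one_lt_card) hM
    have h5 : p ≤ p ^ (n + 1) := Nat.le_self_pow (Nat.succ_ne_zero n) p
    have h6 := hp.out.two_le
    omega
  have key := prod_valuation_fieldGaussSum A (𝓞 (Cyc p n) ⧸ (underPrime p n w).asIdeal)
    (𝓞 (Cyc p (n + 1)) ⧸ w.asIdeal) hs (ζ (residuePrime w)).2 hz₀ h3 hM (hpM ▸ hN)
    (complexChar p (n + 1) w hw) (complexChar p n _ hv)
    (fun g hg ↦ hpM ▸ isPrimitiveRoot_complexChar p (n + 1) w hw hg)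
    (fun x y hxy ↦ complexChar_underPrime p n hw x y hxy)
    (fun ρ : Gal(Cyc p (n + 1)/Cyc p n) ↦
      (cycChar p (n + 1) (inclGal p n ρ * σ) : ZMod (p ^ (n + 1 + 1))).val)
    (cycChar p n (resGal p n σ) : ZMod (p ^ (n + 1))).val (p / 2)
    (fun u hu ↦ sum_mul_cycChar_mod p n σ hu.coprime_mul_right_right
      (by obtain ⟨k, hk⟩ := hp.out.odd_of_ne_two h2; omega))
  refine key.trans ?_
  congr 3
  exact fieldGaussSum_congr_root _ _ hroot.symm _ _

end Under

/-! ### Compatibility of the two norms -/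

section NormEquivariance

variable (p n : ℕ) [hp : Fact p.Prime]

theorem algebraMap_mapRingEquiv_resGal (σ : Gal(Cyc p (n + 1)/ℚ)) (z : 𝓞 (Cyc p n)) :
    algebraMap (𝓞 (Cyc p n)) (𝓞 (Cyc p (n + 1)))
        (RingOfIntegers.mapRingEquiv (resGal p n σ).toRingEquiv z) =
      RingOfIntegers.mapRingEquiv σ.toRingEquiv
        (algebraMap (𝓞 (Cyc p n)) (𝓞 (Cyc p (n + 1))) z) := by
  refine RingOfIntegers.coe_injective ?_
  exact algebraMap_resGal p n σ (z : Cyc p n)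

theorem underPrime_galPrime (σ : Gal(Cyc p (n + 1)/ℚ)) (w : HeightOneSpectrum (𝓞 (Cyc p (n + 1)))) :
    underPrime p n (galPrime p (n + 1) σ w) = galPrime p n (resGal p n σ) (underPrime p n w) := by
  refine HeightOneSpectrum.ext (Ideal.ext fun x ↦ ?_)
  rw [asIdeal_underPrime, Ideal.mem_comap, mem_galPrime, mem_galPrime]
  constructor
  · rintro ⟨y, hy, hyx⟩
    obtain ⟨z, rfl⟩ := (RingOfIntegers.mapRingEquiv (resGal p n σ).toRingEquiv).surjective x
    rw [algebraMap_mapRingEquiv_resGal] at hyx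
    rw [(RingOfIntegers.mapRingEquiv σ.toRingEquiv).injective hyx] at hy
    refine ⟨z, ?_, rfl⟩
    rwa [asIdeal_underPrime, Ideal.mem_comap]
  · rintro ⟨z, hz, rfl⟩
    rw [asIdeal_underPrime, Ideal.mem_comap] at hz
    exact ⟨_, hz, (algebraMap_mapRingEquiv_resGal p n σ z).symm⟩

/-- The ideal norm is equivariant: conjugate primes have the same residue degree. -/
theorem normIdeal_galIdeal (σ : Gal(Cyc p (n + 1)/ℚ)) (a : I p (n + 1)) :
    normIdeal p n (galIdeal p (n + 1) σ a) = galIdeal p n (resGal p n σ) (normIdeal p n a) := by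
  refine DFunLike.congr_fun (hom_ext_primeI p (n + 1)
    (f := (normIdeal p n).comp (galIdeal p (n + 1) σ))
    (g := (galIdeal p n (resGal p n σ)).comp (normIdeal p n)) fun w hw ↦ ?_) a
  obtain ⟨s, hs, hcard⟩ := exists_relNorm_eq p n w
  obtain ⟨s', hs', hcard'⟩ := exists_relNorm_eq p n (galPrime p (n + 1) σ w)
  have hss : s' = s := by
    rw [← Nat.card_congr (galResidue p (n + 1) σ w).toEquiv, underPrime_galPrime,
      ← Nat.card_congr (galResidue p n (resGal p n σ) (underPrime p n w)).toEquiv, hcard] at hcard'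
    exact (Nat.pow_right_injective Finite.one_lt_card hcard').symm
  subst hss
  rw [MonoidHom.comp_apply, MonoidHom.comp_apply, galIdeal_primeI, normIdeal_primeI p n _ hs',
    normIdeal_primeI p n hw hs, map_pow, galIdeal_primeI]
  congr 1
  exact Subtype.ext (congrArg primeUnit (underPrime_galPrime p n σ w))

variable {p n}

theorem normPost_val (f : IdealHom p (n + 1)) (a : I p (n + 1)) :
    (normPost p n f a : Cyc p (n + 1)) =
      ∏ ρ : Gal(Cyc p (n + 1)/Cyc p n), inclGal p n ρ (f a) :=
  algebraMap_norm_succ p n (f a)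

theorem normPre_val (g : IdealHom p n) (a : I p (n + 1)) :
    (normPre p n g a : Cyc p (n + 1)) =
      algebraMap (Cyc p n) (Cyc p (n + 1)) (g (normIdeal p n a)) :=
  rfl

theorem normPost_mem_equivariantHom {f : IdealHom p (n + 1)} (hf : f ∈ equivariantHom p (n + 1)) :
    normPost p n f ∈ equivariantHom p (n + 1) := by
  intro σ a
  refine Units.ext ?_
  change _ = σ (normPost p n f a)
  rw [normPost_val, normPost_val, hf, map_prod]
  refine Finset.prod_congr rfl fun ρ _ ↦ ?_
  change inclGal p n ρ (σ (f a)) = _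
  rw [← AlgEquiv.mul_apply, gal_mul_comm, AlgEquiv.mul_apply]

theorem normPre_mem_equivariantHom {g : IdealHom p n} (hg : g ∈ equivariantHom p n) :
    normPre p n g ∈ equivariantHom p (n + 1) := by
  intro σ a
  refine Units.ext ?_
  change _ = σ (normPre p n g a)
  rw [normPre_val, normPre_val, normIdeal_galIdeal, hg, ← algebraMap_resGal]
  rfl

theorem normPost_mul_sigmaNegOne {f : IdealHom p (n + 1)}
    (hf : ∀ a, f a * Units.mapEquiv (sigmaNegOne p (n + 1)).toMulEquiv (f a) = 1)
    (a : I p (n + 1)) :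
    (normPost p n f a : Cyc p (n + 1)) * sigmaNegOne p (n + 1) (normPost p n f a) = 1 := by
  rw [normPost_val, map_prod, ← Finset.prod_mul_distrib]
  refine Finset.prod_eq_one fun ρ _ ↦ ?_
  rw [← AlgEquiv.mul_apply (sigmaNegOne p (n + 1)), gal_mul_comm, AlgEquiv.mul_apply, ← map_mul]
  have h : (f a : Cyc p (n + 1)) * sigmaNegOne p (n + 1) (f a) = 1 := congrArg Units.val (hf a)
  rw [h, map_one]

theorem normPre_mul_sigmaNegOne {g : IdealHom p n}
    (hg : ∀ a, g a * Units.mapEquiv (sigmaNegOne p n).toMulEquiv (g a) = 1) (a : I p (n + 1)) :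
    (normPre p n g a : Cyc p (n + 1)) * sigmaNegOne p (n + 1) (normPre p n g a) = 1 := by
  have h : (g (normIdeal p n a) : Cyc p n) * sigmaNegOne p n (g (normIdeal p n a)) = 1 :=
    congrArg Units.val (hg _)
  rw [normPre_val, ← algebraMap_resGal, resGal_sigmaNegOne, ← map_mul, h, map_one]

end NormEquivariance

section Comparison

variable {p n : ℕ} [hp : Fact p.Prime] {ζ : RootChoice}
  {δ : MonoidAlgebra ℤ Gal(Cyc p (n + 1)/ℚ)} {f : IdealHom p (n + 1)} {g : IdealHom p n}

/-- By the product formula for Gauss sums, the two sides of the norm relation have the same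
valuations. The residue cardinality of the formula disappears since `δ` has degree `0`. -/
theorem valuation_normPost_eq (h2 : p ≠ 2) (hδ : degree p (n + 1) δ = 0)
    (hf : ∀ a, Units.map (algebraMap (Cyc p (n + 1)) (OmegaCyc p (n + 1))).toMonoidHom (f a) =
      groupRingPow p (n + 1) δ (tau p (n + 1) ζ a))
    (hg : ∀ a, Units.map (algebraMap (Cyc p n) (OmegaCyc p n)).toMonoidHom (g a) =
      groupRingPow p n (resRing p n δ) (tau p n ζ a)) (A : ValuationSubring ℂ)
    (w : HeightOneSpectrum (𝓞 (Cyc p (n + 1)))) (hw : (p : 𝓞 (Cyc p (n + 1))) ∉ w.asIdeal) :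
    A.valuation (cycVal p (n + 1) (normPost p n f (primeI p (n + 1) w hw))) =
      A.valuation (cycVal p (n + 1) (normPre p n g (primeI p (n + 1) w hw))) := by
  obtain ⟨s, hs, hcard⟩ := exists_relNorm_eq p n w
  have hv := notMem_underPrime p n hw
  set G := fun τ : Gal(Cyc p n/ℚ) ↦ A.valuation (complexGaussSum p n ζ (underPrime p n w) hv
    (cycChar p n τ : ZMod (p ^ (n + 1))).val) with hG
  set B := A.valuation (Nat.card (𝓞 (Cyc p (n + 1)) ⧸ w.asIdeal) : ℂ) ^ (p / 2) with hB
  -- `G τ` is the valuation of a conjugate of the Gauss sum of the prime below `w`, and `B` is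
  -- the valuation of the power of the residue cardinality in the product formula
  have hB0 : B ≠ 0 := pow_ne_zero _ ((Valuation.ne_zero_iff _).mpr
    (Nat.cast_ne_zero.mpr Nat.card_pos.ne'))
  have hG0 : ∀ τ, G τ ≠ 0 := fun τ ↦ by
    refine (Valuation.ne_zero_iff _).mpr ?_
    rw [← omegaCycVal_galLift_primeGaussSum, ne_eq, map_eq_zero, map_eq_zero]
    exact primeGaussSum_ne_zero p n ζ _ hv
  have hleft : A.valuation (cycVal p (n + 1) (normPost p n f (primeI p (n + 1) w hw))) =
      ∏ σ, (G (resGal p n σ) ^ s * B) ^ δ.coeff σ := by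
    rw [normPost_val, map_prod, map_prod]
    simp_rw [cycVal_galois_eq_prod hf, map_prod, map_zpow₀]
    rw [Finset.prod_comm]
    refine Finset.prod_congr rfl fun σ _ ↦ ?_
    rw [Finset.prod_zpow, prod_valuation_complexGaussSum p n ζ h2 A hw hcard σ]
  have hright : A.valuation (cycVal p (n + 1) (normPre p n g (primeI p (n + 1) w hw))) =
      ∏ τ, (G τ ^ s) ^ (resRing p n δ).coeff τ := by
    rw [normPre_val, cycVal_algebraMap_succ, normIdeal_primeI p n hw hs, map_pow,
      Units.val_pow_eq_pow_val, map_pow, cycVal_eq_prod p n ζ hg, map_pow, map_prod,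
      ← Finset.prod_pow]
    refine Finset.prod_congr rfl fun τ _ ↦ ?_
    rw [map_zpow₀, ← zpow_natCast, ← zpow_mul, mul_comm, zpow_mul, zpow_natCast]
  rw [hleft, hright, prod_resRing δ fun τ ↦ pow_ne_zero s (hG0 τ)]
  simp_rw [mul_zpow]
  rw [Finset.prod_mul_distrib, prod_zpow_eq_zpow_sum hB0, ← degree, hδ, zpow_zero, mul_one]

/-- At every prime the two homomorphisms have the same finite valuations, and archimedean absolute
values `1`, so their quotient is a root of unity. -/
theorem normPost_div_normPre_mem_rootHom (h2 : p ≠ 2) (hδ : degree p (n + 1) δ = 0)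
    (hf : ∀ a, Units.map (algebraMap (Cyc p (n + 1)) (OmegaCyc p (n + 1))).toMonoidHom (f a) =
      groupRingPow p (n + 1) δ (tau p (n + 1) ζ a))
    (hg : ∀ a, Units.map (algebraMap (Cyc p n) (OmegaCyc p n)).toMonoidHom (g a) =
      groupRingPow p n (resRing p n δ) (tau p n ζ a))
    (hfm : f ∈ jacobiMinus p (n + 1) ζ) (hgm : g ∈ jacobiMinus p n ζ) :
    normPost p n f / normPre p n g ∈ rootHom p (n + 1) := by
  refine ⟨div_mem (normPost_mem_equivariantHom hfm.1.1) (normPre_mem_equivariantHom hgm.1.1), ?_⟩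
  refine mem_of_forall_primeI p (n + 1) ((rootsOfUnity _ _).comap
    (normPost p n f / normPre p n g)) fun w hw ↦ ?_
  set x := normPost p n f (primeI p (n + 1) w hw) with hx
  set y := normPre p n g (primeI p (n + 1) w hw) with hy
  change x / y ∈ rootsOfUnity _ _
  have hint : IsIntegral ℤ (cycVal p (n + 1) ((x / y : (Cyc p (n + 1))ˣ) : Cyc p (n + 1))) := by
    refine isIntegral_of_forall_valuationSubring fun A ↦ ?_
    rw [← ValuationSubring.valuation_le_one_iff, Units.val_div_eq_div_val, map_div₀, map_div₀,
      valuation_normPost_eq h2 hδ hf hg A w hw, div_self]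
    rw [Valuation.ne_zero_iff, ne_eq, map_eq_zero]
    exact Units.ne_zero _
  rw [mem_rootsOfUnity]
  refine Units.ext ?_
  rw [Units.val_pow_eq_pow_val, Units.val_one]
  refine pow_eq_one_of_integral p (n + 1) h2 ?_ ?_
  · exact (isIntegral_algHom_iff (cycVal p (n + 1)).toIntAlgHom (cycVal p (n + 1)).injective).mp hint
  · rw [Units.val_div_eq_div_val, map_div₀, div_mul_div_comm, hx, hy, normPost_mul_sigmaNegOne,
      normPre_mul_sigmaNegOne, div_one]
    · exact fun a ↦ by rw [hgm.2, mul_inv_cancel]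
    · exact fun a ↦ by rw [hfm.2, mul_inv_cancel]

end Comparison

/-- The norm relation, from the comparison of `N ∘ δ τ_{n + 1}` and `(res δ) τ_n ∘ N` and the
surjectivity of restriction on elements of weight and degree `0`. -/
theorem map_normPost_sup_rootHom (p : ℕ) [Fact p.Prime] (hp : p ≠ 2) (ζ : RootChoice) (n : ℕ) :
    (jacobiMinus p (n + 1) ζ).map (normPost p n) ⊔ rootHom p (n + 1) =
      (jacobiMinus p n ζ).map (normPre p n) ⊔ rootHom p (n + 1) := by
  refine le_antisymm (sup_le ?_ le_sup_right) (sup_le ?_ le_sup_right)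
  · rintro _ ⟨f, hfm, rfl⟩
    obtain ⟨δ, hw, hd, hf⟩ := (mem_jacobiMinus_iff hp).mp hfm
    have hw' : weight p n (resRing p n δ) = 0 := by rw [weight_resRing, hw, map_zero]
    have hgm : jacobiHom p n ζ _ hw' ∈ jacobiMinus p n ζ :=
      (mem_jacobiMinus_iff hp).mpr ⟨_, hw', by rw [degree_resRing, hd], map_jacobiHom p n ζ _ hw'⟩
    rw [← div_mul_cancel (normPost p n f) (normPre p n (jacobiHom p n ζ _ hw'))]
    exact mul_mem (Subgroup.mem_sup_right (normPost_div_normPre_mem_rootHom hp hd hf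
      (map_jacobiHom p n ζ _ hw') hfm hgm)) (Subgroup.mem_sup_left ⟨_, hgm, rfl⟩)
  · rintro _ ⟨g, hgm, rfl⟩
    obtain ⟨ε, hw, hd, hg⟩ := (mem_jacobiMinus_iff hp).mp hgm
    obtain ⟨δ, hw', hd', rfl⟩ := exists_resRing_eq p n ε hw hd
    have hfm : jacobiHom p (n + 1) ζ δ hw' ∈ jacobiMinus p (n + 1) ζ :=
      (mem_jacobiMinus_iff hp).mpr ⟨δ, hw', hd', map_jacobiHom p (n + 1) ζ δ hw'⟩
    rw [← div_div_self' (normPost p n (jacobiHom p (n + 1) ζ δ hw')) (normPre p n g)]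
    exact div_mem (Subgroup.mem_sup_left ⟨_, hfm, rfl⟩)
      (Subgroup.mem_sup_right (normPost_div_normPre_mem_rootHom hp hd'
        (map_jacobiHom p (n + 1) ζ δ hw') hg hfm hgm))

end JacobiNorm

end

theorem mainTheorem6 (p : ℕ) [Fact p.Prime] (hp : p ≠ 2) (ζ : JacobiNorm.RootChoice) (n : ℕ) :
    (JacobiNorm.jacobiMinus p (n + 1) ζ).map (JacobiNorm.normPost p n) ⊔
        JacobiNorm.rootHom p (n + 1) =
      (JacobiNorm.jacobiMinus p n ζ).map (JacobiNorm.normPre p n) ⊔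
        JacobiNorm.rootHom p (n + 1) :=
  JacobiNorm.map_normPost_sup_rootHom p hp ζ n
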